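/- Let $H\subseteq J\subseteq G$ be finite subgroups of the circle group $S^1\subset\mathbb C^\times$. For a finite group $K$, let $\mathcal A_{\mathbb N}^K$ be the Burnside category whose objects are finite $K$-sets and whose morphisms are isomorphism classes of spans, composed by pullback. A $K$-Mackey functor is a product-preserving functor from $\mathcal A_{\mathbb N}^K$ to sets, all of whose values (which are commutative monoids) are abelian groups. The box product $\Box$ is Day convolution with respect to the cartesian product of finite $K$-sets, and a commutative $K$-Green functor is a commutative monoid for $\Box$. For $K\subseteq L$, the norm $N_K^L$ is the left Kan extension along coinduction $T\mapsto \mathrm{Map}_K(L,T)$, and the restriction $i_K^*$ is given by $(i_K^*M)(T)=M(L\times_K T)$. Both take commutative Green functors to commutative Green functors. For a finite subgroup $L$ of $S^1$ let $g=e^{2\pi i/|L|}$ be its standard generator. For $K\subseteq L$ and a commutative $K$-Green functor $R$, the $L$-twisted cyclic nerve relative to $K$ is the simplicial commutative $L$-Green functor $HC^L_K(R)_\bullet$ with $n$-simplices $$HC^L_K(R)_n={}^gM\,\Box\, M^{\Box n}=M^{\Box(n+1)},\qquad M=N_K^L R .$$ Number the factors $0,\dots,n$. For $0\le i<n$ the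 face $d_i$ multiplies the factors $i$ and $i+1$; the face $d_n$ rotates the last factor to the front, acts on it by $g$ (the Weyl action, given by restriction along multiplication by $g$ on finite $L$-sets), and multiplies it into the factor $0$; the degeneracy $s_i$ inserts the unit after the factor $i$. For $r\ge 1$ let $\mathrm{sd}_r$ denote $r$-fold edgewise subdivision of simplicial objects, that is, precomposition with the endofunctor of the simplex category given by $[m]\mapsto[r(m+1)-1]$ and, for $f\colon[m]\to[n]$, by $a(m+1)+b\mapsto a(n+1)+f(b)$ for $0\le a<r$, $0\le b\le m$. Then there is a map of simplicial commutative $J$-Green functors $$i_J^*\bigl(HC^G_H(R)_\bullet\bigr)\longrightarrow \mathrm{sd}_{[G:J]}\bigl(HC^J_H(R)_\bullet\bigr),$$ natural in the commutative $H$-Green functor $R$, that is a quasi-isomorphism for every $R$: it induces isomorphisms on the homology $J$-Mackey functors of the normalized chain complexes of the underlying simplicial Mackey functors. -/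

import Mathlib

open CategoryTheory

universe u w

namespace TwistedNerve

/-! ## Finite `G`-sets and the Burnside category -/

/-- A finite `G`-set. -/
structure FinGSet (G : Type) [Group G] where
  carrier : Type u
  [act : MulAction G carrier]
  [fin : Finite carrier]

attribute [instance] FinGSet.act FinGSet.fin

instance {G : Type} [Group G] : CoeSort (FinGSet.{u} G) (Type u) := ⟨FinGSet.carrier⟩

/-- The commutative square `f ∘ p = g ∘ q` is a pullback square. -/
def IsPB {W U V T : Type u} (p : W → U) (q : W → V) (f : U → T) (g : V → T) : Prop :=
  (∀ x, f (p x) = g (q x)) ∧ ∀ a b, f a = g b → ∃! x, p x = a ∧ q x = b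

section Burnside

variable {G : Type} [Group G]

/-- A span `S ← U → T` of finite `G`-sets. -/
structure GSpan (S T : FinGSet.{u} G) where
  apex : FinGSet.{u} G
  l : apex →[G] S
  r : apex →[G] T

/-- Two spans are isomorphic if there is an isomorphism of their apices over `S` and `T`. -/
def GSpan.IsIso {S T : FinGSet.{u} G} (U V : GSpan S T) : Prop :=
  ∃ e : U.apex →[G] V.apex, Function.Bijective e ∧ (∀ x, V.l (e x) = U.l x) ∧
    ∀ x, V.r (e x) = U.r x

lemma bij_inv {S T : FinGSet.{u} G} (e : S →[G] T) (he : Function.Bijective e) :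
    ∃ i : T →[G] S, Function.Bijective i ∧ (∀ x, e (i x) = x) ∧ ∀ x, i (e x) = x := by
  obtain ⟨g, hg1, hg2⟩ := Function.bijective_iff_has_inverse.1 he
  refine ⟨⟨g, fun m x => ?_⟩, ⟨hg2.injective, hg1.surjective⟩, hg2, hg1⟩
  apply he.1
  rw [hg2, map_smul, id, hg2]

instance GSpan.setoid (S T : FinGSet.{u} G) : Setoid (GSpan S T) where
  r := GSpan.IsIso
  iseqv :=
    { refl := fun U => ⟨.id G, Function.bijective_id, fun _ => rfl, fun _ => rfl⟩
      symm := by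
        rintro U V ⟨e, he, h1, h2⟩
        obtain ⟨i, hi, h3, _⟩ := bij_inv e he
        exact ⟨i, hi, fun x => by rw [← h1, h3], fun x => by rw [← h2, h3]⟩
      trans := by
        rintro U V W ⟨e, he, h1, h2⟩ ⟨e', he', h1', h2'⟩
        exact ⟨e'.comp e, he'.comp he, fun x => by simp [h1, h1'], fun x => by simp [h2, h2']⟩ }

/-- The fibre product of finite `G`-sets. -/
def FinGSet.pb {U V T : FinGSet.{u} G} (f : U →[G] T) (g : V →[G] T) : FinGSet.{u} G :=
  letI : MulAction G {p : U × V // f p.1 = g p.2} :=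
    { smul := fun m p => ⟨m • p.1, by simp [p.2]⟩
      one_smul := fun p => Subtype.ext (one_smul G p.1)
      mul_smul := fun m n p => Subtype.ext (mul_smul m n p.1) }
  ⟨{p : U × V // f p.1 = g p.2}⟩

def FinGSet.pbFst {U V T : FinGSet.{u} G} (f : U →[G] T) (g : V →[G] T) :
    FinGSet.pb f g →[G] U := ⟨fun p => p.1.1, fun _ _ => rfl⟩

def FinGSet.pbSnd {U V T : FinGSet.{u} G} (f : U →[G] T) (g : V →[G] T) :
    FinGSet.pb f g →[G] V := ⟨fun p => p.1.2, fun _ _ => rfl⟩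

/-- Composition of spans by pullback. -/
def GSpan.comp {S T W : FinGSet.{u} G} (U : GSpan S T) (V : GSpan T W) : GSpan S W :=
  ⟨FinGSet.pb U.r V.l, U.l.comp (FinGSet.pbFst _ _), V.r.comp (FinGSet.pbSnd _ _)⟩

lemma isPB_pb {U V T : FinGSet.{u} G} (f : U →[G] T) (g : V →[G] T) :
    IsPB (FinGSet.pbFst f g) (FinGSet.pbSnd f g) f g :=
  ⟨fun x => x.2, fun a b h => ⟨⟨(a, b), h⟩, ⟨rfl, rfl⟩, fun _ hy =>
    Subtype.ext (Prod.ext hy.1 hy.2)⟩⟩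

/-- Any span whose apex is a pullback represents the composite. -/
lemma GSpan.comp_isIso {S T W : FinGSet.{u} G} (U : GSpan S T) (V : GSpan T W) (X : GSpan S W)
    (p : X.apex →[G] U.apex) (q : X.apex →[G] V.apex) (h : IsPB p q U.r V.l)
    (hl : ∀ x, U.l (p x) = X.l x) (hr : ∀ x, V.r (q x) = X.r x) : (U.comp V) ≈ X := by
  refine Setoid.symm ⟨⟨fun x => ⟨(p x, q x), h.1 x⟩, fun m x =>
    Subtype.ext (Prod.ext (map_smul p m x) (map_smul q m x))⟩, ⟨fun x y hxy => ?_, fun y => ?_⟩,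
    hl, hr⟩
  · have h1 := congrArg (fun z => z.1.1) hxy
    have h2 := congrArg (fun z => z.1.2) hxy
    exact (h.2 (p y) (q y) (h.1 y)).unique ⟨h1, h2⟩ ⟨rfl, rfl⟩
  · obtain ⟨x, ⟨h1, h2⟩, _⟩ := h.2 y.1.1 y.1.2 y.2
    exact ⟨x, Subtype.ext (Prod.ext h1 h2)⟩

lemma GSpan.comp_congr {S T W : FinGSet.{u} G} {U U' : GSpan S T} {V V' : GSpan T W}
    (hU : U ≈ U') (hV : V ≈ V') : U.comp V ≈ U'.comp V' := by
  obtain ⟨e, he, h1, h2⟩ := Setoid.symm hU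
  obtain ⟨e', he', h1', h2'⟩ := Setoid.symm hV
  refine GSpan.comp_isIso U V (U'.comp V') (e.comp (FinGSet.pbFst _ _))
    (e'.comp (FinGSet.pbSnd _ _)) ⟨fun x => ?_, fun a b hab => ?_⟩ (fun x => h1 _) (fun x => h2' _)
  · exact (h2 _).trans (((isPB_pb U'.r V'.l).1 x).trans (h1' _).symm)
  · obtain ⟨a, rfl⟩ := he.2 a
    obtain ⟨b, rfl⟩ := he'.2 b
    rw [h2, h1'] at hab
    refine ⟨⟨(a, b), hab⟩, ⟨rfl, rfl⟩, fun y hy => Subtype.ext (Prod.ext ?_ ?_)⟩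
    · exact he.1 hy.1
    · exact he'.1 hy.2

/-- The Burnside category `𝒜_ℕ`: objects are finite `G`-sets, morphisms are isomorphism classes of
spans, composition is by pullback. -/
instance : Category (FinGSet.{u} G) where
  Hom S T := Quotient (GSpan.setoid S T)
  id S := Quotient.mk _ ⟨S, .id G, .id G⟩
  comp := Quotient.map₂ GSpan.comp fun _ _ h _ _ h' => GSpan.comp_congr h h'
  id_comp := by
    rintro S T ⟨U⟩
    exact Quotient.sound (GSpan.comp_isIso _ U U U.l (.id G)
      ⟨fun _ => rfl, fun _ b h => ⟨b, ⟨h.symm, rfl⟩, fun _ hy => hy.2⟩⟩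
      (fun _ => rfl) (fun _ => rfl))
  comp_id := by
    rintro S T ⟨U⟩
    exact Quotient.sound (GSpan.comp_isIso U _ U (.id G) U.r
      ⟨fun _ => rfl, fun a _ h => ⟨a, ⟨rfl, h⟩, fun _ hy => hy.1⟩⟩
      (fun _ => rfl) (fun _ => rfl))
  assoc := by
    rintro A B C D ⟨U⟩ ⟨V⟩ ⟨W⟩
    refine Quotient.sound (GSpan.comp_isIso (U.comp V) W (U.comp (V.comp W))
      ⟨fun x => ⟨(x.1.1, x.1.2.1.1), x.2⟩, fun _ _ => rfl⟩
      ⟨fun x => x.1.2.1.2, fun _ _ => rfl⟩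
      ⟨fun x => x.1.2.2, fun a b h => ⟨⟨(a.1.1, ⟨(a.1.2, b), h⟩), a.2⟩, ⟨rfl, rfl⟩, ?_⟩⟩
      (fun _ => rfl) (fun _ => rfl))
    rintro y ⟨rfl, rfl⟩
    rfl

/-- The class of a span. -/
def GSpan.mk' {S T : FinGSet.{u} G} (U : GSpan S T) : S ⟶ T := Quotient.mk _ U

lemma exists_span {S T : FinGSet.{u} G} (f : S ⟶ T) : ∃ U : GSpan S T, f = U.mk' :=
  (Quotient.exists_rep f).imp fun _ h => h.symm

/-- The covariant (transfer) morphism `[S = S → T]`. -/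
def tr {S T : FinGSet.{u} G} (f : S →[G] T) : S ⟶ T := GSpan.mk' ⟨S, .id G, f⟩

/-- The contravariant (restriction) morphism `[T ← S = S]`. -/
def res {S T : FinGSet.{u} G} (f : S →[G] T) : T ⟶ S := GSpan.mk' ⟨S, f, .id G⟩

lemma comp_mk' {S T W : FinGSet.{u} G} (U : GSpan S T) (V : GSpan T W) (X : GSpan S W)
    (p : X.apex →[G] U.apex) (q : X.apex →[G] V.apex) (h : IsPB p q U.r V.l)
    (hl : ∀ x, U.l (p x) = X.l x) (hr : ∀ x, V.r (q x) = X.r x) : U.mk' ≫ V.mk' = X.mk' :=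
  Quotient.sound (GSpan.comp_isIso U V X p q h hl hr)

lemma mk'_eq {S T : FinGSet.{u} G} (U : GSpan S T) : U.mk' = res U.l ≫ tr U.r :=
  (comp_mk' ⟨U.apex, U.l, .id G⟩ ⟨U.apex, .id G, U.r⟩ U (.id G) (.id G)
    ⟨fun _ => rfl, fun a _ h => ⟨a, ⟨rfl, h⟩, fun _ hy => hy.1⟩⟩
    (fun _ => rfl) (fun _ => rfl)).symm

lemma tr_id (S : FinGSet.{u} G) : tr (.id G : S →[G] S) = 𝟙 S := rfl
lemma res_id (S : FinGSet.{u} G) : res (.id G : S →[G] S) = 𝟙 S := rfl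

lemma tr_comp {S T W : FinGSet.{u} G} (f : S →[G] T) (g : T →[G] W) :
    tr (g.comp f) = tr f ≫ tr g :=
  (comp_mk' ⟨S, .id G, f⟩ ⟨T, .id G, g⟩ ⟨S, .id G, g.comp f⟩ (.id G) f
    ⟨fun _ => rfl, fun a _ h => ⟨a, ⟨rfl, h⟩, fun _ hy => hy.1⟩⟩
    (fun _ => rfl) (fun _ => rfl)).symm

lemma res_comp {S T W : FinGSet.{u} G} (f : S →[G] T) (g : T →[G] W) :
    res (g.comp f) = res g ≫ res f :=
  (comp_mk' ⟨T, g, .id G⟩ ⟨S, f, .id G⟩ ⟨S, g.comp f, .id G⟩ f (.id G)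
    ⟨fun _ => rfl, fun _ b h => ⟨b, ⟨h.symm, rfl⟩, fun _ hy => hy.2⟩⟩
    (fun _ => rfl) (fun _ => rfl)).symm

/-- The base change (double coset) formula. -/
lemma base_change {W U V T : FinGSet.{u} G} (p : W →[G] U) (q : W →[G] V) (f : U →[G] T)
    (g : V →[G] T) (h : IsPB p q f g) : tr f ≫ res g = res p ≫ tr q := by
  rw [← mk'_eq ⟨W, p, q⟩]
  exact comp_mk' _ _ ⟨W, p, q⟩ p q h (fun _ => rfl) (fun _ => rfl)

/-- A transfer along an isomorphism is inverse to the restriction. -/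
lemma tr_res_of_bij {S T : FinGSet.{u} G} (f : S →[G] T) (hf : Function.Bijective f) :
    tr f ≫ res f = 𝟙 S ∧ res f ≫ tr f = 𝟙 T := by
  constructor
  · rw [base_change (.id G) (.id G) f f
      ⟨fun _ => rfl, fun a _ h => ⟨a, ⟨rfl, hf.1 h⟩, fun _ hy => hy.1⟩⟩, res_id, tr_id,
      Category.comp_id]
  · rw [← mk'_eq ⟨S, f, f⟩]
    exact Quotient.sound ⟨f, hf, fun _ => rfl, fun _ => rfl⟩

end Burnside

/-! ## Mackey functors -/

section Mackey

variable {G : Type} [Group G]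

/-- The empty `G`-set. -/
def FinGSet.empty (G : Type) [Group G] : FinGSet.{u} G :=
  letI : MulAction G PEmpty.{u + 1} :=
    { smul := fun _ x => x, one_smul := fun _ => rfl, mul_smul := fun _ _ _ => rfl }
  ⟨PEmpty.{u + 1}⟩

/-- The disjoint union of finite `G`-sets. -/
def FinGSet.sum (S T : FinGSet.{u} G) : FinGSet.{u} G :=
  letI : MulAction G (S ⊕ T) :=
    { smul := fun g => Sum.map (g • ·) (g • ·)
      one_smul := by
        rintro (x | x)
        · exact congrArg Sum.inl (one_smul G x)
        · exact congrArg Sum.inr (one_smul G x)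
      mul_smul := by
        rintro g h (x | x)
        · exact congrArg Sum.inl (mul_smul g h x)
        · exact congrArg Sum.inr (mul_smul g h x) }
  ⟨S ⊕ T⟩

def FinGSet.fromEmpty (T : FinGSet.{u} G) : FinGSet.empty G →[G] T :=
  ⟨fun x => PEmpty.elim x, fun _ x => PEmpty.elim x⟩

def FinGSet.inl (S T : FinGSet.{u} G) : S →[G] S.sum T := ⟨Sum.inl, fun _ _ => rfl⟩

def FinGSet.inr (S T : FinGSet.{u} G) : T →[G] S.sum T := ⟨Sum.inr, fun _ _ => rfl⟩

def FinGSet.sumElim {S T W : FinGSet.{u} G} (f : S →[G] W) (g : T →[G] W) : S.sum T →[G] W :=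
  ⟨fun x => Sum.elim f g x, by
    rintro m (x | x)
    · exact map_smul f m x
    · exact map_smul g m x⟩

def FinGSet.fold (T : FinGSet.{u} G) : T.sum T →[G] T := FinGSet.sumElim (.id G) (.id G)

/-- A semi-Mackey functor is a functor from the Burnside category to sets that preserves finite
products: in the Burnside category the empty set is terminal, and `S ⊔ T` is the product of `S` and
`T` with the restrictions along the two inclusions as projections. -/
structure IsSemiMackey (M : FinGSet.{u} G ⥤ Type w) : Prop where
  empty : ∃ z : M.obj (FinGSet.empty G), ∀ x, x = z
  sum : ∀ S T : FinGSet.{u} G, Function.Bijective fun x : M.obj (S.sum T) =>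
    (M.map (res (FinGSet.inl S T)) x, M.map (res (FinGSet.inr S T)) x)

lemma isPB_inl {S T S' T' : FinGSet.{u} G} (f : S →[G] S') (g : T →[G] T') :
    IsPB f (FinGSet.inl S T) (FinGSet.inl S' T')
      (FinGSet.sumElim ((FinGSet.inl S' T').comp f) ((FinGSet.inr S' T').comp g)) := by
  refine ⟨fun _ => rfl, ?_⟩
  rintro a (b | b) h
  · exact ⟨b, ⟨(Sum.inl_injective h).symm, rfl⟩, fun y hy => Sum.inl_injective hy.2⟩
  · cases h

lemma isPB_inr {S T S' T' : FinGSet.{u} G} (f : S →[G] S') (g : T →[G] T') :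
    IsPB g (FinGSet.inr S T) (FinGSet.inr S' T')
      (FinGSet.sumElim ((FinGSet.inl S' T').comp f) ((FinGSet.inr S' T').comp g)) := by
  refine ⟨fun _ => rfl, ?_⟩
  rintro a (b | b) h
  · cases h
  · exact ⟨b, ⟨(Sum.inr_injective h).symm, rfl⟩, fun y hy => Sum.inr_injective hy.2⟩

lemma IsPB.swap {W U V T : Type u} {p : W → U} {q : W → V} {f : U → T} {g : V → T}
    (h : IsPB p q f g) : IsPB q p g f :=
  ⟨fun x => (h.1 x).symm, fun a b hab => by
    obtain ⟨x, hx, hu⟩ := h.2 b a hab.symm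
    exact ⟨x, hx.symm, fun y hy => hu y hy.symm⟩⟩

namespace IsSemiMackey

variable {M : FinGSet.{u} G ⥤ Type w}

/-- The element of `M(S ⊔ T)` with given restrictions. -/
noncomputable def pair (hM : IsSemiMackey M) {S T : FinGSet.{u} G} (a : M.obj S) (b : M.obj T) : M.obj (S.sum T) :=
  ((hM.sum S T).2 (a, b)).choose

lemma inl_pair (hM : IsSemiMackey M) {S T : FinGSet.{u} G} (a : M.obj S) (b : M.obj T) :
    M.map (res (FinGSet.inl S T)) (hM.pair a b) = a :=
  congrArg Prod.fst ((hM.sum S T).2 (a, b)).choose_spec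

lemma inr_pair (hM : IsSemiMackey M) {S T : FinGSet.{u} G} (a : M.obj S) (b : M.obj T) :
    M.map (res (FinGSet.inr S T)) (hM.pair a b) = b :=
  congrArg Prod.snd ((hM.sum S T).2 (a, b)).choose_spec

lemma hom_ext (hM : IsSemiMackey M) {S T : FinGSet.{u} G} {x y : M.obj (S.sum T)}
    (h1 : M.map (res (FinGSet.inl S T)) x = M.map (res (FinGSet.inl S T)) y)
    (h2 : M.map (res (FinGSet.inr S T)) x = M.map (res (FinGSet.inr S T)) y) : x = y :=
  (hM.sum S T).1 (Prod.ext h1 h2)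

/-- The sum of two elements of `M(T)`. -/
noncomputable def add (hM : IsSemiMackey M) {T : FinGSet.{u} G} (a b : M.obj T) : M.obj T :=
  M.map (tr (FinGSet.fold T)) (hM.pair a b)

/-- The zero of `M(T)`. -/
noncomputable def zero (hM : IsSemiMackey M) (T : FinGSet.{u} G) : M.obj T :=
  M.map (tr (FinGSet.fromEmpty T)) hM.empty.choose

lemma tr_elim (hM : IsSemiMackey M) {S T W : FinGSet.{u} G} (f : S →[G] W) (g : T →[G] W) (a : M.obj S) (b : M.obj T) :
    M.map (tr (FinGSet.sumElim f g)) (hM.pair a b) =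
      hM.add (M.map (tr f) a) (M.map (tr g) b) := by
  have h : FinGSet.sumElim f g = (FinGSet.fold W).comp
      (FinGSet.sumElim ((FinGSet.inl W W).comp f) ((FinGSet.inr W W).comp g)) := by
    ext (x | x) <;> rfl
  rw [h, tr_comp, Functor.map_comp_apply, add]
  congr 1
  apply hM.hom_ext
  · rw [inl_pair, ← Functor.map_comp_apply, base_change _ _ _ _ (isPB_inl f g).swap,
      Functor.map_comp_apply, inl_pair]
  · rw [inr_pair, ← Functor.map_comp_apply, base_change _ _ _ _ (isPB_inr f g).swap,
      Functor.map_comp_apply, inr_pair]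

lemma tr_add (hM : IsSemiMackey M) {S T : FinGSet.{u} G} (f : S →[G] T) (a b : M.obj S) :
    M.map (tr f) (hM.add a b) = hM.add (M.map (tr f) a) (M.map (tr f) b) := by
  have h : f.comp (FinGSet.fold S) = FinGSet.sumElim f f := by
    ext (x | x) <;> rfl
  rw [← tr_elim, add, ← Functor.map_comp_apply, ← tr_comp, h]

lemma res_add (hM : IsSemiMackey M) {S T : FinGSet.{u} G} (f : S →[G] T) (a b : M.obj T) :
    M.map (res f) (hM.add a b) = hM.add (M.map (res f) a) (M.map (res f) b) := by
  let f2 := FinGSet.sumElim ((FinGSet.inl T T).comp f) ((FinGSet.inr T T).comp f)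
  have h : IsPB f2 (FinGSet.fold S) (FinGSet.fold T) f := by
    refine ⟨by rintro (x | x) <;> rfl, ?_⟩
    rintro (a | a) b hab
    · refine ⟨Sum.inl b, ⟨congrArg Sum.inl hab.symm, rfl⟩, ?_⟩
      rintro (y | y) ⟨h1, h2⟩
      · exact congrArg Sum.inl h2
      · cases h1
    · refine ⟨Sum.inr b, ⟨congrArg Sum.inr hab.symm, rfl⟩, ?_⟩
      rintro (y | y) ⟨h1, h2⟩
      · cases h1
      · exact congrArg Sum.inr h2
  rw [add, ← Functor.map_comp_apply, base_change _ _ _ _ h, Functor.map_comp_apply, add]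
  congr 1
  apply hM.hom_ext
  · rw [inl_pair, ← Functor.map_comp_apply, ← res_comp]
    exact (congrFun (congrArg (fun k => ⇑(ConcreteCategory.hom (M.map k)))
      (res_comp f (FinGSet.inl T T))) _).trans
        ((Functor.map_comp_apply _ _ _ _).trans (congrArg _ (hM.inl_pair a b)))
  · rw [inr_pair, ← Functor.map_comp_apply, ← res_comp]
    exact (congrFun (congrArg (fun k => ⇑(ConcreteCategory.hom (M.map k)))
      (res_comp f (FinGSet.inr T T))) _).trans
        ((Functor.map_comp_apply _ _ _ _).trans (congrArg _ (hM.inr_pair a b)))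

/-- Every morphism of the Burnside category acts additively. -/
lemma map_add (hM : IsSemiMackey M) {S T : FinGSet.{u} G} (f : S ⟶ T) (a b : M.obj S) :
    M.map f (hM.add a b) = hM.add (M.map f a) (M.map f b) := by
  obtain ⟨U, rfl⟩ := exists_span f
  rw [mk'_eq]
  simp only [Functor.map_comp_apply, hM.res_add, hM.tr_add]

lemma map_zero (hM : IsSemiMackey M) {S T : FinGSet.{u} G} (f : S ⟶ T) : M.map f (hM.zero S) = hM.zero T := by
  obtain ⟨U, rfl⟩ := exists_span f
  have h : IsPB (FinGSet.fromEmpty (FinGSet.empty G)) (FinGSet.fromEmpty U.apex)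
      (FinGSet.fromEmpty S) U.l :=
    ⟨fun x => PEmpty.elim x, fun x => PEmpty.elim x⟩
  have h' : U.r.comp (FinGSet.fromEmpty U.apex) = FinGSet.fromEmpty T := by
    ext x
    exact PEmpty.elim x
  rw [mk'_eq, zero, ← Functor.map_comp_apply, ← Category.assoc, base_change _ _ _ _ h,
    Category.assoc, ← tr_comp, Functor.map_comp_apply, hM.empty.choose_spec (M.map _ _), h', zero]

lemma add_comm' (hM : IsSemiMackey M) {T : FinGSet.{u} G} (a b : M.obj T) : hM.add a b = hM.add b a := by
  let s : T.sum T →[G] T.sum T := FinGSet.sumElim (FinGSet.inr T T) (FinGSet.inl T T)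
  have h : hM.pair b a = M.map (res s) (hM.pair a b) := by
    apply hM.hom_ext
    · rw [inl_pair, ← Functor.map_comp_apply, ← res_comp]
      exact (hM.inr_pair a b).symm
    · rw [inr_pair, ← Functor.map_comp_apply, ← res_comp]
      exact (hM.inl_pair a b).symm
  have hs : Function.Bijective s := by
    refine Function.bijective_iff_has_inverse.2 ⟨s, ?_, ?_⟩ <;> rintro (x | x) <;> rfl
  have h2 : FinGSet.fold T = (FinGSet.fold T).comp s := by
    ext (x | x) <;> rfl
  conv_rhs => rw [add, h, h2, tr_comp, ← Functor.map_comp_apply, ← Category.assoc,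
    (tr_res_of_bij s hs).2, Category.id_comp]
  rfl

lemma zero_add' (hM : IsSemiMackey M) {T : FinGSet.{u} G} (a : M.obj T) : hM.add (hM.zero T) a = a := by
  have h := hM.tr_elim (FinGSet.fromEmpty T) (.id G) hM.empty.choose a
  rw [tr_id, Functor.map_id_apply] at h
  refine h.symm.trans ?_
  have hb : Function.Bijective (FinGSet.sumElim (FinGSet.fromEmpty T) (.id G)) := by
    refine Function.bijective_iff_has_inverse.2 ⟨Sum.inr, ?_, fun _ => rfl⟩
    rintro (x | x)
    · exact PEmpty.elim x
    · rfl
  have h2 : hM.pair hM.empty.choose a =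
      M.map (res (FinGSet.sumElim (FinGSet.fromEmpty T) (.id G))) a := by
    apply hM.hom_ext
    · exact (hM.empty.choose_spec _).trans (hM.empty.choose_spec _).symm
    · rw [inr_pair, ← Functor.map_comp_apply, ← res_comp]
      exact (Functor.map_id_apply M T a).symm
  rw [h2, ← Functor.map_comp_apply, (tr_res_of_bij _ hb).2, Functor.map_id_apply]

lemma add_assoc' (hM : IsSemiMackey M) {T : FinGSet.{u} G} (a b c : M.obj T) :
    hM.add (hM.add a b) c = hM.add a (hM.add b c) := by
  have h1 := hM.tr_elim (FinGSet.fold T) (.id G) (hM.pair a b) c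
  have h2 := hM.tr_elim (.id G) (FinGSet.fold T) a (hM.pair b c)
  rw [tr_id, Functor.map_id_apply] at h1 h2
  refine h1.symm.trans (Eq.trans ?_ h2)
  let s : (T.sum T).sum T →[G] T.sum (T.sum T) :=
    FinGSet.sumElim (FinGSet.sumElim (FinGSet.inl _ _) ((FinGSet.inr _ _).comp (FinGSet.inl _ _)))
      ((FinGSet.inr _ _).comp (FinGSet.inr _ _))
  have hs : Function.Bijective s := by
    refine Function.bijective_iff_has_inverse.2 ⟨fun x => Sum.elim (Sum.inl ∘ Sum.inl)
      (Sum.elim (Sum.inl ∘ Sum.inr) Sum.inr) x, ?_, ?_⟩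
    · rintro ((x | x) | x) <;> rfl
    · rintro (x | x | x) <;> rfl
  have h : hM.pair (hM.pair a b) c = M.map (res s) (hM.pair a (hM.pair b c)) := by
    apply hM.hom_ext
    · apply hM.hom_ext
      · rw [inl_pair, inl_pair, ← Functor.map_comp_apply, ← res_comp, ← Functor.map_comp_apply,
          ← res_comp]
        exact (hM.inl_pair a _).symm
      · rw [inl_pair, inr_pair, ← Functor.map_comp_apply, ← res_comp, ← Functor.map_comp_apply,
          ← res_comp]
        refine Eq.trans ?_ (congrFun (congrArg (fun k => ⇑(ConcreteCategory.hom (M.map k)))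
          (res_comp (FinGSet.inl T T) (FinGSet.inr T (T.sum T)))) _).symm
        rw [Functor.map_comp_apply, inr_pair, inl_pair]
    · rw [inr_pair, ← Functor.map_comp_apply, ← res_comp]
      refine Eq.trans ?_ (congrFun (congrArg (fun k => ⇑(ConcreteCategory.hom (M.map k)))
          (res_comp (FinGSet.inr T T) (FinGSet.inr T (T.sum T)))) _).symm
      rw [Functor.map_comp_apply, inr_pair, inr_pair]
  have h3 : FinGSet.sumElim (FinGSet.fold T) (.id G) =
      (FinGSet.sumElim (.id G) (FinGSet.fold T)).comp s := by
    ext ((x | x) | x) <;> rfl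
  rw [h, h3, tr_comp, ← Functor.map_comp_apply, ← Category.assoc, (tr_res_of_bij s hs).2,
    Category.id_comp]

/-- Natural transformations are additive. -/
lemma app_add (hM : IsSemiMackey M) {N : FinGSet.{u} G ⥤ Type w} (hN : IsSemiMackey N) (f : M ⟶ N)
    {T : FinGSet.{u} G} (a b : M.obj T) :
    f.app T (hM.add a b) = hN.add (f.app T a) (f.app T b) := by
  rw [add, add, NatTrans.naturality_apply]
  congr 1
  apply hN.hom_ext
  · rw [inl_pair, ← NatTrans.naturality_apply, inl_pair]
  · rw [inr_pair, ← NatTrans.naturality_apply, inr_pair]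

end IsSemiMackey

/-- A Mackey functor is a semi-Mackey functor whose values, which are commutative monoids under
`IsSemiMackey.add`, are all groups. -/
def IsMackey (M : FinGSet.{u} G ⥤ Type w) : Prop :=
  ∃ h : IsSemiMackey M, ∀ (T : FinGSet.{u} G) (a : M.obj T), ∃ b, h.add a b = h.zero T

/-- The abelian group structure on the values of a Mackey functor. -/
noncomputable abbrev IsMackey.addCommGroup {M : FinGSet.{u} G ⥤ Type w} (hM : IsMackey M)
    (T : FinGSet.{u} G) : AddCommGroup (M.obj T) :=
  letI : Add (M.obj T) := ⟨hM.choose.add⟩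
  letI : Zero (M.obj T) := ⟨hM.choose.zero T⟩
  letI : Neg (M.obj T) := ⟨fun a => (hM.choose_spec T a).choose⟩
  { AddGroup.ofLeftAxioms (G := M.obj T) hM.choose.add_assoc' hM.choose.zero_add'
      fun a => (hM.choose.add_comm' _ a).trans (hM.choose_spec T a).choose_spec with
    add_comm := hM.choose.add_comm' }

/-- The category of Mackey functors, a full subcategory of the category of functors from the
Burnside category to sets. -/
abbrev Mack (G : Type) [Group G] := ObjectProperty.FullSubcategory (IsMackey.{u, w} (G := G))

end Mackey

/-! ## Left Kan extensions of set-valued functors -/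

section Lan

variable {C D : Type w} [Category.{w} C] [Category.{w} D]

/-- Generators `(c, s : F c ⟶ d, m ∈ M c)` of the left Kan extension at `d`. -/
structure LanPre (F : C ⥤ D) (M : C ⥤ Type w) (d : D) : Type w where
  c : C
  s : F.obj c ⟶ d
  m : M.obj c

/-- The relation `(c, F(v) ≫ s, m) ∼ (c', s, v m)` for `v : c ⟶ c'`. -/
inductive LanRel (F : C ⥤ D) (M : C ⥤ Type w) (d : D) : LanPre F M d → LanPre F M d → Prop
  | mk {c c' : C} (v : c ⟶ c') (s : F.obj c' ⟶ d) (m : M.obj c) :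
      LanRel F M d ⟨c, F.map v ≫ s, m⟩ ⟨c', s, M.map v m⟩

/-- The class of a generator. -/
def LanPre.cls {F : C ⥤ D} {M : C ⥤ Type w} {d : D} (x : LanPre F M d) : Quot (LanRel F M d) :=
  Quot.mk _ x

/-- The left Kan extension of `M` along `F`. -/
def Lan (F : C ⥤ D) (M : C ⥤ Type w) : D ⥤ Type w where
  obj d := Quot (LanRel F M d)
  map {d d'} f := ↾(Quot.map (fun x => ⟨x.c, x.s ≫ f, x.m⟩) (by
    rintro _ _ ⟨v, s, m⟩
    simpa using LanRel.mk v (s ≫ f) m))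
  map_id d := by
    ext ⟨x⟩
    exact congrArg (fun s => LanPre.cls ⟨x.c, s, x.m⟩) (Category.comp_id x.s)
  map_comp f g := by
    ext ⟨x⟩
    exact congrArg (fun s => LanPre.cls ⟨x.c, s, x.m⟩) (Category.assoc x.s f g).symm

/-- The class of `(c, s, m)` in the left Kan extension. -/
def Lan.mk {F : C ⥤ D} {M : C ⥤ Type w} {d : D} {c : C} (s : F.obj c ⟶ d) (m : M.obj c) :
    (Lan F M).obj d := LanPre.cls ⟨c, s, m⟩

lemma Lan.exists_mk {F : C ⥤ D} {M : C ⥤ Type w} {d : D} (x : (Lan F M).obj d) :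
    ∃ (c : C) (s : F.obj c ⟶ d) (m : M.obj c), x = Lan.mk s m := by
  obtain ⟨⟨c, s, m⟩⟩ := x
  exact ⟨c, s, m, rfl⟩

lemma Lan.map_mk {F : C ⥤ D} {M : C ⥤ Type w} {d d' : D} {c : C} (s : F.obj c ⟶ d) (m : M.obj c)
    (f : d ⟶ d') : (Lan F M).map f (Lan.mk s m) = Lan.mk (s ≫ f) m := rfl

lemma Lan.mk_map {F : C ⥤ D} {M : C ⥤ Type w} {d : D} {c c' : C} (v : c ⟶ c')
    (s : F.obj c' ⟶ d) (m : M.obj c) :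
    (Lan.mk (F.map v ≫ s) m : (Lan F M).obj d) = Lan.mk s (M.map v m) :=
  Quot.sound (LanRel.mk v s m)

/-- The universal natural transformation `M ⟶ Lan F M ∘ F`. -/
def Lan.unit (F : C ⥤ D) (M : C ⥤ Type w) : M ⟶ F ⋙ Lan F M where
  app c := ↾fun m => Lan.mk (𝟙 _) m
  naturality c c' v := by
    ext m
    refine (Lan.mk_map v (𝟙 _) m).symm.trans ?_
    simp [Lan.map_mk]

/-- Functions out of the left Kan extension. -/
def Lan.elim {F : C ⥤ D} {M : C ⥤ Type w} {d : D} {X : Type w}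
    (f : ∀ {c : C}, (F.obj c ⟶ d) → M.obj c → X)
    (hf : ∀ {c c' : C} (v : c ⟶ c') (s : F.obj c' ⟶ d) (m : M.obj c),
      f (F.map v ≫ s) m = f s (M.map v m)) (x : (Lan F M).obj d) : X :=
  Quot.lift (fun y : LanPre F M d => f y.s y.m) (by
    rintro _ _ ⟨v, s, m⟩
    exact hf v s m) x

/-- Natural transformations out of the left Kan extension. -/
def Lan.desc {F : C ⥤ D} {M : C ⥤ Type w} {N : D ⥤ Type w} (t : M ⟶ F ⋙ N) : Lan F M ⟶ N where
  app d := ↾(Lan.elim (fun s m => N.map s (t.app _ m)) (by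
    intro c c' v s m
    rw [NatTrans.naturality_apply t v m, Functor.map_comp_apply]
    rfl))
  naturality d d' f := by
    ext x
    obtain ⟨c, s, m, rfl⟩ := Lan.exists_mk x
    exact Functor.map_comp_apply N s f (t.app _ m)

lemma Lan.desc_mk {F : C ⥤ D} {M : C ⥤ Type w} {N : D ⥤ Type w} (t : M ⟶ F ⋙ N) {d : D} {c : C}
    (s : F.obj c ⟶ d) (m : M.obj c) : (Lan.desc t).app d (Lan.mk s m) = N.map s (t.app c m) := rfl

lemma Lan.hom_ext {F : C ⥤ D} {M : C ⥤ Type w} {N : D ⥤ Type w} {f g : Lan F M ⟶ N}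
    (h : ∀ c (m : M.obj c), f.app _ (Lan.mk (𝟙 (F.obj c)) m) = g.app _ (Lan.mk (𝟙 _) m)) :
    f = g := by
  ext d x
  obtain ⟨c, s, m, rfl⟩ := Lan.exists_mk x
  have e : (Lan.mk s m : (Lan F M).obj d) = (Lan F M).map s (Lan.mk (𝟙 _) m) := by
    rw [Lan.map_mk, Category.id_comp]
  change f.app d _ = g.app d _
  rw [e, NatTrans.naturality_apply, NatTrans.naturality_apply, h]

/-- `Lan F M` is the left Kan extension in the sense of Mathlib. -/
instance (F : C ⥤ D) (M : C ⥤ Type w) : (Lan F M).IsLeftKanExtension (Lan.unit F M) where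
  nonempty_isUniversal := ⟨Limits.IsInitial.ofUniqueHom
    (fun Y => StructuredArrow.homMk (Lan.desc Y.hom) (by
      ext c m
      exact Functor.map_id_apply Y.right (F.obj c) (Y.hom.app c m)))
    (fun Y f => by
      refine StructuredArrow.ext _ _ (Lan.hom_ext fun c m => ?_)
      have h := congrFun (congrArg (fun k : M ⟶ F ⋙ Y.right =>
        ⇑(ConcreteCategory.hom (NatTrans.app k c))) (StructuredArrow.w f)) m
      exact h.trans (Functor.map_id_apply Y.right (F.obj c) (Y.hom.app c m)).symm)⟩

end Lan

/-! ## Left Kan extensions of Mackey functors -/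

section LanMackey

variable {G : Type} [Group G]

def GSpan.sum {X S T : FinGSet.{u} G} (A : GSpan X S) (B : GSpan X T) : GSpan X (S.sum T) :=
  ⟨A.apex.sum B.apex, FinGSet.sumElim A.l B.l,
    FinGSet.sumElim ((FinGSet.inl S T).comp A.r) ((FinGSet.inr S T).comp B.r)⟩

lemma GSpan.sum_congr {X S T : FinGSet.{u} G} {A A' : GSpan X S} {B B' : GSpan X T} (hA : A ≈ A')
    (hB : B ≈ B') : A.sum B ≈ A'.sum B' := by
  obtain ⟨e, he, h1, h2⟩ := hA
  obtain ⟨e', he', h1', h2'⟩ := hB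
  refine ⟨FinGSet.sumElim ((FinGSet.inl _ _).comp e) ((FinGSet.inr _ _).comp e'), ⟨?_, ?_⟩, ?_, ?_⟩
  · rintro (x | x) (y | y) h
    · exact congrArg Sum.inl (he.1 (Sum.inl_injective h))
    · cases h
    · cases h
    · exact congrArg Sum.inr (he'.1 (Sum.inr_injective h))
  · rintro (x | x)
    · obtain ⟨y, rfl⟩ := he.2 x
      exact ⟨Sum.inl y, rfl⟩
    · obtain ⟨y, rfl⟩ := he'.2 x
      exact ⟨Sum.inr y, rfl⟩
  · rintro (x | x)
    · exact h1 x
    · exact h1' x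
  · rintro (x | x)
    · exact congrArg Sum.inl (h2 x)
    · exact congrArg Sum.inr (h2' x)

lemma burnside_lift {X S T : FinGSet.{u} G} (f : X ⟶ S) (g : X ⟶ T) :
    ∃ h : X ⟶ S.sum T, h ≫ res (FinGSet.inl S T) = f ∧ h ≫ res (FinGSet.inr S T) = g := by
  obtain ⟨A, rfl⟩ := exists_span f
  obtain ⟨B, rfl⟩ := exists_span g
  exact ⟨(A.sum B).mk', comp_mk' (A.sum B) _ A (FinGSet.inl _ _) A.r (isPB_inl A.r B.r).swap
    (fun _ => rfl) (fun _ => rfl), comp_mk' (A.sum B) _ B (FinGSet.inr _ _) B.r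
    (isPB_inr A.r B.r).swap (fun _ => rfl) (fun _ => rfl)⟩

lemma burnside_eq_sum {X S T : FinGSet.{u} G} (U : GSpan X (S.sum T)) :
    (U.comp ⟨S, FinGSet.inl S T, .id G⟩).sum (U.comp ⟨T, FinGSet.inr S T, .id G⟩) ≈ U := by
  refine ⟨FinGSet.sumElim (FinGSet.pbFst _ _) (FinGSet.pbFst _ _), ⟨?_, fun y => ?_⟩, ?_, ?_⟩
  · rintro (⟨⟨x, s⟩, hx⟩ | ⟨⟨x, s⟩, hx⟩) (⟨⟨y, t⟩, hy⟩ | ⟨⟨y, t⟩, hy⟩) (h : x = y)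
    · subst h
      have : s = t := Sum.inl_injective (hx.symm.trans hy)
      subst this
      rfl
    · subst h
      cases hx.symm.trans hy
    · subst h
      cases hx.symm.trans hy
    · subst h
      have : s = t := Sum.inr_injective (hx.symm.trans hy)
      subst this
      rfl
  · rcases hz : U.r y with s | t
    · exact ⟨Sum.inl ⟨(y, s), hz⟩, rfl⟩
    · exact ⟨Sum.inr ⟨(y, t), hz⟩, rfl⟩
  · rintro (⟨x, hx⟩ | ⟨x, hx⟩) <;> rfl
  · rintro (⟨x, hx⟩ | ⟨x, hx⟩)
    · exact hx
    · exact hx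

lemma burnside_hom_ext {X S T : FinGSet.{u} G} {f g : X ⟶ S.sum T}
    (h1 : f ≫ res (FinGSet.inl S T) = g ≫ res (FinGSet.inl S T))
    (h2 : f ≫ res (FinGSet.inr S T) = g ≫ res (FinGSet.inr S T)) : f = g := by
  obtain ⟨U, rfl⟩ := exists_span f
  obtain ⟨V, rfl⟩ := exists_span g
  exact Quotient.sound (Setoid.trans (Setoid.symm (burnside_eq_sum U))
    (Setoid.trans (GSpan.sum_congr (Quotient.exact h1) (Quotient.exact h2)) (burnside_eq_sum V)))

lemma burnside_empty {X : FinGSet.{u} G} (f g : X ⟶ FinGSet.empty G) : f = g := by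
  obtain ⟨U, rfl⟩ := exists_span f
  obtain ⟨V, rfl⟩ := exists_span g
  exact Quotient.sound ⟨⟨fun x => PEmpty.elim (U.r x), fun _ x => PEmpty.elim (U.r x)⟩,
    ⟨fun x => PEmpty.elim (U.r x), fun x => PEmpty.elim (V.r x)⟩, fun x => PEmpty.elim (U.r x),
    fun x => PEmpty.elim (U.r x)⟩

/-- `M` preserves finite products and there are enough products in its source. -/
structure PreservesProds {C : Type w} [Category.{w} C] (M : C ⥤ Type w) : Prop where
  nonempty : ∃ c, Nonempty (M.obj c)
  prod : ∀ a b : C, ∃ (c : C) (p : c ⟶ a) (q : c ⟶ b),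
    (∀ (x : C) (f : x ⟶ a) (g : x ⟶ b), ∃ l : x ⟶ c, l ≫ p = f ∧ l ≫ q = g) ∧
      Function.Bijective fun x : M.obj c => (M.map p x, M.map q x)

lemma IsSemiMackey.preservesProds {M : FinGSet.{u} G ⥤ Type (u + 1)} (hM : IsSemiMackey M) :
    PreservesProds M :=
  ⟨⟨_, ⟨hM.empty.choose⟩⟩, fun S T => ⟨S.sum T, _, _, fun _ f g => burnside_lift f g, hM.sum S T⟩⟩

lemma Lan.isSemiMackey {C : Type (u + 1)} [Category.{u + 1} C] (F : C ⥤ FinGSet.{u} G)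
    (M : C ⥤ Type (u + 1)) (hM : PreservesProds M) : IsSemiMackey (Lan F M) := by
  choose c p q hl hb using hM.prod
  choose j hj1 hj2 using fun X S T => @burnside_lift G _ X S T
  choose n hn using fun a b => (hb a b).2
  have hn1 : ∀ a b x, M.map (p a b) (n a b x) = x.1 := fun a b x => congrArg Prod.fst (hn a b x)
  have hn2 : ∀ a b x, M.map (q a b) (n a b x) = x.2 := fun a b x => congrArg Prod.snd (hn a b x)
  -- a joint representative of two classes
  have key : ∀ (S T : FinGSet.{u} G) {a b a' b' : C} (v : a ⟶ a') (v' : b ⟶ b')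
      (s : F.obj a' ⟶ S) (t : F.obj b' ⟶ T) (x : M.obj a) (y : M.obj b),
      (Lan.mk (j _ S T (F.map (p a b ≫ v) ≫ s) (F.map (q a b ≫ v') ≫ t)) (n a b (x, y)) :
        (Lan F M).obj (S.sum T)) =
      Lan.mk (j _ S T (F.map (p a' b') ≫ s) (F.map (q a' b') ≫ t))
        (n a' b' (M.map v x, M.map v' y)) := by
    intro S T a b a' b' v v' s t x y
    obtain ⟨l, h1, h2⟩ := hl a' b' _ (p a b ≫ v) (q a b ≫ v')
    have e1 : n a' b' (M.map v x, M.map v' y) = M.map l (n a b (x, y)) := by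
      apply (hb a' b').1
      refine (hn a' b' _).trans (Prod.ext ?_ ?_)
      · change _ = M.map (p a' b') (M.map l _)
        rw [← Functor.map_comp_apply, h1, Functor.map_comp_apply, hn1]
      · change _ = M.map (q a' b') (M.map l _)
        rw [← Functor.map_comp_apply, h2, Functor.map_comp_apply, hn2]
    rw [e1, ← Lan.mk_map]
    congr 1
    apply burnside_hom_ext
    · rw [hj1, Category.assoc, hj1, ← h1, F.map_comp, Category.assoc]
    · rw [hj2, Category.assoc, hj2, ← h2, F.map_comp, Category.assoc]
  -- the inverse map
  let inv : ∀ S T : FinGSet.{u} G, (Lan F M).obj S → (Lan F M).obj T →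
      (Lan F M).obj (S.sum T) := fun S T x y =>
    Lan.elim (X := (Lan F M).obj (S.sum T)) (fun {a} s m =>
      Lan.elim (X := (Lan F M).obj (S.sum T)) (fun {b} t m' =>
        Lan.mk (j _ S T (F.map (p a b) ≫ s) (F.map (q a b) ≫ t)) (n a b (m, m')))
        (by
          intro b b' v t m'
          have := key S T (𝟙 a) v s t m m'
          simpa using this) y)
      (by
        intro a a' v s m
        obtain ⟨b, t, m', rfl⟩ := Lan.exists_mk y
        have := key S T v (𝟙 b) s t m m'
        change Lan.mk _ _ = Lan.mk _ _
        simpa using this) x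
  have hinv : ∀ (S T : FinGSet.{u} G) (x : (Lan F M).obj (S.sum T)),
      inv S T ((Lan F M).map (res (FinGSet.inl S T)) x)
        ((Lan F M).map (res (FinGSet.inr S T)) x) = x := by
    intro S T x
    obtain ⟨a, s, m, rfl⟩ := Lan.exists_mk x
    change Lan.mk (j _ S T (F.map (p a a) ≫ s ≫ _) (F.map (q a a) ≫ s ≫ _)) (n a a (m, m)) = _
    obtain ⟨l, h1, h2⟩ := hl a a a (𝟙 a) (𝟙 a)
    have e1 : n a a (m, m) = M.map l m := by
      apply (hb a a).1
      refine (hn a a _).trans (Prod.ext ?_ ?_)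
      · change _ = M.map (p a a) (M.map l _)
        rw [← Functor.map_comp_apply, h1, Functor.map_id_apply]
      · change _ = M.map (q a a) (M.map l _)
        rw [← Functor.map_comp_apply, h2, Functor.map_id_apply]
    rw [e1, ← Lan.mk_map]
    congr 1
    apply burnside_hom_ext
    · rw [Category.assoc, hj1, ← Category.assoc, ← F.map_comp, h1, F.map_id, Category.id_comp]
    · rw [Category.assoc, hj2, ← Category.assoc, ← F.map_comp, h2, F.map_id, Category.id_comp]
  refine ⟨?_, fun S T => ⟨fun x y hxy => ?_, ?_⟩⟩
  · obtain ⟨a, ⟨m⟩⟩ := hM.nonempty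
    let z : F.obj a ⟶ FinGSet.empty G := res (FinGSet.fromEmpty (F.obj a))
    refine ⟨Lan.mk z m, fun x => ?_⟩
    obtain ⟨b, t, m', rfl⟩ := Lan.exists_mk x
    have e1 := Lan.mk_map (F := F) (M := M) (p b a) t (n b a (m', m))
    have e2 := Lan.mk_map (F := F) (M := M) (q b a) z (n b a (m', m))
    rw [hn1] at e1
    rw [hn2] at e2
    exact e1.symm.trans ((congrArg (fun s => Lan.mk s (n b a (m', m)))
      (burnside_empty _ _)).trans e2)
  · rw [← hinv S T x, ← hinv S T y]
    exact congrArg₂ (inv S T) (congrArg Prod.fst hxy) (congrArg Prod.snd hxy)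
  · rintro ⟨x, y⟩
    obtain ⟨a, s, m, rfl⟩ := Lan.exists_mk x
    obtain ⟨b, t, m', rfl⟩ := Lan.exists_mk y
    refine ⟨inv S T (Lan.mk s m) (Lan.mk t m'), Prod.ext ?_ ?_⟩
    · change Lan.mk (j _ S T (F.map (p a b) ≫ s) (F.map (q a b) ≫ t) ≫ _) _ = Lan.mk s m
      rw [hj1, Lan.mk_map, hn1]
    · change Lan.mk (j _ S T (F.map (p a b) ≫ s) (F.map (q a b) ≫ t) ≫ _) _ = Lan.mk t m'
      rw [hj2, Lan.mk_map, hn2]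

/-- `M(Y) ≅ M(Z) × M(C)` when `Y` is the disjoint union of `Z` and `C`. -/
lemma IsSemiMackey.sum_of_cover {M : FinGSet.{u} G ⥤ Type w} (hM : IsSemiMackey M)
    {Z C Y : FinGSet.{u} G} (i : Z →[G] Y) (k : C →[G] Y)
    (h : Function.Bijective (FinGSet.sumElim i k)) :
    Function.Bijective fun x : M.obj Y => (M.map (res i) x, M.map (res k) x) := by
  have h1 : ∀ x, (M.map (res i) x, M.map (res k) x) = (fun x : M.obj (Z.sum C) =>
      (M.map (res (FinGSet.inl Z C)) x, M.map (res (FinGSet.inr Z C)) x))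
        (M.map (res (FinGSet.sumElim i k)) x) := by
    intro x
    refine Prod.ext ?_ ?_
    · change _ = M.map (res (FinGSet.inl Z C)) (M.map (res (FinGSet.sumElim i k)) x)
      rw [← Functor.map_comp_apply, ← res_comp]
      rfl
    · change _ = M.map (res (FinGSet.inr Z C)) (M.map (res (FinGSet.sumElim i k)) x)
      rw [← Functor.map_comp_apply, ← res_comp]
      rfl
  simp only [h1]
  refine (hM.sum Z C).comp (Function.bijective_iff_has_inverse.2
    ⟨M.map (tr (FinGSet.sumElim i k)), fun x => ?_, fun x => ?_⟩)
  · rw [← Functor.map_comp_apply, (tr_res_of_bij _ h).2, Functor.map_id_apply]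
  · rw [← Functor.map_comp_apply, (tr_res_of_bij _ h).1, Functor.map_id_apply]

lemma IsSemiMackey.eq_add_of_cover {M : FinGSet.{u} G ⥤ Type w} (hM : IsSemiMackey M)
    {Z C Y : FinGSet.{u} G} (i : Z →[G] Y) (k : C →[G] Y)
    (h : Function.Bijective (FinGSet.sumElim i k)) (y : M.obj Y) :
    y = hM.add (M.map (tr i) (M.map (res i) y)) (M.map (tr k) (M.map (res k) y)) := by
  have h1 : M.map (res (FinGSet.sumElim i k)) y = hM.pair (M.map (res i) y) (M.map (res k) y) := by
    apply hM.hom_ext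
    · rw [inl_pair, ← Functor.map_comp_apply, ← res_comp]
      rfl
    · rw [inr_pair, ← Functor.map_comp_apply, ← res_comp]
      rfl
  rw [← hM.tr_elim, ← h1, ← Functor.map_comp_apply, (tr_res_of_bij _ h).2, Functor.map_id_apply]

/-- The complement of the image of a map of finite `G`-sets. -/
lemma exists_complement {Z Y : FinGSet.{u} G} (i : Z →[G] Y) (hi : Function.Injective i) :
    ∃ (C : FinGSet.{u} G) (k : C →[G] Y), Function.Bijective (FinGSet.sumElim i k) := by
  let _ : MulAction G {y : Y // ∀ z, i z ≠ y} :=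
    { smul := fun g y => ⟨g • y.1, fun z hz => y.2 (g⁻¹ • z) (by
        rw [map_smul, hz, inv_smul_smul])⟩
      one_smul := fun y => Subtype.ext (one_smul G y.1)
      mul_smul := fun g h y => Subtype.ext (mul_smul g h y.1) }
  refine ⟨⟨{y : Y // ∀ z, i z ≠ y}⟩, ⟨fun y => y.1, fun _ _ => rfl⟩, ?_, fun y => ?_⟩
  · rintro (x | x) (y | y) h
    · exact congrArg Sum.inl (hi h)
    · exact (y.2 x h).elim
    · exact (x.2 y h.symm).elim
    · exact congrArg Sum.inr (Subtype.ext h)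
  · by_cases hy : ∃ z, i z = y
    · obtain ⟨z, hz⟩ := hy
      exact ⟨Sum.inl z, hz⟩
    · exact ⟨Sum.inr ⟨y, fun z hz => hy ⟨z, hz⟩⟩, rfl⟩

/-- A criterion for a left Kan extension to take values in groups. -/
lemma Lan.isMackey {C : Type (u + 1)} [Category.{u + 1} C] (F : C ⥤ FinGSet.{u} G)
    (M : C ⥤ Type (u + 1)) (hM : PreservesProds M)
    (hneg : ∀ (c : C) (m : M.obj c), ∃ (c' z : C) (r : c' ⟶ c) (f : c' ⟶ c) (t : z ⟶ c)
      (i : F.obj c →[G] F.obj c') (f' : F.obj c' →[G] F.obj c) (y : M.obj c') (e : M.obj z),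
      IsEmpty (F.obj z) ∧ Function.Injective i ∧ (∀ x, f' (i x) = x) ∧
      F.map r = res i ∧ F.map f = tr f' ∧ M.map r y = m ∧ M.map f y = M.map t e) :
    IsMackey (Lan F M) := by
  have hN := Lan.isSemiMackey F M hM
  refine ⟨hN, fun T x => ?_⟩
  obtain ⟨c, s, m, rfl⟩ := Lan.exists_mk x
  obtain ⟨c', z, r, f, t, i, f', y, e, hz, hi, hif, hr, hf, hry, hfy⟩ := hneg c m
  obtain ⟨C', k, hk⟩ := exists_complement i hi
  -- the zero element
  have h0 : (Lan F M).map (tr f') (Lan.mk (𝟙 (F.obj c')) y) = hN.zero (F.obj c) := by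
    rw [Lan.map_mk, Category.id_comp, ← hf, ← Category.comp_id (F.map f), Lan.mk_map, hfy,
      ← Lan.mk_map, Category.comp_id]
    have hb : Function.Bijective (FinGSet.fromEmpty (F.obj z)) :=
      ⟨fun a => PEmpty.elim a, fun a => hz.elim a⟩
    have e1 : (Lan.mk (F.map t) e : (Lan F M).obj _) = (Lan F M).map (F.map t)
      ((Lan F M).map (tr (FinGSet.fromEmpty (F.obj z)))
        (Lan.mk (res (FinGSet.fromEmpty (F.obj z))) e)) := by
      rw [Lan.map_mk, (tr_res_of_bij _ hb).2, Lan.map_mk, Category.id_comp]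
    rw [e1, hN.empty.choose_spec (Lan.mk _ _)]
    exact hN.map_zero (F.map t)
  have h1 := hN.eq_add_of_cover i k hk (Lan.mk (𝟙 (F.obj c')) y)
  rw [h1, hN.map_add, ← Functor.map_comp_apply, ← tr_comp] at h0
  have h2 : f'.comp i = .id G := by
    ext x
    exact hif x
  have h3 : (Lan F M).map (res i) (Lan.mk (𝟙 (F.obj c')) y) = Lan.mk (𝟙 _) m := by
    rw [Lan.map_mk, Category.id_comp, ← hr, ← Category.comp_id (F.map r), Lan.mk_map, hry]
  rw [h2, tr_id, Functor.map_id_apply, h3] at h0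
  have h4 := congrArg ((Lan F M).map s) h0
  rw [hN.map_add, hN.map_zero, Lan.map_mk, Category.id_comp] at h4
  exact ⟨_, h4⟩

end LanMackey

/-! ## Products, restriction and coinduction on the Burnside category -/

section Squares

variable {G : Type} [Group G]

lemma mk'_tr {S T W : FinGSet.{u} G} (U : GSpan S T) (f : T →[G] W) :
    U.mk' ≫ tr f = GSpan.mk' ⟨U.apex, U.l, f.comp U.r⟩ :=
  comp_mk' _ _ _ (.id G) U.r ⟨fun _ => rfl, fun a _ h => ⟨a, ⟨rfl, h⟩, fun _ hy => hy.1⟩⟩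
    (fun _ => rfl) (fun _ => rfl)

lemma mk'_eq_mk' {S T : FinGSet.{u} G} (U V : GSpan S T) (e : U.apex →[G] V.apex)
    (he : Function.Bijective e) (hl : ∀ x, V.l (e x) = U.l x) (hr : ∀ x, V.r (e x) = U.r x) :
    U.mk' = V.mk' := Quotient.sound ⟨e, he, hl, hr⟩

/-- Compatibility of spans with maps that are invertible on the left. -/
lemma tr_square {S T S' T' : FinGSet.{u} G} (U : GSpan S T) (V : GSpan S' T') (a : S →[G] S')
    (b : T →[G] T') (e : U.apex →[G] V.apex) (ha : Function.Bijective a)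
    (he : Function.Bijective e) (hl : ∀ x, V.l (e x) = a (U.l x))
    (hr : ∀ x, V.r (e x) = b (U.r x)) : U.mk' ≫ tr b = tr a ≫ V.mk' := by
  rw [mk'_tr]
  refine (comp_mk' ⟨S, .id G, a⟩ V ⟨U.apex, U.l, b.comp U.r⟩ U.l e ⟨fun x => (hl x).symm, ?_⟩
    (fun _ => rfl) hr).symm
  intro x y h
  obtain ⟨z, rfl⟩ := he.2 y
  exact ⟨z, ⟨ha.1 ((hl z).symm.trans h.symm), rfl⟩, fun w hw => he.1 hw.2⟩

lemma tr_eq_res {S T : FinGSet.{u} G} (e : S →[G] T) (i : T →[G] S) (h1 : ∀ x, i (e x) = x)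
    (h2 : ∀ x, e (i x) = x) : tr e = res i :=
  mk'_eq_mk' ⟨S, .id G, e⟩ ⟨T, i, .id G⟩ e ⟨fun x y h => by rw [← h1 x, h, h1], fun x => ⟨_, h2 x⟩⟩
    h1 fun _ => rfl

lemma tr2 {S T T' W : FinGSet.{u} G} {a : S →[G] T} {b : T →[G] W} {c : S →[G] T'} {d : T' →[G] W}
    (h : ∀ x, b (a x) = d (c x)) : tr a ≫ tr b = tr c ≫ tr d := by
  rw [← tr_comp, ← tr_comp]
  exact congrArg tr (MulActionHom.ext h)

lemma res2 {S T T' W : FinGSet.{u} G} {a : S →[G] T} {b : T →[G] W} {c : S →[G] T'} {d : T' →[G] W}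
    (h : ∀ x, b (a x) = d (c x)) : res b ≫ res a = res d ≫ res c := by
  rw [← res_comp, ← res_comp]
  exact congrArg res (MulActionHom.ext h)

lemma tr3 {S T T' U U' W : FinGSet.{u} G} {a : S →[G] T} {b : T →[G] U} {c : U →[G] W}
    {a' : S →[G] T'} {b' : T' →[G] U'} {c' : U' →[G] W}
    (h : ∀ x, c (b (a x)) = c' (b' (a' x))) : tr a ≫ tr b ≫ tr c = tr a' ≫ tr b' ≫ tr c' := by
  rw [← tr_comp, ← tr_comp, ← tr_comp, ← tr_comp]
  exact congrArg tr (MulActionHom.ext h)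

lemma res3 {S T T' U U' W : FinGSet.{u} G} {a : S →[G] T} {b : T →[G] U} {c : U →[G] W}
    {a' : S →[G] T'} {b' : T' →[G] U'} {c' : U' →[G] W}
    (h : ∀ x, c (b (a x)) = c' (b' (a' x))) :
    res c ≫ res b ≫ res a = res c' ≫ res b' ≫ res a' := by
  rw [← Category.assoc, ← Category.assoc, ← res_comp, ← res_comp, ← res_comp, ← res_comp]
  exact congrArg res (MulActionHom.ext h)

/-- The one-point `G`-set. -/
def FinGSet.pt (G : Type) [Group G] : FinGSet.{u} G :=
  letI : MulAction G PUnit.{u + 1} :=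
    { smul := fun _ x => x, one_smul := fun _ => rfl, mul_smul := fun _ _ _ => rfl }
  ⟨PUnit.{u + 1}⟩

def FinGSet.toPt (S : FinGSet.{u} G) : S →[G] FinGSet.pt G := ⟨fun _ => PUnit.unit, fun _ _ => rfl⟩

/-- The cartesian product of finite `G`-sets. -/
def FinGSet.prod (S T : FinGSet.{u} G) : FinGSet.{u} G := ⟨S × T⟩

def FinGSet.fst (S T : FinGSet.{u} G) : S.prod T →[G] S := ⟨Prod.fst, fun _ _ => rfl⟩

def FinGSet.snd (S T : FinGSet.{u} G) : S.prod T →[G] T := ⟨Prod.snd, fun _ _ => rfl⟩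

def FinGSet.prodLift {W S T : FinGSet.{u} G} (f : W →[G] S) (g : W →[G] T) : W →[G] S.prod T :=
  ⟨fun x => (f x, g x), fun m x => Prod.ext (map_smul f m x) (map_smul g m x)⟩

def FinGSet.prodMap {S S' T T' : FinGSet.{u} G} (f : S →[G] S') (g : T →[G] T') :
    S.prod T →[G] S'.prod T' :=
  FinGSet.prodLift (f.comp (FinGSet.fst S T)) (g.comp (FinGSet.snd S T))

def GSpan.prod {S S' T T' : FinGSet.{u} G} (U : GSpan S S') (V : GSpan T T') :
    GSpan (S.prod T) (S'.prod T') :=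
  ⟨U.apex.prod V.apex, FinGSet.prodMap U.l V.l, FinGSet.prodMap U.r V.r⟩

lemma prodMap_bij {S S' T T' : FinGSet.{u} G} {f : S →[G] S'} {g : T →[G] T'}
    (hf : Function.Bijective f) (hg : Function.Bijective g) :
    Function.Bijective (FinGSet.prodMap f g) := hf.prodMap hg

/-- The cartesian product as a bifunctor on the Burnside category. -/
def burnsideProd {S S' T T' : FinGSet.{u} G} : (S ⟶ S') → (T ⟶ T') →
    (S.prod T ⟶ S'.prod T') :=
  Quotient.map₂ GSpan.prod (by
    rintro U U' ⟨e, he, h1, h2⟩ V V' ⟨e', he', h1', h2'⟩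
    exact ⟨FinGSet.prodMap e e', prodMap_bij he he', fun x => Prod.ext (h1 _) (h1' _),
      fun x => Prod.ext (h2 _) (h2' _)⟩)

lemma IsPB.prodMap {W U V T W' U' V' T' : FinGSet.{u} G} {p : W →[G] U} {q : W →[G] V}
    {f : U →[G] T} {g : V →[G] T} {p' : W' →[G] U'} {q' : W' →[G] V'} {f' : U' →[G] T'}
    {g' : V' →[G] T'} (h : IsPB p q f g) (h' : IsPB p' q' f' g') :
    IsPB (FinGSet.prodMap p p') (FinGSet.prodMap q q') (FinGSet.prodMap f f')
      (FinGSet.prodMap g g') := by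
  refine ⟨fun x => Prod.ext (h.1 _) (h'.1 _), fun a b hab => ?_⟩
  obtain ⟨x, ⟨h1, h2⟩, h3⟩ := h.2 a.1 b.1 (congrArg Prod.fst hab)
  obtain ⟨x', ⟨h1', h2'⟩, h3'⟩ := h'.2 a.2 b.2 (congrArg Prod.snd hab)
  exact ⟨(x, x'), ⟨Prod.ext h1 h1', Prod.ext h2 h2'⟩, fun y hy => Prod.ext
    (h3 _ ⟨congrArg Prod.fst hy.1, congrArg Prod.fst hy.2⟩)
    (h3' _ ⟨congrArg Prod.snd hy.1, congrArg Prod.snd hy.2⟩)⟩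

lemma burnsideProd_comp {S S' S'' T T' T'' : FinGSet.{u} G} (f : S ⟶ S') (f' : S' ⟶ S'')
    (g : T ⟶ T') (g' : T' ⟶ T'') :
    burnsideProd (f ≫ f') (g ≫ g') = burnsideProd f g ≫ burnsideProd f' g' := by
  obtain ⟨U, rfl⟩ := exists_span f
  obtain ⟨U', rfl⟩ := exists_span f'
  obtain ⟨V, rfl⟩ := exists_span g
  obtain ⟨V', rfl⟩ := exists_span g'
  exact (comp_mk' (U.prod V) (U'.prod V') ((U.comp U').prod (V.comp V'))
    (FinGSet.prodMap (FinGSet.pbFst _ _) (FinGSet.pbFst _ _))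
    (FinGSet.prodMap (FinGSet.pbSnd _ _) (FinGSet.pbSnd _ _))
    ((isPB_pb _ _).prodMap (isPB_pb _ _)) (fun _ => rfl) (fun _ => rfl)).symm

lemma burnsideProd_tr {S S' T T' : FinGSet.{u} G} (f : S →[G] S') (g : T →[G] T') :
    burnsideProd (tr f) (tr g) = tr (FinGSet.prodMap f g) := rfl

lemma burnsideProd_res {S S' T T' : FinGSet.{u} G} (f : S →[G] S') (g : T →[G] T') :
    burnsideProd (res f) (res g) = res (FinGSet.prodMap f g) := rfl

/-- The product of a family of finite `G`-sets. -/
def FinGSet.pi {ι : Type} [Finite ι] (S : ι → FinGSet.{u} G) : FinGSet.{u} G := ⟨∀ i, S i⟩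

def FinGSet.proj {ι : Type} [Finite ι] (S : ι → FinGSet.{u} G) (i : ι) : FinGSet.pi S →[G] S i :=
  ⟨fun x => x i, fun _ _ => rfl⟩

def FinGSet.piLift {ι : Type} [Finite ι] {W : FinGSet.{u} G} {S : ι → FinGSet.{u} G}
    (f : ∀ i, W →[G] S i) : W →[G] FinGSet.pi S :=
  ⟨fun x i => f i x, fun m x => funext fun i => map_smul (f i) m x⟩

def FinGSet.piMap {ι : Type} [Finite ι] {S T : ι → FinGSet.{u} G}
    (f : ∀ i, S i →[G] T i) : FinGSet.pi S →[G] FinGSet.pi T :=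
  FinGSet.piLift fun i => (f i).comp (FinGSet.proj S i)

def GSpan.pi {ι : Type} [Finite ι] {S T : ι → FinGSet.{u} G} (U : ∀ i, GSpan (S i) (T i)) :
    GSpan (FinGSet.pi S) (FinGSet.pi T) :=
  ⟨FinGSet.pi fun i => (U i).apex, FinGSet.piMap fun i => (U i).l, FinGSet.piMap fun i => (U i).r⟩

lemma piMap_bij {ι : Type} [Finite ι] {S T : ι → FinGSet.{u} G} {f : ∀ i, S i →[G] T i}
    (hf : ∀ i, Function.Bijective (f i)) : Function.Bijective (FinGSet.piMap f) :=
  Function.Bijective.piMap hf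

/-- The product `∏ᵢ fᵢ` of morphisms of the Burnside category. -/
noncomputable def burnsidePi {ι : Type} [Finite ι] {S T : ι → FinGSet.{u} G}
    (f : ∀ i, S i ⟶ T i) : FinGSet.pi S ⟶ FinGSet.pi T :=
  GSpan.mk' (GSpan.pi fun i => (exists_span (f i)).choose)

lemma burnsidePi_mk' {ι : Type} [Finite ι] {S T : ι → FinGSet.{u} G}
    (U : ∀ i, GSpan (S i) (T i)) : burnsidePi (fun i => (U i).mk') = (GSpan.pi U).mk' := by
  have h : ∀ i, (exists_span (U i).mk').choose ≈ U i := fun i =>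
    Quotient.exact (exists_span (U i).mk').choose_spec.symm
  choose e he h1 h2 using h
  exact mk'_eq_mk' _ _ (FinGSet.piMap e) (piMap_bij he) (fun x => funext fun i => h1 i _)
    (fun x => funext fun i => h2 i _)

lemma burnsidePi_tr {ι : Type} [Finite ι] {S T : ι → FinGSet.{u} G} (f : ∀ i, S i →[G] T i) :
    burnsidePi (fun i => tr (f i)) = tr (FinGSet.piMap f) :=
  burnsidePi_mk' _

lemma burnsidePi_res {ι : Type} [Finite ι] {S T : ι → FinGSet.{u} G} (f : ∀ i, S i →[G] T i) :
    burnsidePi (fun i => res (f i)) = res (FinGSet.piMap f) :=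
  burnsidePi_mk' _

/-- The product functor `(Sᵢ)ᵢ ↦ ∏ᵢ Sᵢ` on the Burnside category. -/
noncomputable def piFunctor (G : Type) [Group G] (ι : Type) [Finite ι] :
    (ι → FinGSet.{u} G) ⥤ FinGSet.{u} G where
  obj := FinGSet.pi
  map f := burnsidePi f
  map_id S := burnsidePi_tr fun i => .id G
  map_comp {S T W} f g := by
    obtain ⟨U, hU⟩ : ∃ U : ∀ i, GSpan (S i) (T i), f = fun i => (U i).mk' :=
      ⟨fun i => (exists_span (f i)).choose, funext fun i => (exists_span (f i)).choose_spec⟩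
    obtain ⟨V, hV⟩ : ∃ V : ∀ i, GSpan (T i) (W i), g = fun i => (V i).mk' :=
      ⟨fun i => (exists_span (g i)).choose, funext fun i => (exists_span (g i)).choose_spec⟩
    subst hU hV
    rw [burnsidePi_mk', burnsidePi_mk']
    refine (burnsidePi_mk' fun i => (U i).comp (V i)).trans
      (comp_mk' _ _ (GSpan.pi fun i => (U i).comp (V i)) (FinGSet.piMap fun i => FinGSet.pbFst _ _)
      (FinGSet.piMap fun i => FinGSet.pbSnd _ _)
      ⟨fun (x : ∀ i, FinGSet.pb (U i).r (V i).l) => funext fun i => (x i).2, fun a b hab => ?_⟩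
      (fun _ => rfl) (fun _ => rfl)).symm
    exact ⟨fun i => ⟨(a i, b i), congrFun hab i⟩, ⟨rfl, rfl⟩, fun y hy => funext fun i =>
      Subtype.ext (Prod.ext (congrFun hy.1 i) (congrFun hy.2 i))⟩

end Squares

/-- A functor from finite `K`-sets to finite `G`-sets that preserves pullbacks. -/
structure PBFunctor (K G : Type) [Group K] [Group G] where
  obj : FinGSet.{u} K → FinGSet.{u} G
  map : ∀ {S T : FinGSet.{u} K}, (S →[K] T) → (obj S →[G] obj T)
  map_id : ∀ S : FinGSet.{u} K, map (.id K : S →[K] S) = .id G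
  map_comp : ∀ {S T W : FinGSet.{u} K} (f : S →[K] T) (g : T →[K] W),
    map (g.comp f) = (map g).comp (map f)
  map_pb : ∀ {W U V T : FinGSet.{u} K} (p : W →[K] U) (q : W →[K] V) (f : U →[K] T) (g : V →[K] T),
    IsPB p q f g → IsPB (map p) (map q) (map f) (map g)

namespace PBFunctor

variable {K G : Type} [Group K] [Group G] (F : PBFunctor.{u} K G)

def span {S T : FinGSet.{u} K} (U : GSpan S T) : GSpan (F.obj S) (F.obj T) :=
  ⟨F.obj U.apex, F.map U.l, F.map U.r⟩

lemma map_bij {S T : FinGSet.{u} K} (e : S →[K] T) (he : Function.Bijective e) :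
    Function.Bijective (F.map e) := by
  obtain ⟨i, _, h1, h2⟩ := bij_inv e he
  have e1 : e.comp i = .id K := by ext x; exact h1 x
  have e2 : i.comp e = .id K := by ext x; exact h2 x
  have f1 := F.map_comp i e
  have f2 := F.map_comp e i
  rw [e1, F.map_id] at f1
  rw [e2, F.map_id] at f2
  exact Function.bijective_iff_has_inverse.2 ⟨F.map i, fun x => (DFunLike.congr_fun f2 x).symm,
    fun x => (DFunLike.congr_fun f1 x).symm⟩

lemma map_apply_of_comp {S T W : FinGSet.{u} K} {f : S →[K] T} {g : T →[K] W} {h : S →[K] W}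
    (e : ∀ x, g (f x) = h x) (x : F.obj S) : F.map g (F.map f x) = F.map h x := by
  have e1 : g.comp f = h := by ext y; exact e y
  rw [← e1, F.map_comp]
  rfl

/-- The functor of Burnside categories induced by a pullback-preserving functor. -/
def burnside : FinGSet.{u} K ⥤ FinGSet.{u} G where
  obj := F.obj
  map := Quotient.map F.span (by
    rintro U V ⟨e, he, h1, h2⟩
    exact ⟨F.map e, F.map_bij e he, F.map_apply_of_comp h1, F.map_apply_of_comp h2⟩)
  map_id S := by
    change GSpan.mk' (F.span ⟨S, .id K, .id K⟩) = GSpan.mk' ⟨F.obj S, .id G, .id G⟩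
    rw [span, F.map_id]
  map_comp {S T W} f g := by
    obtain ⟨U, rfl⟩ := exists_span f
    obtain ⟨V, rfl⟩ := exists_span g
    exact (comp_mk' (F.span U) (F.span V) (F.span (U.comp V)) (F.map (FinGSet.pbFst _ _))
      (F.map (FinGSet.pbSnd _ _)) (F.map_pb _ _ _ _ (isPB_pb _ _))
      (F.map_apply_of_comp fun _ => rfl) (F.map_apply_of_comp fun _ => rfl)).symm

lemma burnside_tr {S T : FinGSet.{u} K} (f : S →[K] T) : F.burnside.map (tr f) = tr (F.map f) := by
  change GSpan.mk' (F.span ⟨S, .id K, f⟩) = GSpan.mk' ⟨F.obj S, .id G, F.map f⟩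
  rw [span, F.map_id]

lemma burnside_res {S T : FinGSet.{u} K} (f : S →[K] T) :
    F.burnside.map (res f) = res (F.map f) := by
  change GSpan.mk' (F.span ⟨S, f, .id K⟩) = GSpan.mk' ⟨F.obj S, F.map f, .id G⟩
  rw [span, F.map_id]

end PBFunctor

section GroupHom

variable {K G : Type} [Group K] [Group G]

/-- The coinduced `G`-set `F_K(G, T)` of `K`-equivariant maps `G → T`, with
`(g f)(x) = f (x g)`. -/
def FinGSet.coind [Finite G] (φ : K →* G) (T : FinGSet.{u} K) : FinGSet.{u} G :=
  letI : MulAction G {f : G → T // ∀ k x, f (φ k * x) = k • f x} :=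
    { smul := fun g f => ⟨fun x => f.1 (x * g), fun k x =>
        (congrArg f.1 (mul_assoc (φ k) x g)).trans (f.2 k (x * g))⟩
      one_smul := fun f => Subtype.ext (funext fun x => congrArg f.1 (mul_one x))
      mul_smul := fun g h f => Subtype.ext (funext fun x => congrArg f.1 (mul_assoc x g h).symm) }
  ⟨{f : G → T // ∀ k x, f (φ k * x) = k • f x}⟩

/-- Coinduction `F_K(G, -)` from finite `K`-sets to finite `G`-sets. -/
def coind [Finite G] (φ : K →* G) : PBFunctor.{u} K G where
  obj := FinGSet.coind φ
  map f := ⟨fun a => ⟨fun x => f (a.1 x), fun k x =>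
    (congrArg f (a.2 k x)).trans (map_smul f k _)⟩, fun _ _ => rfl⟩
  map_id _ := rfl
  map_comp _ _ := rfl
  map_pb {W U V T} p q f g h := by
    refine ⟨fun a => Subtype.ext (funext fun x => h.1 (a.1 x)), fun a b hab => ?_⟩
    have hab' : ∀ x, f (a.1 x) = g (b.1 x) := fun x => congrFun (congrArg Subtype.val hab) x
    choose c hc hu using fun x => h.2 (a.1 x) (b.1 x) (hab' x)
    refine ⟨⟨c, fun k x => ?_⟩, ⟨Subtype.ext (funext fun x => (hc x).1),
      Subtype.ext (funext fun x => (hc x).2)⟩, fun y hy => Subtype.ext (funext fun x => ?_)⟩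
    · refine (hu _ _ ⟨?_, ?_⟩).symm
      · rw [map_smul, (hc x).1, a.2]
      · rw [map_smul, (hc x).2, b.2]
    · exact hu x _ ⟨congrFun (congrArg Subtype.val hy.1) x,
        congrFun (congrArg Subtype.val hy.2) x⟩

/-- The relation `(g φ(k), t) ∼ (g, k t)` on `G × T`. -/
def indSetoid (φ : K →* G) (T : FinGSet.{u} K) : Setoid (G × T) where
  r x y := ∃ k : K, x.1 = y.1 * φ k ∧ y.2 = k • x.2
  iseqv :=
    { refl := fun x => ⟨1, by simp, by simp⟩
      symm := by
        rintro x y ⟨k, h1, h2⟩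
        exact ⟨k⁻¹, by simp [h1], by simp [h2]⟩
      trans := by
        rintro x y z ⟨k, h1, h2⟩ ⟨l, h3, h4⟩
        exact ⟨l * k, by simp [h1, h3, mul_assoc], by simp [h2, h4, mul_smul]⟩ }

/-- The induced `G`-set `G ×_K T`. -/
def FinGSet.ind [Finite G] (φ : K →* G) (T : FinGSet.{u} K) : FinGSet.{u} G :=
  letI : MulAction G (Quotient (indSetoid φ T)) :=
    { smul := fun g => Quotient.map (fun x => (g * x.1, x.2)) (by
        rintro x y ⟨k, h1, h2⟩
        exact ⟨k, by simp [h1, mul_assoc], h2⟩)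
      one_smul := by
        rintro ⟨x⟩
        exact congrArg (fun y => Quotient.mk (indSetoid φ T) (y, x.2)) (one_mul x.1)
      mul_smul := by
        rintro g h ⟨x⟩
        exact congrArg (fun y => Quotient.mk (indSetoid φ T) (y, x.2)) (mul_assoc g h x.1) }
  ⟨Quotient (indSetoid φ T)⟩

/-- The class `[g, t]` in `G ×_K T`. -/
def indMk [Finite G] (φ : K →* G) {T : FinGSet.{u} K} (g : G) (t : T) : FinGSet.ind φ T :=
  Quotient.mk (indSetoid φ T) (g, t)

lemma exists_indMk [Finite G] (φ : K →* G) {T : FinGSet.{u} K} (x : FinGSet.ind φ T) :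
    ∃ g t, x = indMk φ g t := by
  obtain ⟨⟨g, t⟩⟩ := x
  exact ⟨g, t, rfl⟩

lemma indMk_eq [Finite G] (φ : K →* G) {T : FinGSet.{u} K} {g g' : G} {t t' : T} :
    indMk φ g t = indMk φ g' t' ↔ ∃ k : K, g = g' * φ k ∧ t' = k • t :=
  ⟨fun h => Quotient.exact h, fun h => Quotient.sound h⟩

/-- Induction `G ×_K (-)` along an injective homomorphism `K → G`. -/
def ind [Finite G] (φ : K →* G) (hφ : Function.Injective φ) : PBFunctor.{u} K G where
  obj := FinGSet.ind φ
  map f := ⟨Quotient.map (fun x => (x.1, f x.2)) (by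
      rintro x y ⟨k, h1, h2⟩
      exact ⟨k, h1, by rw [h2, map_smul]⟩), by
    rintro g ⟨x⟩
    rfl⟩
  map_id S := by
    ext ⟨x⟩
    rfl
  map_comp f g := by
    ext ⟨x⟩
    rfl
  map_pb {W U V T} p q f g h := by
    refine ⟨?_, fun a b hab => ?_⟩
    · rintro ⟨x⟩
      exact congrArg (indMk φ x.1) (h.1 x.2)
    obtain ⟨x, a, rfl⟩ := exists_indMk φ a
    obtain ⟨y, b, rfl⟩ := exists_indMk φ b
    obtain ⟨k, h1, h2⟩ := (indMk_eq φ).1 hab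
    have hb : indMk φ y b = indMk φ x (k⁻¹ • b) := (indMk_eq φ).2 ⟨k⁻¹, by
      rw [map_inv, eq_mul_inv_iff_mul_eq]
      exact h1.symm, rfl⟩
    rw [hb]
    have h2' : f a = g (k⁻¹ • b) := by
      rw [map_smul, h2]
      exact (inv_smul_smul k (f a)).symm
    generalize k⁻¹ • b = b' at h2'
    obtain ⟨w, ⟨hw1, hw2⟩, hw⟩ := h.2 a b' h2'
    refine ⟨indMk φ x w, ⟨congrArg (indMk φ x) hw1, congrArg (indMk φ x) hw2⟩, fun z hz => ?_⟩
    obtain ⟨z, w', rfl⟩ := exists_indMk φ z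
    obtain ⟨k1, e1, e2⟩ := (indMk_eq φ).1 hz.1
    obtain ⟨k2, e3, e4⟩ := (indMk_eq φ).1 hz.2
    obtain rfl : k1 = k2 := hφ (mul_left_cancel (e1.symm.trans e3))
    refine (indMk_eq φ).2 ⟨k1, e1, (hw _ ⟨?_, ?_⟩).symm⟩
    · rw [map_smul]; exact e2.symm
    · rw [map_smul]; exact e4.symm

end GroupHom

/-! ## Commutative monoids for Day convolution -/

/-- A tensor product on a category, with unit, associator, symmetry and left unitor. -/
class Tens (C : Type w) [Category.{w} C] where
  obj : C → C → C
  map : ∀ {a a' b b' : C}, (a ⟶ a') → (b ⟶ b') → (obj a b ⟶ obj a' b')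
  map_comp : ∀ {a a' a'' b b' b'' : C} (f : a ⟶ a') (f' : a' ⟶ a'') (g : b ⟶ b') (g' : b' ⟶ b''),
    map (f ≫ f') (g ≫ g') = map f g ≫ map f' g'
  unit : C
  assoc : ∀ a b c : C, obj (obj a b) c ⟶ obj a (obj b c)
  assoc_nat : ∀ {a a' b b' c c' : C} (f : a ⟶ a') (g : b ⟶ b') (h : c ⟶ c'),
    map (map f g) h ≫ assoc a' b' c' = assoc a b c ≫ map f (map g h)
  comm : ∀ a b : C, obj a b ⟶ obj b a
  comm_nat : ∀ {a a' b b' : C} (f : a ⟶ a') (g : b ⟶ b'), map f g ≫ comm a' b' = comm a b ≫ map g f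
  lunit : ∀ a : C, obj unit a ⟶ a
  lunit_nat : ∀ {a a' : C} (f : a ⟶ a'), map (𝟙 unit) f ≫ lunit a' = lunit a ≫ f

section Pairing

variable {C D : Type w} [Category.{w} C] [Category.{w} D] [Tens C] [Tens D]

/-- The structure of a commutative monoid for the Day convolution product on a set-valued functor,
that is, of a symmetric lax monoidal functor. By the universal property of the left Kan extension
defining `M □ M`, a natural transformation `M □ M ⟶ M` is a natural family of maps
`M(a) × M(b) → M(a ⊗ b)`; the unit is an element of `M(unit)`. -/
@[ext]
structure CommPairing (M : C ⥤ Type w) where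
  mul : ∀ {a b : C}, M.obj a → M.obj b → M.obj (Tens.obj a b)
  mul_nat : ∀ {a a' b b' : C} (f : a ⟶ a') (g : b ⟶ b') (x : M.obj a) (y : M.obj b),
    M.map (Tens.map f g) (mul x y) = mul (M.map f x) (M.map g y)
  one : M.obj (Tens.unit : C)
  mul_assoc : ∀ {a b c : C} (x : M.obj a) (y : M.obj b) (z : M.obj c),
    M.map (Tens.assoc a b c) (mul (mul x y) z) = mul x (mul y z)
  mul_comm : ∀ {a b : C} (x : M.obj a) (y : M.obj b), M.map (Tens.comm a b) (mul x y) = mul y x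
  one_mul : ∀ {a : C} (x : M.obj a), M.map (Tens.lunit a) (mul one x) = x

/-- The structure maps of a symmetric oplax monoidal functor. -/
structure OplaxSym (F : C ⥤ D) where
  δ : ∀ a b : C, F.obj (Tens.obj a b) ⟶ Tens.obj (F.obj a) (F.obj b)
  δ_nat : ∀ {a a' b b' : C} (f : a ⟶ a') (g : b ⟶ b'),
    F.map (Tens.map f g) ≫ δ a' b' = δ a b ≫ Tens.map (F.map f) (F.map g)
  ε : F.obj Tens.unit ⟶ Tens.unit
  assoc : ∀ a b c : C, F.map (Tens.assoc a b c) ≫ δ a (Tens.obj b c) ≫ Tens.map (𝟙 _) (δ b c) =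
    δ (Tens.obj a b) c ≫ Tens.map (δ a b) (𝟙 _) ≫ Tens.assoc _ _ _
  comm : ∀ a b : C, F.map (Tens.comm a b) ≫ δ b a = δ a b ≫ Tens.comm _ _
  lunit : ∀ a : C, F.map (Tens.lunit a) = δ Tens.unit a ≫ Tens.map ε (𝟙 _) ≫ Tens.lunit _

/-- The left Kan extension of a commutative monoid is a commutative monoid, with
`(s, x) · (t, y) = (δ ≫ (s ⊗ t), x · y)`. -/
def Lan.pairing {F : C ⥤ D} (hF : OplaxSym F) {M : C ⥤ Type w} (P : CommPairing M) :
    CommPairing (Lan F M) where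
  mul {d d'} X Y := Lan.elim (X := (Lan F M).obj (Tens.obj d d')) (fun {a} s x =>
      Lan.elim (X := (Lan F M).obj (Tens.obj d d')) (fun {b} t y =>
        Lan.mk (hF.δ a b ≫ Tens.map s t) (P.mul x y)) (by
          intro b b' v t y
          have h := P.mul_nat (𝟙 a) v x y
          rw [Functor.map_id_apply] at h
          rw [← h, ← Lan.mk_map, ← Category.assoc, hF.δ_nat, Category.assoc, F.map_id,
            ← Tens.map_comp, Category.id_comp]) Y) (by
      intro a a' v s x
      obtain ⟨b, t, y, rfl⟩ := Lan.exists_mk Y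
      have h := P.mul_nat v (𝟙 b) x y
      rw [Functor.map_id_apply] at h
      change Lan.mk (hF.δ a b ≫ Tens.map (F.map v ≫ s) t) (P.mul x y) =
        Lan.mk (hF.δ a' b ≫ Tens.map s t) (P.mul (M.map v x) y)
      rw [← h, ← Lan.mk_map, ← Category.assoc, hF.δ_nat, Category.assoc, F.map_id,
            ← Tens.map_comp, Category.id_comp]) X
  mul_nat f g X Y := by
    obtain ⟨a, s, x, rfl⟩ := Lan.exists_mk X
    obtain ⟨b, t, y, rfl⟩ := Lan.exists_mk Y
    change Lan.mk ((hF.δ a b ≫ Tens.map s t) ≫ Tens.map f g) (P.mul x y) =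
      Lan.mk (hF.δ a b ≫ Tens.map (s ≫ f) (t ≫ g)) (P.mul x y)
    rw [Category.assoc, Tens.map_comp]
  one := Lan.mk hF.ε P.one
  mul_assoc X Y Z := by
    obtain ⟨a, s, x, rfl⟩ := Lan.exists_mk X
    obtain ⟨b, t, y, rfl⟩ := Lan.exists_mk Y
    obtain ⟨c, r, z, rfl⟩ := Lan.exists_mk Z
    change Lan.mk ((hF.δ _ c ≫ Tens.map (hF.δ a b ≫ Tens.map s t) r) ≫ Tens.assoc _ _ _)
      (P.mul (P.mul x y) z) =
      Lan.mk (hF.δ a _ ≫ Tens.map s (hF.δ b c ≫ Tens.map t r)) (P.mul x (P.mul y z))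
    rw [← P.mul_assoc, ← Lan.mk_map]
    congr 1
    have h1 : Tens.map s (hF.δ b c ≫ Tens.map t r) =
        Tens.map (𝟙 _) (hF.δ b c) ≫ Tens.map s (Tens.map t r) := by
      rw [← Tens.map_comp, Category.id_comp]
    have h2 : Tens.map (hF.δ a b ≫ Tens.map s t) r =
        Tens.map (hF.δ a b) (𝟙 _) ≫ Tens.map (Tens.map s t) r := by
      rw [← Tens.map_comp, Category.id_comp]
    rw [h1, h2, Category.assoc, Category.assoc, Tens.assoc_nat]
    have h3 := hF.assoc a b c =≫ Tens.map s (Tens.map t r)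
    simp only [Category.assoc] at h3
    exact h3.symm
  mul_comm X Y := by
    obtain ⟨a, s, x, rfl⟩ := Lan.exists_mk X
    obtain ⟨b, t, y, rfl⟩ := Lan.exists_mk Y
    change Lan.mk ((hF.δ a b ≫ Tens.map s t) ≫ Tens.comm _ _) (P.mul x y) =
      Lan.mk (hF.δ b a ≫ Tens.map t s) (P.mul y x)
    rw [← P.mul_comm x y, ← Lan.mk_map, Category.assoc, Tens.comm_nat, ← Category.assoc,
      ← Category.assoc, hF.comm]
  one_mul X := by
    obtain ⟨a, s, x, rfl⟩ := Lan.exists_mk X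
    change Lan.mk ((hF.δ _ a ≫ Tens.map hF.ε s) ≫ Tens.lunit _) (P.mul P.one x) = _
    have h1 : Tens.map hF.ε s = Tens.map hF.ε (𝟙 _) ≫ Tens.map (𝟙 _) s := by
      rw [← Tens.map_comp, Category.id_comp, Category.comp_id]
    conv_rhs => rw [← P.one_mul x, ← Lan.mk_map, hF.lunit]
    rw [h1, Category.assoc, Category.assoc, Tens.lunit_nat, Category.assoc, Category.assoc]

/-- The structure maps of a symmetric lax monoidal functor. -/
structure LaxSym (F : C ⥤ D) where
  γ : ∀ a b : C, Tens.obj (F.obj a) (F.obj b) ⟶ F.obj (Tens.obj a b)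
  γ_nat : ∀ {a a' b b' : C} (f : a ⟶ a') (g : b ⟶ b'),
    Tens.map (F.map f) (F.map g) ≫ γ a' b' = γ a b ≫ F.map (Tens.map f g)
  ε : Tens.unit ⟶ F.obj Tens.unit
  assoc : ∀ a b c : C, Tens.map (γ a b) (𝟙 _) ≫ γ (Tens.obj a b) c ≫ F.map (Tens.assoc a b c) =
    Tens.assoc _ _ _ ≫ Tens.map (𝟙 _) (γ b c) ≫ γ a (Tens.obj b c)
  comm : ∀ a b : C, γ a b ≫ F.map (Tens.comm a b) = Tens.comm _ _ ≫ γ b a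
  lunit : ∀ a : C, Tens.map ε (𝟙 _) ≫ γ Tens.unit a ≫ F.map (Tens.lunit a) = Tens.lunit _

/-- Precomposition of a commutative monoid with a lax monoidal functor. -/
def CommPairing.precomp {F : C ⥤ D} (hF : LaxSym F) {M : D ⥤ Type w} (P : CommPairing M) :
    CommPairing (F ⋙ M) where
  mul {a b} x y := M.map (hF.γ a b) (P.mul x y)
  mul_nat {a a' b b'} f g x y := by
    change M.map (F.map _) _ = M.map _ (P.mul (M.map (F.map f) x) (M.map (F.map g) y))
    rw [← P.mul_nat, ← Functor.map_comp_apply, ← Functor.map_comp_apply, hF.γ_nat]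
  one := M.map hF.ε P.one
  mul_assoc {a b c} x y z := by
    change M.map (F.map _) (M.map _ (P.mul (M.map _ (P.mul x y)) z)) =
      M.map _ (P.mul x (M.map _ (P.mul y z)))
    have h1 := P.mul_nat (hF.γ a b) (𝟙 _) (P.mul x y) z
    have h2 := P.mul_nat (𝟙 _) (hF.γ b c) x (P.mul y z)
    rw [Functor.map_id_apply] at h1 h2
    rw [← h1, ← h2, ← P.mul_assoc]
    simp only [← Functor.map_comp_apply, Category.assoc]
    rw [hF.assoc]
  mul_comm {a b} x y := by
    change M.map (F.map _) (M.map _ (P.mul x y)) = M.map _ (P.mul y x)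
    rw [← P.mul_comm x y, ← Functor.map_comp_apply, ← Functor.map_comp_apply, hF.comm]
  one_mul {a} x := by
    change M.map (F.map _) (M.map _ (P.mul (M.map _ P.one) x)) = x
    have h1 := P.mul_nat hF.ε (𝟙 _) P.one x
    rw [Functor.map_id_apply] at h1
    rw [← h1, ← Functor.map_comp_apply, ← Functor.map_comp_apply, hF.lunit, P.one_mul]

end Pairing

section Green

variable {G : Type} [Group G]

/-- The Burnside category with the cartesian product of `G`-sets. -/
instance : Tens (FinGSet.{u} G) where
  obj := FinGSet.prod
  map := burnsideProd
  map_comp := burnsideProd_comp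
  unit := FinGSet.pt G
  assoc S T W := tr (⟨fun x => (x.1.1, x.1.2, x.2), fun _ _ => rfl⟩ :
    (S.prod T).prod W →[G] S.prod (T.prod W))
  assoc_nat f g h := by
    obtain ⟨U, rfl⟩ := exists_span f
    obtain ⟨V, rfl⟩ := exists_span g
    obtain ⟨W, rfl⟩ := exists_span h
    exact tr_square ((U.prod V).prod W) (U.prod (V.prod W)) _ _
      ⟨fun x => (x.1.1, x.1.2, x.2), fun _ _ => rfl⟩ (Equiv.prodAssoc _ _ _).bijective
      (Equiv.prodAssoc _ _ _).bijective (fun _ => rfl) (fun _ => rfl)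
  comm S T := tr (FinGSet.prodLift (FinGSet.snd S T) (FinGSet.fst S T))
  comm_nat f g := by
    obtain ⟨U, rfl⟩ := exists_span f
    obtain ⟨V, rfl⟩ := exists_span g
    exact tr_square (U.prod V) (V.prod U) _ _ (FinGSet.prodLift (FinGSet.snd _ _) (FinGSet.fst _ _))
      (Equiv.prodComm _ _).bijective (Equiv.prodComm _ _).bijective (fun _ => rfl) (fun _ => rfl)
  lunit S := tr (FinGSet.snd (FinGSet.pt G) S)
  lunit_nat f := by
    obtain ⟨U, rfl⟩ := exists_span f
    exact tr_square (GSpan.prod ⟨FinGSet.pt G, .id G, .id G⟩ U) U (FinGSet.snd _ _)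
      (FinGSet.snd _ _) (FinGSet.snd _ _) (Equiv.punitProd _).bijective
      (Equiv.punitProd _).bijective (fun _ => rfl) (fun _ => rfl)

/-- Families of objects, with the componentwise tensor product. -/
instance (ι : Type) : Tens (ι → FinGSet.{u} G) where
  obj S T i := Tens.obj (S i) (T i)
  map f g i := Tens.map (f i) (g i)
  map_comp f f' g g' := funext fun i => Tens.map_comp (f i) (f' i) (g i) (g' i)
  unit _ := Tens.unit
  assoc _ _ _ _ := Tens.assoc _ _ _
  assoc_nat f g h := funext fun i => Tens.assoc_nat (f i) (g i) (h i)
  comm _ _ _ := Tens.comm _ _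
  comm_nat f g := funext fun i => Tens.comm_nat (f i) (g i)
  lunit _ _ := Tens.lunit _
  lunit_nat f := funext fun i => Tens.lunit_nat (f i)

/-- A commutative Green functor: a commutative monoid in Mackey functors under the box product,
which is Day convolution for the cartesian product on the Burnside category. -/
structure CommGreen (G : Type) [Group G] where
  mack : Mack.{u, u + 1} G
  pairing : CommPairing mack.obj

namespace CommGreen

/-- The underlying functor on the Burnside category. -/
abbrev fn (R : CommGreen.{u} G) : FinGSet.{u} G ⥤ Type (u + 1) := R.mack.obj

/-- Morphisms of commutative Green functors. -/
@[ext]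
structure Hom (R R' : CommGreen.{u} G) where
  nat : R.fn ⟶ R'.fn
  map_mul : ∀ {S T : FinGSet.{u} G} (x : R.fn.obj S) (y : R.fn.obj T),
    nat.app _ (R.pairing.mul x y) = R'.pairing.mul (nat.app _ x) (nat.app _ y)
  map_one : nat.app _ R.pairing.one = R'.pairing.one

instance : Category (CommGreen.{u} G) where
  Hom := Hom
  id _ := ⟨𝟙 _, fun _ _ => rfl, rfl⟩
  comp f g := ⟨f.nat ≫ g.nat, fun x y => (congrArg (g.nat.app _) (f.map_mul x y)).trans
    (g.map_mul _ _), (congrArg (g.nat.app _) f.map_one).trans g.map_one⟩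
  id_comp _ := Hom.ext (Category.id_comp _)
  comp_id _ := Hom.ext (Category.comp_id _)
  assoc _ _ _ := Hom.ext (Category.assoc _ _ _)

@[ext]
lemma hom_ext' {R R' : CommGreen.{u} G} {f g : R ⟶ R'} (h : Hom.nat f = Hom.nat g) : f = g :=
  Hom.ext h

end CommGreen

/-- The forgetful functor from commutative Green functors to Mackey functors. -/
def greenToMack (G : Type) [Group G] : CommGreen.{u} G ⥤ Mack.{u, u + 1} G where
  obj R := R.mack
  map f := ObjectProperty.homMk f.nat

end Green

/-! ## Norm and restriction -/

section NormRes

variable {C D : Type w} [Category.{w} C] [Category.{w} D]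

/-- Functoriality of the left Kan extension. -/
def Lan.mapNat {F : C ⥤ D} {M M' : C ⥤ Type w} (α : M ⟶ M') : Lan F M ⟶ Lan F M' :=
  Lan.desc (α ≫ Lan.unit F M')

lemma Lan.mapNat_mk {F : C ⥤ D} {M M' : C ⥤ Type w} (α : M ⟶ M') {d : D} {c : C}
    (s : F.obj c ⟶ d) (m : M.obj c) :
    (Lan.mapNat α).app d (Lan.mk s m) = Lan.mk s (α.app c m) := by
  change (Lan F M').map s (Lan.mk (𝟙 _) (α.app c m)) = _
  rw [Lan.map_mk, Category.id_comp]

variable {K G : Type} [Group K] [Group G] [Finite G]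

/-- Coinduction is symmetric monoidal for the cartesian product. -/
def coindOplax (φ : K →* G) : OplaxSym (coind.{u} φ).burnside where
  δ S T := tr (FinGSet.prodLift ((coind φ).map (FinGSet.fst S T)) ((coind φ).map (FinGSet.snd S T)))
  δ_nat {S S' T T'} f g := by
    have hb : ∀ S T : FinGSet.{u} K, Function.Bijective (FinGSet.prodLift
        ((coind φ).map (FinGSet.fst S T)) ((coind φ).map (FinGSet.snd S T))) := by
      refine fun S T => Function.bijective_iff_has_inverse.2 ⟨fun x =>
        ⟨fun g => (x.1.1 g, x.2.1 g), fun k g => Prod.ext (x.1.2 k g) (x.2.2 k g)⟩, ?_, ?_⟩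
      · intro x; rfl
      · intro x; rfl
    obtain ⟨U, rfl⟩ := exists_span f
    obtain ⟨V, rfl⟩ := exists_span g
    exact tr_square ((coind φ).span (U.prod V)) (GSpan.prod ((coind φ).span U) ((coind φ).span V))
      _ _ (FinGSet.prodLift ((coind φ).map (FinGSet.fst _ _)) ((coind φ).map (FinGSet.snd _ _)))
      (hb _ _) (hb _ _) (fun _ => rfl) (fun _ => rfl)
  ε := tr (FinGSet.toPt _)
  assoc S T W := by
    rw [show (coind φ).burnside.map (Tens.assoc S T W) = _ from (coind φ).burnside_tr _]
    change tr _ ≫ tr _ ≫ tr _ = tr _ ≫ tr _ ≫ tr _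
    exact tr3 fun _ => rfl
  comm S T := by
    rw [show (coind φ).burnside.map (Tens.comm S T) = _ from (coind φ).burnside_tr _]
    exact tr2 fun _ => rfl
  lunit S := by
    rw [show (coind φ).burnside.map (Tens.lunit S) = _ from (coind φ).burnside_tr _,
      ← Category.id_comp (tr ((coind φ).map _)), ← Category.id_comp (𝟙 _ ≫ tr _)]
    change tr (.id G) ≫ tr (.id G) ≫ tr _ = tr _ ≫ tr _ ≫ tr _
    exact tr3 fun _ => rfl

/-- The norm `N_K^G M`: the left Kan extension of `M` along coinduction. -/
abbrev normFn (φ : K →* G) (M : FinGSet.{u} K ⥤ Type (u + 1)) : FinGSet.{u} G ⥤ Type (u + 1) :=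
  Lan (coind φ).burnside M

lemma isMackey_norm (φ : K →* G) {M : FinGSet.{u} K ⥤ Type (u + 1)} (hM : IsMackey M) :
    IsMackey (normFn φ M) := by
  obtain ⟨hM, hneg⟩ := hM
  refine Lan.isMackey _ M hM.preservesProds fun S m => ?_
  obtain ⟨m', hm'⟩ := hneg S m
  refine ⟨S.sum S, FinGSet.empty K, res (FinGSet.inl S S), tr (FinGSet.fold S),
    tr (FinGSet.fromEmpty S), (coind φ).map (FinGSet.inl S S), (coind φ).map (FinGSet.fold S),
    hM.pair m m', hM.empty.choose, ⟨fun x => PEmpty.elim (x.1 1)⟩, ?_, fun x => rfl,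
    (coind φ).burnside_res _, (coind φ).burnside_tr _, hM.inl_pair m m', hm'⟩
  intro x y hxy
  exact Subtype.ext (funext fun g => Sum.inl_injective (congrFun (congrArg Subtype.val hxy) g))

/-- The norm functor from commutative Green functors for `K` to those for `G`. -/
def norm (φ : K →* G) : CommGreen.{u} K ⥤ CommGreen.{u} G where
  obj R := ⟨⟨normFn φ R.fn, isMackey_norm φ R.mack.property⟩, Lan.pairing (coindOplax φ) R.pairing⟩
  map {R R'} f :=
    { nat := Lan.mapNat f.nat
      map_mul := by
        intro S T X Y
        obtain ⟨a, s, x, rfl⟩ := Lan.exists_mk X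
        obtain ⟨b, t, y, rfl⟩ := Lan.exists_mk Y
        rw [Lan.mapNat_mk, Lan.mapNat_mk]
        change (Lan.mapNat f.nat).app _ (Lan.mk _ (R.pairing.mul x y)) =
          Lan.mk _ (R'.pairing.mul _ _)
        rw [Lan.mapNat_mk, f.map_mul]
      map_one := by
        change (Lan.mapNat f.nat).app _ (Lan.mk _ R.pairing.one) = Lan.mk _ R'.pairing.one
        rw [Lan.mapNat_mk, f.map_one] }
  map_id R := by
    refine CommGreen.hom_ext' (Lan.hom_ext fun c m => ?_)
    exact Lan.mapNat_mk _ _ _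
  map_comp f g := by
    refine CommGreen.hom_ext' (Lan.hom_ext fun c m => ?_)
    refine (Lan.mapNat_mk _ _ _).trans ?_
    refine Eq.symm ((congrArg ((Lan.mapNat g.nat).app _) (Lan.mapNat_mk f.nat _ m)).trans ?_)
    exact Lan.mapNat_mk g.nat _ _

lemma isPB_ind (φ : K →* G) (hφ : Function.Injective φ) {U V S T : FinGSet.{u} K} (r : U →[K] S)
    (r' : V →[K] T) : IsPB
      (FinGSet.prodLift ((ind φ hφ).map (FinGSet.fst U V)) ((ind φ hφ).map (FinGSet.snd U V)))
      ((ind φ hφ).map (FinGSet.prodMap r r'))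
      (FinGSet.prodMap ((ind φ hφ).map r) ((ind φ hφ).map r'))
      (FinGSet.prodLift ((ind φ hφ).map (FinGSet.fst S T)) ((ind φ hφ).map (FinGSet.snd S T))) := by
  refine ⟨?_, ?_⟩
  · rintro ⟨x⟩
    rfl
  · rintro ⟨a, b⟩ c hab
    obtain ⟨x, u, rfl⟩ := exists_indMk φ a
    obtain ⟨y, v, rfl⟩ := exists_indMk φ b
    obtain ⟨z, ⟨s, t⟩, rfl⟩ := exists_indMk φ c
    obtain ⟨k, h1, h2⟩ := (indMk_eq φ).1 (congrArg Prod.fst hab)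
    obtain ⟨l, h3, h4⟩ := (indMk_eq φ).1 (congrArg Prod.snd hab)
    have ea : indMk φ x u = indMk φ z (k • u) := (indMk_eq φ).2 ⟨k, h1, rfl⟩
    have eb : indMk φ y v = indMk φ z (l • v) := (indMk_eq φ).2 ⟨l, h3, rfl⟩
    have h2' : s = r (k • u) := by rw [map_smul]; exact h2
    have h4' : t = r' (l • v) := by rw [map_smul]; exact h4
    subst h2' h4'
    rw [ea, eb]
    generalize k • u = u
    generalize l • v = v
    refine ⟨indMk φ z (T := U.prod V) (u, v), ⟨rfl, rfl⟩, ?_⟩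
    rintro y ⟨hy, -⟩
    obtain ⟨y, ⟨u', v'⟩, rfl⟩ := exists_indMk φ y
    obtain ⟨k1, e1, e2⟩ := (indMk_eq φ).1 (congrArg Prod.fst hy)
    obtain ⟨k2, e3, e4⟩ := (indMk_eq φ).1 (congrArg Prod.snd hy)
    obtain rfl : k1 = k2 := hφ (mul_left_cancel (e1.symm.trans e3))
    exact (indMk_eq φ).2 ⟨k1, e1, Prod.ext e2 e4⟩

/-- The lax monoidal structure of induction on Burnside categories, by restriction along
`G ×_K (S × T) → (G ×_K S) × (G ×_K T)`. -/
def indLax (φ : K →* G) (hφ : Function.Injective φ) : LaxSym (ind.{u} φ hφ).burnside where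
  γ S T := res (FinGSet.prodLift ((ind φ hφ).map (FinGSet.fst S T))
    ((ind φ hφ).map (FinGSet.snd S T)))
  γ_nat f g := by
    obtain ⟨U, rfl⟩ := exists_span f
    obtain ⟨V, rfl⟩ := exists_span g
    change (GSpan.prod ((ind φ hφ).span U) ((ind φ hφ).span V)).mk' ≫ _ =
      _ ≫ ((ind φ hφ).span (U.prod V)).mk'
    rw [mk'_eq, mk'_eq]
    have h := base_change _ _ _ _ (isPB_ind φ hφ U.r V.r)
    refine (Category.assoc _ _ _).trans ((congrArg (res _ ≫ ·) h).trans ?_)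
    refine (Category.assoc _ _ _).symm.trans (Eq.trans ?_ (Category.assoc _ _ _))
    refine congrArg (· ≫ tr _) (res2 ?_)
    rintro ⟨x⟩
    rfl
  ε := res (FinGSet.toPt _)
  assoc S T W := by
    have h1 : (Tens.assoc S T W : _ ⟶ _) = res (⟨fun x => ((x.1, x.2.1), x.2.2), fun _ _ => rfl⟩ :
        S.prod (T.prod W) →[K] (S.prod T).prod W) := tr_eq_res _ _ (fun _ => rfl) fun _ => rfl
    have h2 : ∀ S T W : FinGSet.{u} G, (Tens.assoc S T W : _ ⟶ _) =
        res (⟨fun x => ((x.1, x.2.1), x.2.2), fun _ _ => rfl⟩ :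
        S.prod (T.prod W) →[G] (S.prod T).prod W) := fun _ _ _ =>
      tr_eq_res _ _ (fun _ => rfl) fun _ => rfl
    rw [h1, h2, (ind φ hφ).burnside_res]
    change res (FinGSet.prodMap _ (.id G)) ≫ res _ ≫ res _ =
      res _ ≫ res (FinGSet.prodMap (.id G) _) ≫ res _
    refine res3 ?_
    rintro ⟨x⟩
    rfl
  comm S T := by
    have h1 : (Tens.comm S T : _ ⟶ _) = res (FinGSet.prodLift (FinGSet.snd T S) (FinGSet.fst T S)) :=
      tr_eq_res _ _ (fun _ => rfl) fun _ => rfl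
    have h2 : ∀ S T : FinGSet.{u} G, (Tens.comm S T : _ ⟶ _) =
        res (FinGSet.prodLift (FinGSet.snd T S) (FinGSet.fst T S)) := fun _ _ =>
      tr_eq_res _ _ (fun _ => rfl) fun _ => rfl
    rw [h1, h2, (ind φ hφ).burnside_res]
    refine res2 ?_
    rintro ⟨x⟩
    rfl
  lunit S := by
    have h1 : (Tens.lunit S : _ ⟶ _) = res (FinGSet.prodLift (FinGSet.toPt S) (.id K)) :=
      tr_eq_res _ _ (fun _ => rfl) fun _ => rfl
    have h2 : ∀ S : FinGSet.{u} G, (Tens.lunit S : _ ⟶ _) =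
        res (FinGSet.prodLift (FinGSet.toPt S) (.id G)) := fun _ =>
      tr_eq_res _ _ (fun _ => rfl) fun _ => rfl
    rw [h1, h2, (ind φ hφ).burnside_res]
    refine Eq.trans ?_ ((congrArg (_ ≫ ·) (Category.comp_id _)).trans (Category.comp_id _))
    change res (FinGSet.prodMap _ (.id G)) ≫ res _ ≫ res _ = res _ ≫
      res (.id G : FinGSet.ind φ S →[G] FinGSet.ind φ S) ≫
      res (.id G : FinGSet.ind φ S →[G] FinGSet.ind φ S)
    refine res3 ?_
    rintro ⟨x⟩
    rfl

/-- The restriction `i_K^* M`, with `(i_K^* M)(T) = M(G ×_K T)`. -/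
abbrev resFn (φ : K →* G) (hφ : Function.Injective φ) (M : FinGSet.{u} G ⥤ Type w) :
    FinGSet.{u} K ⥤ Type w := (ind φ hφ).burnside ⋙ M

lemma isMackey_res (φ : K →* G) (hφ : Function.Injective φ) {M : FinGSet.{u} G ⥤ Type w}
    (hM : IsMackey M) : IsMackey (resFn φ hφ M) := by
  obtain ⟨hM, hneg⟩ := hM
  have hcov : ∀ S T : FinGSet.{u} K, Function.Bijective (FinGSet.sumElim
      ((ind φ hφ).map (FinGSet.inl S T)) ((ind φ hφ).map (FinGSet.inr S T))) := by
    refine fun S T => ⟨?_, ?_⟩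
    · rintro (⟨⟨g, x⟩⟩ | ⟨⟨g, x⟩⟩) (⟨⟨g', y⟩⟩ | ⟨⟨g', y⟩⟩) h
      · obtain ⟨k, h1, h2⟩ := (indMk_eq φ (T := S.sum T) (t := Sum.inl x)
          (t' := Sum.inl y)).1 h
        exact congrArg Sum.inl ((indMk_eq φ).2 ⟨k, h1, Sum.inl_injective h2⟩)
      · obtain ⟨k, h1, h2⟩ := (indMk_eq φ (T := S.sum T) (t := Sum.inl x)
          (t' := Sum.inr y)).1 h
        cases h2
      · obtain ⟨k, h1, h2⟩ := (indMk_eq φ (T := S.sum T) (t := Sum.inr x)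
          (t' := Sum.inl y)).1 h
        cases h2
      · obtain ⟨k, h1, h2⟩ := (indMk_eq φ (T := S.sum T) (t := Sum.inr x)
          (t' := Sum.inr y)).1 h
        exact congrArg Sum.inr ((indMk_eq φ).2 ⟨k, h1, Sum.inr_injective h2⟩)
    · intro x
      obtain ⟨g, s | t, rfl⟩ := exists_indMk φ x
      · exact ⟨Sum.inl (indMk φ g s), rfl⟩
      · exact ⟨Sum.inr (indMk φ g t), rfl⟩
  have hemp : ∀ x : FinGSet.ind φ (FinGSet.empty.{u} K), False := fun x => by
    obtain ⟨g, t, -⟩ := exists_indMk φ x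
    exact PEmpty.elim t
  have hz : ∀ x : M.obj (FinGSet.ind φ (FinGSet.empty.{u} K)), x = hM.zero _ := by
    intro x
    have hb : Function.Bijective (FinGSet.fromEmpty (FinGSet.ind φ (FinGSet.empty.{u} K))) :=
      ⟨fun a => PEmpty.elim a, fun a => (hemp a).elim⟩
    rw [IsSemiMackey.zero, ← hM.empty.choose_spec (M.map (res (FinGSet.fromEmpty _)) x),
      ← Functor.map_comp_apply, (tr_res_of_bij _ hb).2, Functor.map_id_apply]
  have hN : IsSemiMackey (resFn φ hφ M) := by
    refine ⟨⟨hM.zero _, hz⟩, fun S T => ?_⟩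
    have := hM.sum_of_cover _ _ (hcov S T)
    rw [← (ind φ hφ).burnside_res, ← (ind φ hφ).burnside_res] at this
    exact this
  refine ⟨hN, fun T a => ?_⟩
  obtain ⟨b, hb⟩ := hneg _ a
  refine ⟨b, ?_⟩
  have e1 : ∀ w : M.obj (FinGSet.ind φ (T.sum T)),
      M.map ((ind φ hφ).burnside.map (tr (FinGSet.fold T))) w =
      hM.add (M.map ((ind φ hφ).burnside.map (res (FinGSet.inl T T))) w)
        (M.map ((ind φ hφ).burnside.map (res (FinGSet.inr T T))) w) := by
    intro w
    have hl : ((ind φ hφ).map (FinGSet.fold T)).comp ((ind φ hφ).map (FinGSet.inl T T)) = .id G := by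
      ext ⟨x⟩; rfl
    have hr : ((ind φ hφ).map (FinGSet.fold T)).comp ((ind φ hφ).map (FinGSet.inr T T)) = .id G := by
      ext ⟨x⟩; rfl
    have h := congrArg (M.map (tr ((ind φ hφ).map (FinGSet.fold T))))
      (hM.eq_add_of_cover _ _ (hcov T T) w)
    rw [hM.map_add, ← Functor.map_comp_apply, ← Functor.map_comp_apply, ← tr_comp, ← tr_comp, hl,
      hr, tr_id, Functor.map_id_apply, Functor.map_id_apply] at h
    rw [(ind φ hφ).burnside_res, (ind φ hφ).burnside_res, (ind φ hφ).burnside_tr]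
    exact h
  refine (e1 (hN.pair a b)).trans ?_
  refine (congrArg₂ hM.add (hN.inl_pair a b) (hN.inr_pair a b)).trans (hb.trans ?_)
  refine Eq.symm ((congrArg (M.map _) (hz _)).trans (hM.map_zero _))

/-- The restriction functor on commutative Green functors. -/
def restrict (φ : K →* G) (hφ : Function.Injective φ) : CommGreen.{u} G ⥤ CommGreen.{u} K where
  obj R := ⟨⟨resFn φ hφ R.fn, isMackey_res φ hφ R.mack.property⟩,
    R.pairing.precomp (indLax φ hφ)⟩
  map {R R'} f :=
    { nat := Functor.whiskerLeft _ f.nat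
      map_mul := by
        intro S T x y
        change f.nat.app _ (R.fn.map _ (R.pairing.mul x y)) = R'.fn.map _ (R'.pairing.mul _ _)
        rw [NatTrans.naturality_apply, f.map_mul]
        rfl
      map_one := by
        change f.nat.app _ (R.fn.map _ R.pairing.one) = R'.fn.map _ R'.pairing.one
        rw [NatTrans.naturality_apply, f.map_one] }

end NormRes

/-! ## Box products and the internal multiplication -/

section Box

variable {G : Type} [Group G]

/-- The external product `(Sᵢ)ᵢ ↦ ∏ᵢ Mᵢ(Sᵢ)`. -/
def extProd {ι : Type} (M : ι → (FinGSet.{u} G ⥤ Type (u + 1))) :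
    (ι → FinGSet.{u} G) ⥤ Type (u + 1) where
  obj S := ∀ i, (M i).obj (S i)
  map f := ↾fun x i => (M i).map (f i) (x i)
  map_id S := by
    ext x i
    exact Functor.map_id_apply (M i) (S i) (x i)
  map_comp f g := by
    ext x i
    exact Functor.map_comp_apply (M i) (f i) (g i) (x i)

/-- The box product `□ᵢ Mᵢ` of a finite family: the left Kan extension of the external product
along the cartesian product of finite `G`-sets. -/
noncomputable abbrev box {ι : Type} [Finite ι] (M : ι → (FinGSet.{u} G ⥤ Type (u + 1))) :
    FinGSet.{u} G ⥤ Type (u + 1) := Lan (piFunctor G ι) (extProd M)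

lemma preservesProds_extProd {ι : Type} {M : ι → (FinGSet.{u} G ⥤ Type (u + 1))}
    (hM : ∀ i, IsSemiMackey (M i)) : PreservesProds (extProd M) := by
  refine ⟨⟨fun _ => FinGSet.empty G, ⟨fun i => (hM i).empty.choose⟩⟩, fun S T =>
    ⟨fun i => (S i).sum (T i), fun i => res (FinGSet.inl _ _), fun i => res (FinGSet.inr _ _),
      fun X f g => ?_, ?_, ?_⟩⟩
  · choose l h1 h2 using fun i => burnside_lift (f i) (g i)
    exact ⟨l, funext h1, funext h2⟩
  · intro x y hxy
    exact funext fun i => (hM i).hom_ext (congrFun (congrArg Prod.fst hxy) i)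
      (congrFun (congrArg Prod.snd hxy) i)
  · rintro ⟨x, y⟩
    exact ⟨fun i => (hM i).pair (x i) (y i), Prod.ext (funext fun i => (hM i).inl_pair _ _)
      (funext fun i => (hM i).inr_pair _ _)⟩

lemma isMackey_box {ι : Type} [Finite ι] [Nonempty ι] {M : ι → (FinGSet.{u} G ⥤ Type (u + 1))}
    (hM : ∀ i, IsMackey (M i)) : IsMackey (box M) := by
  choose hM hneg using hM
  refine Lan.isMackey _ _ (preservesProds_extProd hM) fun S m => ?_
  choose m' hm' using fun i => hneg i (S i) (m i)
  refine ⟨fun i => (S i).sum (S i), fun i => FinGSet.empty G, fun i => res (FinGSet.inl _ _),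
    fun i => tr (FinGSet.fold _), fun i => tr (FinGSet.fromEmpty _),
    FinGSet.piMap fun i => FinGSet.inl _ _, FinGSet.piMap fun i => FinGSet.fold _,
    fun i => (hM i).pair (m i) (m' i), fun i => (hM i).empty.choose, ?_, ?_, fun _ => rfl,
    burnsidePi_res _, burnsidePi_tr _, funext fun i => (hM i).inl_pair _ _, funext hm'⟩
  · exact ⟨fun x => PEmpty.elim (x (Classical.arbitrary ι))⟩
  · exact Function.Injective.piMap fun i => Sum.inl_injective

/-- The cartesian product of finite families is symmetric monoidal. -/
noncomputable def piOplax (G : Type) [Group G] (ι : Type) [Finite ι] :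
    OplaxSym (piFunctor.{u} G ι) where
  δ S T := tr (FinGSet.prodLift (FinGSet.piMap fun i => FinGSet.fst (S i) (T i))
    (FinGSet.piMap fun i => FinGSet.snd (S i) (T i)))
  δ_nat {S S' T T'} f g := by
    have hb : ∀ S T : ι → FinGSet.{u} G, Function.Bijective (FinGSet.prodLift
        (FinGSet.piMap fun i => FinGSet.fst (S i) (T i))
        (FinGSet.piMap fun i => FinGSet.snd (S i) (T i))) := fun S T =>
      Function.bijective_iff_has_inverse.2 ⟨fun x i => (x.1 i, x.2 i), fun _ => rfl, fun _ => rfl⟩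
    obtain ⟨U, hU⟩ : ∃ U : ∀ i, GSpan (S i) (S' i), f = fun i => (U i).mk' :=
      ⟨fun i => (exists_span (f i)).choose, funext fun i => (exists_span (f i)).choose_spec⟩
    obtain ⟨V, hV⟩ : ∃ V : ∀ i, GSpan (T i) (T' i), g = fun i => (V i).mk' :=
      ⟨fun i => (exists_span (g i)).choose, funext fun i => (exists_span (g i)).choose_spec⟩
    subst hU hV
    have h := tr_square (GSpan.pi fun i => (U i).prod (V i)) ((GSpan.pi U).prod (GSpan.pi V))
      _ (FinGSet.prodLift (FinGSet.piMap fun i => FinGSet.fst _ _)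
        (FinGSet.piMap fun i => FinGSet.snd _ _)) (hb S T) (hb _ _) (fun _ => rfl)
      (b := (FinGSet.prodLift (FinGSet.piMap fun i => FinGSet.fst (S' i) (T' i))
        (FinGSet.piMap fun i => FinGSet.snd (S' i) (T' i)))) (fun _ => rfl)
    refine (congrArg (· ≫ _) (burnsidePi_mk' fun i => (U i).prod (V i))).trans (h.trans ?_)
    exact congrArg₂ (fun a b => _ ≫ burnsideProd a b) (burnsidePi_mk' U).symm (burnsidePi_mk' V).symm
  ε := tr (FinGSet.toPt _)
  assoc S T W := by
    rw [show (piFunctor G ι).map (Tens.assoc S T W) = _ from burnsidePi_tr _]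
    change tr _ ≫ tr _ ≫ tr _ = tr _ ≫ tr _ ≫ tr _
    exact tr3 fun _ => rfl
  comm S T := by
    rw [show (piFunctor G ι).map (Tens.comm S T) = _ from burnsidePi_tr _]
    exact tr2 fun _ => rfl
  lunit S := by
    rw [show (piFunctor G ι).map (Tens.lunit S) = _ from burnsidePi_tr _,
      ← Category.id_comp (tr (FinGSet.piMap _)), ← Category.id_comp (𝟙 _ ≫ tr _)]
    change tr (.id G) ≫ tr (.id G) ≫ tr _ = tr _ ≫ tr _ ≫ tr _
    exact tr3 fun _ => rfl

/-- The componentwise multiplication on an external product. -/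
def extPairing {ι : Type} (R : ι → CommGreen.{u} G) :
    CommPairing (extProd fun i => (R i).fn) where
  mul x y i := (R i).pairing.mul (x i) (y i)
  mul_nat _ _ _ _ := funext fun i => (R i).pairing.mul_nat _ _ _ _
  one i := (R i).pairing.one
  mul_assoc _ _ _ := funext fun i => (R i).pairing.mul_assoc _ _ _
  mul_comm _ _ := funext fun i => (R i).pairing.mul_comm _ _
  one_mul _ := funext fun i => (R i).pairing.one_mul _

/-- The box power `R^{□ ι}` as a commutative Green functor. -/
noncomputable def boxPow (R : CommGreen.{u} G) (ι : Type) [Finite ι] [Nonempty ι] :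
    CommGreen.{u} G :=
  ⟨⟨box fun _ : ι => R.fn, isMackey_box fun _ => R.mack.property⟩,
    Lan.pairing (piOplax G ι) (extPairing fun _ => R)⟩

namespace CommGreen

variable (R : CommGreen.{u} G)

def diag (T : FinGSet.{u} G) : T →[G] T.prod T :=
  FinGSet.prodLift (.id G) (.id G)

lemma res_apply_comp {S T W : FinGSet.{u} G} {f : S →[G] T} {g : T →[G] W} {h : S →[G] W}
    (e : ∀ x, g (f x) = h x) (a : R.fn.obj W) :
    R.fn.map (res f) (R.fn.map (res g) a) = R.fn.map (res h) a := by
  rw [← Functor.map_comp_apply, ← res_comp]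
  exact congrArg (fun k => R.fn.map (res k) a) (MulActionHom.ext e)

lemma tr_apply_comp {S T W : FinGSet.{u} G} {f : S →[G] T} {g : T →[G] W} {h : S →[G] W}
    (e : ∀ x, g (f x) = h x) (a : R.fn.obj S) :
    R.fn.map (tr g) (R.fn.map (tr f) a) = R.fn.map (tr h) a := by
  rw [← Functor.map_comp_apply, ← tr_comp]
  exact congrArg (fun k => R.fn.map (tr k) a) (MulActionHom.ext e)

lemma base_change_apply {W U V T : FinGSet.{u} G} {p : W →[G] U} {q : W →[G] V} {f : U →[G] T}
    {g : V →[G] T} (h : IsPB p q f g) (a : R.fn.obj U) :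
    R.fn.map (res g) (R.fn.map (tr f) a) = R.fn.map (tr q) (R.fn.map (res p) a) := by
  rw [← Functor.map_comp_apply, base_change p q f g h, Functor.map_comp_apply]

lemma mul_res {S S' T T' : FinGSet.{u} G} (f : S' →[G] S) (g : T' →[G] T) (x : R.fn.obj S)
    (y : R.fn.obj T) : R.pairing.mul (R.fn.map (res f) x) (R.fn.map (res g) y) =
      R.fn.map (res (FinGSet.prodMap f g)) (R.pairing.mul x y) :=
  (R.pairing.mul_nat (res f) (res g) x y).symm

lemma mul_tr {S S' T T' : FinGSet.{u} G} (f : S →[G] S') (g : T →[G] T') (x : R.fn.obj S)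
    (y : R.fn.obj T) : R.pairing.mul (R.fn.map (tr f) x) (R.fn.map (tr g) y) =
      R.fn.map (tr (FinGSet.prodMap f g)) (R.pairing.mul x y) :=
  (R.pairing.mul_nat (tr f) (tr g) x y).symm

/-- The internal multiplication of `R(T)`: restrict the external product along the diagonal. -/
def imul {T : FinGSet.{u} G} (x y : R.fn.obj T) : R.fn.obj T :=
  R.fn.map (res (diag T)) (R.pairing.mul x y)

/-- The unit element of `R(T)`. -/
def ione (T : FinGSet.{u} G) : R.fn.obj T := R.fn.map (res (FinGSet.toPt T)) R.pairing.one

lemma imul_comm {T : FinGSet.{u} G} (x y : R.fn.obj T) : R.imul x y = R.imul y x := by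
  have h : (Tens.comm T T : _ ⟶ _) = res (FinGSet.prodLift (FinGSet.snd T T) (FinGSet.fst T T)) :=
      tr_eq_res _ _ (fun _ => rfl) fun _ => rfl
  rw [imul, imul, ← R.pairing.mul_comm x y, h]
  exact (R.res_apply_comp (fun _ => rfl) _).symm

lemma ione_imul {T : FinGSet.{u} G} (x : R.fn.obj T) : R.imul (R.ione T) x = x := by
  have h : (Tens.lunit T : _ ⟶ _) = res (FinGSet.prodLift (FinGSet.toPt T) (.id G)) :=
      tr_eq_res _ _ (fun _ => rfl) fun _ => rfl
  have h1 := R.mul_res (FinGSet.toPt T) (.id G) R.pairing.one x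
  rw [res_id, Functor.map_id_apply] at h1
  conv_rhs => rw [← R.pairing.one_mul x, h]
  rw [imul, ione, h1]
  exact R.res_apply_comp (fun _ => rfl) _

lemma imul_assoc {T : FinGSet.{u} G} (x y z : R.fn.obj T) :
    R.imul (R.imul x y) z = R.imul x (R.imul y z) := by
  have h : (Tens.assoc T T T : _ ⟶ _) = res (⟨fun x => ((x.1, x.2.1), x.2.2), fun _ _ => rfl⟩ :
      T.prod (T.prod T) →[G] (T.prod T).prod T) := tr_eq_res _ _ (fun _ => rfl) fun _ => rfl
  have h1 := R.mul_res (diag T) (.id G) (R.pairing.mul x y) z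
  have h2 := R.mul_res (.id G) (diag T) x (R.pairing.mul y z)
  rw [res_id, Functor.map_id_apply] at h1 h2
  have e1 : R.imul (R.imul x y) z = R.fn.map (res (FinGSet.prodLift (diag T) (.id G)))
      (R.pairing.mul (R.pairing.mul x y) z) := by
    rw [imul, imul, h1]
    exact R.res_apply_comp (fun _ => rfl) _
  have e2 : R.imul x (R.imul y z) = R.fn.map (res (FinGSet.prodLift (.id G) (diag T)))
      (R.pairing.mul x (R.pairing.mul y z)) := by
    rw [imul, imul, h2]
    exact R.res_apply_comp (fun _ => rfl) _
  rw [e1, e2, ← R.pairing.mul_assoc, h]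
  exact (R.res_apply_comp (fun _ => rfl) _).symm

/-- The multiplicative monoid `R(T)`. -/
instance (T : FinGSet.{u} G) : CommMonoid (R.fn.obj T) where
  mul := R.imul
  one := R.ione T
  mul_assoc := R.imul_assoc
  one_mul := R.ione_imul
  mul_one x := (R.imul_comm x _).trans (R.ione_imul x)
  mul_comm := R.imul_comm

lemma mul_def {T : FinGSet.{u} G} (x y : R.fn.obj T) :
    x * y = R.fn.map (res (diag T)) (R.pairing.mul x y) := rfl

lemma one_def {T : FinGSet.{u} G} :
    (1 : R.fn.obj T) = R.fn.map (res (FinGSet.toPt T)) R.pairing.one := rfl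

/-- Restrictions are multiplicative. -/
def resHom {S T : FinGSet.{u} G} (f : S →[G] T) : R.fn.obj T →* R.fn.obj S where
  toFun := R.fn.map (res f)
  map_one' := R.res_apply_comp (fun _ => rfl) _
  map_mul' x y := by
    rw [mul_def, mul_def, mul_res, R.res_apply_comp (h := FinGSet.prodLift f f) (fun _ => rfl),
      R.res_apply_comp (h := FinGSet.prodLift f f) (fun _ => rfl)]

lemma frobenius {S T : FinGSet.{u} G} (f : S →[G] T) (x : R.fn.obj S) (y : R.fn.obj T) :
    R.fn.map (tr f) (x * R.resHom f y) = R.fn.map (tr f) x * y := by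
  have h1 := R.mul_res (.id G) f x y
  have h2 := R.mul_tr f (.id G) x y
  rw [res_id, Functor.map_id_apply] at h1
  rw [tr_id, Functor.map_id_apply] at h2
  have hp : IsPB (FinGSet.prodLift (.id G) f) f (FinGSet.prodMap f (.id G : T →[G] T))
      (diag T) := by
    refine ⟨fun _ => rfl, fun a b hab => ⟨a.1, ⟨Prod.ext rfl ?_, congrArg Prod.fst hab⟩,
      fun y hy => congrArg Prod.fst hy.1⟩⟩
    exact (congrArg Prod.fst hab).trans (congrArg Prod.snd hab).symm
  rw [mul_def, mul_def, h2, R.base_change_apply hp]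
  change R.fn.map (tr f) (R.fn.map _ (R.pairing.mul x (R.fn.map (res f) y))) = _
  rw [h1, R.res_apply_comp (h := FinGSet.prodLift (.id G) f) (fun _ => rfl)]

lemma mul_eq {S T : FinGSet.{u} G} (x : R.fn.obj S) (y : R.fn.obj T) :
    R.pairing.mul x y = (R.resHom (FinGSet.fst S T) x * R.resHom (FinGSet.snd S T) y :
      R.fn.obj (S.prod T)) := by
  rw [mul_def]
  change _ = R.fn.map _ (R.pairing.mul (R.fn.map _ x) (R.fn.map _ y))
  rw [mul_res, R.res_apply_comp (h := .id G) (fun _ => rfl), res_id]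
  exact (Functor.map_id_apply R.fn _ _).symm

end CommGreen

end Box

/-! ## The action of a commutative group and pure tensors -/

section Action

variable {G : Type} [CommGroup G]

/-- Multiplication by `g` as a map of `G`-sets, for `G` commutative. -/
def FinGSet.lmul (g : G) (T : FinGSet.{u} G) : T →[G] T :=
  ⟨fun x => g • x, fun h x => smul_comm g h x⟩

namespace CommGreen

variable (R : CommGreen.{u} G)

/-- The action of `g ∈ G` on `R`: the restriction along multiplication by `g`. On
`R(G/H)` this is the Weyl action. -/
def act (g : G) (T : FinGSet.{u} G) : R.fn.obj T →* R.fn.obj T := R.resHom (FinGSet.lmul g T)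

lemma act_res (g : G) {S T : FinGSet.{u} G} (f : S →[G] T) (x : R.fn.obj T) :
    R.act g S (R.resHom f x) = R.resHom f (R.act g T x) :=
  (R.res_apply_comp (f := FinGSet.lmul g S) (g := f) (h := f.comp (FinGSet.lmul g S))
    (fun _ => rfl) x).trans
    (R.res_apply_comp (f := f) (g := FinGSet.lmul g T) (h := f.comp (FinGSet.lmul g S))
      (fun y => (map_smul f g y).symm) x).symm

lemma act_tr (g : G) {S T : FinGSet.{u} G} (f : S →[G] T) (x : R.fn.obj S) :
    R.act g T (R.fn.map (tr f) x) = R.fn.map (tr f) (R.act g S x) := by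
  refine R.base_change_apply ⟨fun y => map_smul f g y, fun a b hab => ?_⟩ x
  refine ⟨g⁻¹ • a, ⟨smul_inv_smul g a, ?_⟩, fun y hy => ?_⟩
  · rw [map_smul, hab]
    exact inv_smul_smul g b
  · rw [← hy.1]
    exact (inv_smul_smul g y).symm

lemma act_one (T : FinGSet.{u} G) (x : R.fn.obj T) : R.act 1 T x = x := by
  have h : FinGSet.lmul (1 : G) T = .id G := MulActionHom.ext fun x => one_smul G x
  change R.fn.map (res _) x = x
  rw [h, res_id, Functor.map_id_apply]

lemma act_mul (g h : G) (T : FinGSet.{u} G) (x : R.fn.obj T) :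
    R.act (g * h) T x = R.act g T (R.act h T x) :=
  (R.res_apply_comp (fun y => (mul_smul h g y).symm.trans
    (congrArg (· • y) (mul_comm h g))) x).symm

variable {R}

lemma Hom.map_imul {R' : CommGreen.{u} G} (f : R.Hom R') {T : FinGSet.{u} G} (x y : R.fn.obj T) :
    f.nat.app T (x * y) = f.nat.app T x * f.nat.app T y := by
  rw [mul_def, mul_def, NatTrans.naturality_apply]
  exact congrArg (R'.fn.map (res (diag T))) (f.map_mul x y)

/-- A morphism of commutative Green functors is multiplicative. -/
def Hom.monoidHom {R' : CommGreen.{u} G} (f : R.Hom R') (T : FinGSet.{u} G) :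
    R.fn.obj T →* R'.fn.obj T where
  toFun := f.nat.app T
  map_one' := by
    rw [one_def, one_def, NatTrans.naturality_apply]
    exact congrArg (R'.fn.map (res (FinGSet.toPt T))) f.map_one
  map_mul' := f.map_imul

lemma Hom.map_act {R' : CommGreen.{u} G} (f : R.Hom R') (g : G) (T : FinGSet.{u} G)
    (x : R.fn.obj T) : f.monoidHom T (R.act g T x) = R'.act g T (f.monoidHom T x) :=
  NatTrans.naturality_apply f.nat _ x

variable (R)

section Pure

variable {ι κ μ : Type}

/-- The element of `R^{□ι}(T)` represented by `s : ∏ᵢ Sᵢ ⟶ T` and `(aᵢ)ᵢ ∈ ∏ᵢ R(Sᵢ)`. -/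
noncomputable def bmk [Finite ι] {S : ι → FinGSet.{u} G} {T : FinGSet.{u} G}
    (s : FinGSet.pi S ⟶ T) (a : ∀ i, R.fn.obj (S i)) : (box fun _ : ι => R.fn).obj T :=
  Lan.mk (F := piFunctor G ι) (M := extProd fun _ => R.fn) (c := S) s a

lemma bmk_pi [Finite ι] {S S' : ι → FinGSet.{u} G} {T : FinGSet.{u} G} (v : ∀ i, S i ⟶ S' i)
    (s : FinGSet.pi S' ⟶ T) (a : ∀ i, R.fn.obj (S i)) :
    R.bmk (burnsidePi v ≫ s) a = R.bmk s fun i => R.fn.map (v i) (a i) :=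
  Lan.mk_map (F := piFunctor G ι) (M := extProd fun _ : ι => R.fn) (c := S) (c' := S') v s a

lemma map_bmk [Finite ι] {S : ι → FinGSet.{u} G} {T T' : FinGSet.{u} G} (s : FinGSet.pi S ⟶ T)
    (t : T ⟶ T') (a : ∀ i, R.fn.obj (S i)) :
    (box fun _ : ι => R.fn).map t (R.bmk s a) = R.bmk (s ≫ t) a := rfl

lemma exists_bmk [Finite ι] {T : FinGSet.{u} G} (x : (box fun _ : ι => R.fn).obj T) :
    ∃ (S : ι → FinGSet.{u} G) (s : FinGSet.pi S ⟶ T) (a : ∀ i, R.fn.obj (S i)),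
      R.bmk s a = x := by
  obtain ⟨S, s, a, h⟩ := Lan.exists_mk x
  exact ⟨S, s, a, h.symm⟩

/-- The diagonal `U → U^ι`. -/
def piDiag (ι : Type) [Finite ι] (U : FinGSet.{u} G) :
    U →[G] FinGSet.pi fun _ : ι => U := FinGSet.piLift fun _ => .id G

/-- The pure tensor `⊗ᵢ bᵢ ∈ R^{□ι}(U)` for `bᵢ ∈ R(U)`. -/
noncomputable def pure [Finite ι] {U : FinGSet.{u} G} (b : ι → R.fn.obj U) :
    (box fun _ : ι => R.fn).obj U := R.bmk (res (piDiag ι U)) b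

lemma bmk_res [Finite ι] {S : ι → FinGSet.{u} G} {U T : FinGSet.{u} G} (f : ∀ i, U →[G] S i)
    (s : U ⟶ T) (b : ∀ i, R.fn.obj (S i)) :
    R.bmk (res (FinGSet.piLift f) ≫ s) b =
    (box fun _ : ι => R.fn).map s (R.pure fun i => R.resHom (f i) (b i)) := by
  rw [pure, map_bmk]
  refine Eq.trans ?_ (R.bmk_pi (fun i => res (f i)) (res (piDiag ι U) ≫ s) b)
  rw [burnsidePi_res, ← Category.assoc, ← res_comp]
  rfl

lemma pure_res [Finite ι] {U V : FinGSet.{u} G} (f : V →[G] U) (b : ι → R.fn.obj U) :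
    (box fun _ : ι => R.fn).map (res f) (R.pure b) = R.pure fun i => R.resHom f (b i) := by
  have h := R.bmk_res (fun _ : ι => f) (𝟙 V) b
  rw [Category.comp_id, Functor.map_id_apply] at h
  rw [← h, pure, map_bmk, ← res_comp]
  rfl

lemma bmk_eq [Finite ι] {S : ι → FinGSet.{u} G} {T : FinGSet.{u} G} (s : FinGSet.pi S ⟶ T)
    (b : ∀ i, R.fn.obj (S i)) :
    R.bmk s b = (box fun _ : ι => R.fn).map s
      (R.pure fun i => R.resHom (FinGSet.proj S i) (b i)) := by
  rw [← R.bmk_res (fun i : ι => FinGSet.proj S i) s b]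
  congr 1
  exact (Category.id_comp s).symm

lemma exists_pure [Finite ι] {T : FinGSet.{u} G} (x : (box fun _ : ι => R.fn).obj T) :
    ∃ (U : FinGSet.{u} G) (s : U ⟶ T) (b : ι → R.fn.obj U),
      x = (box fun _ : ι => R.fn).map s (R.pure b) := by
  obtain ⟨S, s, a, rfl⟩ := R.exists_bmk x
  exact ⟨_, s, _, R.bmk_eq s a⟩

lemma pure_tr_aux [Finite ι] {W Y : FinGSet.{u} G} (p : W →[G] Y) (Q : ι → FinGSet.{u} G)
    (e : ∀ i, W →[G] Q i) (q : ∀ i, Q i →[G] Y) (z : ∀ i, R.fn.obj (Q i)) (i₀ : ι)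
    (hqe : ∀ i x, q i (e i x) = p x) (he : Function.Bijective (e i₀))
    (hq : ∀ i, i ≠ i₀ → Function.Injective (q i)) :
    (box fun _ : ι => R.fn).map (tr p) (R.pure fun i => R.resHom (e i) (z i)) =
      R.pure fun i => R.fn.map (tr (q i)) (z i) := by
  have hpb : IsPB (FinGSet.piLift e) p (FinGSet.piMap q) (piDiag ι Y) := by
    refine ⟨fun x => funext fun i => hqe i x, fun a b hab => ?_⟩
    have hab' : ∀ i, q i (a i) = b := fun i => congrFun hab i
    obtain ⟨x, hx⟩ := he.2 (a i₀)
    have hpx : p x = b := by rw [← hqe i₀, hx, hab']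
    refine ⟨x, ⟨funext fun i => ?_, hpx⟩, fun y hy => he.1 ((congrFun hy.1 i₀).trans hx.symm)⟩
    by_cases hi : i = i₀
    · subst hi
      exact hx
    · exact hq i hi ((hqe i x).trans (hpx.trans (hab' i).symm))
  rw [← R.bmk_res e (tr p) z, ← base_change _ _ _ _ hpb, ← burnsidePi_tr, bmk_pi]
  rfl

/-- Frobenius reciprocity for pure tensors. -/
lemma pure_tr [Finite ι] {W Y : FinGSet.{u} G} (p : W →[G] Y) (b : ι → R.fn.obj W)
    (c : ι → R.fn.obj Y) (i₀ : ι) (h0 : R.fn.map (tr p) (b i₀) = c i₀)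
    (h : ∀ i, i ≠ i₀ → R.resHom p (c i) = b i) :
    (box fun _ : ι => R.fn).map (tr p) (R.pure b) = R.pure c := by
  have key : ∀ i, ∃ (Q : FinGSet.{u} G) (e : W →[G] Q) (q : Q →[G] Y) (z : R.fn.obj Q),
      (∀ x, q (e x) = p x) ∧ (i = i₀ → Function.Bijective e) ∧ (i ≠ i₀ → Function.Injective q) ∧
      R.resHom e z = b i ∧ R.fn.map (tr q) z = c i := by
    intro i
    by_cases hi : i = i₀
    · refine ⟨W, .id G, p, b i, fun _ => rfl, fun _ => Function.bijective_id,
        fun h => (h hi).elim, ?_, ?_⟩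
      · exact Functor.map_id_apply R.fn W (b i)
      · subst hi
        exact h0
    · refine ⟨Y, p, .id G, c i, fun _ => rfl, fun h => (hi h).elim,
        fun _ => Function.injective_id, h i hi, ?_⟩
      exact Functor.map_id_apply R.fn Y (c i)
  choose Q e q z h1 h2 h3 h4 h5 using key
  have := R.pure_tr_aux p Q e q z i₀ h1 (h2 i₀ rfl) h3
  simpa only [h4, h5] using this

/-- The product over the fibres of `φ` of the elements `γᵢ aᵢ`. -/
noncomputable def comb [Fintype ι] [DecidableEq κ] (φ : ι → κ) (γ : ι → G) {U : FinGSet.{u} G}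
    (a : ι → R.fn.obj U) (k : κ) : R.fn.obj U :=
  ∏ i with φ i = k, R.act (γ i) U (a i)

lemma comb_res [Fintype ι] [DecidableEq κ] (φ : ι → κ) (γ : ι → G) {U V : FinGSet.{u} G}
    (f : V →[G] U) (a : ι → R.fn.obj U) (k : κ) :
    R.resHom f (R.comb φ γ a k) = R.comb φ γ (fun i => R.resHom f (a i)) k := by
  rw [comb, map_prod, comb]
  simp only [act_res]

lemma tr_comb_aux [DecidableEq ι] [Finite κ] [DecidableEq κ] (φ : ι → κ) (γ : ι → G)
    {S S' : ι → FinGSet.{u} G} (h : ∀ i, S i →[G] S' i) (a : ∀ i, R.fn.obj (S i))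
    (t : Finset ι) : ∀ {W Y : FinGSet.{u} G} (p : W →[G] Y) (w : ∀ i, W →[G] S i)
    (y : ∀ i, Y →[G] S' i), (∀ i x, h i (w i x) = y i (p x)) →
    (∀ (b : Y) (x : ∀ i ∈ t, S i), (∀ i hi, h i (x i hi) = y i b) →
      ∃! v, p v = b ∧ ∀ i hi, w i v = x i hi) →
    ∀ c : κ → R.fn.obj Y, (box fun _ : κ => R.fn).map (tr p) (R.pure fun k =>
      (∏ i ∈ t with φ i = k, R.act (γ i) W (R.resHom (w i) (a i))) * R.resHom p (c k)) =
      R.pure fun k => (∏ i ∈ t with φ i = k, R.act (γ i) Y (R.resHom (y i)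
        (R.fn.map (tr (h i)) (a i)))) * c k := by
  induction t using Finset.induction_on with
  | empty =>
    intro W Y p w y hwy hpb c
    have hp : Function.Bijective p := by
      refine ⟨fun v v' hv => ?_, fun b => ?_⟩
      · exact (hpb (p v') (fun _ hi => absurd hi (Finset.notMem_empty _))
          (fun _ hi => absurd hi (Finset.notMem_empty _))).unique
          ⟨hv, fun _ hi => absurd hi (Finset.notMem_empty _)⟩
          ⟨rfl, fun _ hi => absurd hi (Finset.notMem_empty _)⟩
      · obtain ⟨v, hv, _⟩ := hpb b (fun _ hi => absurd hi (Finset.notMem_empty _))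
          (fun _ hi => absurd hi (Finset.notMem_empty _))
        exact ⟨v, hv.1⟩
    simp only [Finset.filter_empty, Finset.prod_empty, one_mul]
    rw [← pure_res, ← Functor.map_comp_apply, (tr_res_of_bij p hp).2, Functor.map_id_apply]
  | insert i₀ t hi₀ ih =>
    intro W Y p w y hwy hpb c
    let p1 := FinGSet.pbFst (y i₀) (h i₀)
    let x1 := FinGSet.pbSnd (y i₀) (h i₀)
    let e : W →[G] FinGSet.pb (y i₀) (h i₀) :=
      ⟨fun v => ⟨(p v, w i₀ v), (hwy i₀ v).symm⟩, fun m v =>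
        Subtype.ext (Prod.ext (map_smul p m v) (map_smul (w i₀) m v))⟩
    let D : κ → R.fn.obj Y := fun k => ∏ i ∈ t with φ i = k, R.act (γ i) Y (R.resHom (y i)
        (R.fn.map (tr (h i)) (a i)))
    let c' : κ → R.fn.obj (FinGSet.pb (y i₀) (h i₀)) := fun k =>
      (if φ i₀ = k then R.act (γ i₀) _ (R.resHom x1 (a i₀)) else 1) * R.resHom p1 (c k)
    have hpb' : ∀ (b : FinGSet.pb (y i₀) (h i₀)) (x : ∀ i ∈ t, S i),
        (∀ i hi, h i (x i hi) = ((y i).comp p1) b) → ∃! v, e v = b ∧ ∀ i hi, w i v = x i hi := by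
      rintro ⟨⟨b, x0⟩, hb⟩ x hx
      obtain ⟨x', hx'0, hx't⟩ : ∃ x' : ∀ i ∈ insert i₀ t, S i, (∀ hi, x' i₀ hi = x0) ∧
          ∀ i hi (hit : i ∈ t), x' i hi = x i hit := by
        refine ⟨fun i hi => if hit : i ∈ t then x i hit else
          (Finset.eq_of_mem_insert_of_notMem hi hit) ▸ x0, fun hi => ?_, fun i hi hit => ?_⟩
        · simp only [hi₀, ↓reduceDIte]
        · simp only [hit, ↓reduceDIte]
      have hx' : ∀ i hi, h i (x' i hi) = y i b := by
        intro i hi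
        by_cases hit : i ∈ t
        · rw [hx't i hi hit]
          exact hx i hit
        · obtain rfl := Finset.eq_of_mem_insert_of_notMem hi hit
          rw [hx'0 hi]
          exact hb.symm
      obtain ⟨v, ⟨hv1, hv2⟩, hv⟩ := hpb b x' hx'
      refine ⟨v, ⟨Subtype.ext (Prod.ext hv1 ((hv2 i₀ (Finset.mem_insert_self _ _)).trans
        (hx'0 _))), fun i hi => (hv2 i (Finset.mem_insert_of_mem hi)).trans (hx't _ _ hi)⟩,
        fun v' hv' => hv v' ⟨congrArg (fun z => z.1.1) hv'.1, fun i hi => ?_⟩⟩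
      by_cases hit : i ∈ t
      · rw [hx't i hi hit]
        exact hv'.2 i hit
      · obtain rfl := Finset.eq_of_mem_insert_of_notMem hi hit
        rw [hx'0 hi]
        exact congrArg (fun z => z.1.2) hv'.1
    have h1 := ih e w (fun i => (y i).comp p1) (fun i x => hwy i x) hpb' c'
    have h2 : ∀ k, (∏ i ∈ t with φ i = k, R.act (γ i) W (R.resHom (w i) (a i))) *
        R.resHom e (c' k) = (∏ i ∈ insert i₀ t with φ i = k,
          R.act (γ i) W (R.resHom (w i) (a i))) * R.resHom p (c k) := by
      intro k
      have e1 : R.resHom e (R.resHom p1 (c k)) = R.resHom p (c k) :=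
        R.res_apply_comp (fun _ => rfl) _
      have e2 : R.resHom e (R.resHom x1 (a i₀)) = R.resHom (w i₀) (a i₀) :=
        R.res_apply_comp (fun _ => rfl) _
      rw [Finset.filter_insert]
      by_cases hk : φ i₀ = k
      · simp only [c', hk, if_true]
        rw [Finset.prod_insert (by simp [hi₀]), map_mul, ← act_res, e1, e2, mul_left_comm, mul_assoc]
      · simp only [c', hk, if_false]
        rw [one_mul, e1]
    have h3 : (fun k => (∏ i ∈ t with φ i = k, R.act (γ i) _ (R.resHom ((y i).comp p1)
        (R.fn.map (tr (h i)) (a i)))) * c' k) = fun k => R.resHom p1 (D k) * c' k := by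
      funext k
      have e1 : ∀ (i : ι) z, R.resHom p1 (R.resHom (y i) z) = R.resHom ((y i).comp p1) z :=
        fun i z => R.res_apply_comp (fun _ => rfl) _
      simp only [D, map_prod, ← act_res, e1]
    simp only [h2] at h1
    rw [h3] at h1
    have h4 := congrArg ((box fun _ : κ => R.fn).map (tr p1)) h1
    rw [← Functor.map_comp_apply, ← tr_comp] at h4
    refine Eq.trans h4 ?_
    refine R.pure_tr p1 _ _ (φ i₀) ?_ fun k hk => ?_
    · have e3 : R.fn.map (tr p1) (R.act (γ i₀) _ (R.resHom x1 (a i₀))) =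
          R.act (γ i₀) Y (R.resHom (y i₀) (R.fn.map (tr (h i₀)) (a i₀))) := by
        rw [← act_tr]
        exact congrArg _ (R.base_change_apply (isPB_pb (y i₀) (h i₀)).swap (a i₀)).symm
      simp only [c', if_true]
      rw [mul_left_comm, ← map_mul, frobenius, e3, Finset.filter_insert, if_pos rfl,
        Finset.prod_insert (by simp [hi₀]), mul_assoc]
    · have hk' : φ i₀ ≠ k := fun h => hk h.symm
      simp only [c', if_neg hk', one_mul]
      rw [Finset.filter_insert, if_neg hk', map_mul]

end Pure

end CommGreen

end Action

/-! ## Maps between box powers -/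

section BoxMaps

variable {G : Type} [CommGroup G]

namespace CommGreen

variable (R : CommGreen.{u} G) {ι κ μ : Type}

lemma comb_one [Fintype ι] [DecidableEq κ] (φ : ι → κ) (γ : ι → G) {U : FinGSet.{u} G} :
    (R.comb φ γ fun _ => (1 : R.fn.obj U)) = fun _ => 1 := by
  funext k
  rw [comb]
  exact Finset.prod_eq_one fun i _ => map_one _

lemma comb_mul [Fintype ι] [DecidableEq κ] (φ : ι → κ) (γ : ι → G) {U : FinGSet.{u} G}
    (a b : ι → R.fn.obj U) (k : κ) :
    R.comb φ γ (fun i => a i * b i) k = R.comb φ γ a k * R.comb φ γ b k := by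
  simp only [comb, map_mul]
  exact Finset.prod_mul_distrib

lemma comb_id [Fintype ι] [DecidableEq ι] {U : FinGSet.{u} G} (a : ι → R.fn.obj U) :
    R.comb id (fun _ => 1) a = a := by
  funext k
  rw [comb]
  simp only [id, Finset.filter_eq', Finset.mem_univ, if_true, Finset.prod_singleton]
  exact R.act_one U (a k)

lemma comb_comb [Fintype ι] [Fintype κ] [DecidableEq κ] [DecidableEq μ] (φ : ι → κ) (γ : ι → G)
    (ψ : κ → μ) (ξ : κ → G) {U : FinGSet.{u} G} (a : ι → R.fn.obj U) :
    R.comb ψ ξ (R.comb φ γ a) = R.comb (ψ ∘ φ) (fun i => ξ (φ i) * γ i) a := by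
  funext m
  simp only [comb, map_prod, Function.comp]
  rw [← Finset.prod_fiberwise_of_maps_to (g := φ) (t := Finset.univ.filter fun k => ψ k = m)
    (s := Finset.univ.filter fun i => ψ (φ i) = m) (by simp)]
  refine Finset.prod_congr rfl fun k hk => ?_
  have hk' : ψ k = m := by simpa using hk
  refine Finset.prod_congr ?_ fun i hi => ?_
  · ext i
    simp only [Finset.mem_filter, Finset.mem_univ, true_and]
    exact ⟨fun h => ⟨by rw [h, hk'], h⟩, fun h => h.2⟩
  · have hi' : φ i = k := by simpa using (Finset.mem_filter.1 hi).2
    rw [act_mul, hi']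

/-- The transformation underlying `boxMap`. -/
noncomputable def thetaAux [Finite ι] [Fintype ι] [DecidableEq κ] [Finite κ] (φ : ι → κ)
    (γ : ι → G) : extProd (fun _ : ι => R.fn) ⟶ piFunctor G ι ⋙ box (fun _ : κ => R.fn) where
  app S := ↾fun a => R.pure (R.comb φ γ fun i => R.resHom (FinGSet.proj S i) (a i))
  naturality {S S'} f := by
    classical
    ext a
    obtain ⟨U, hU⟩ : ∃ U : ∀ i, GSpan (S i) (S' i), f = fun i => (U i).mk' :=
      ⟨fun i => (exists_span (f i)).choose, funext fun i => (exists_span (f i)).choose_spec⟩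
    subst hU
    change R.pure (R.comb φ γ fun i => R.resHom (FinGSet.proj S' i) (R.fn.map (U i).mk' (a i))) =
      (box fun _ : κ => R.fn).map (burnsidePi fun i => (U i).mk')
        (R.pure (R.comb φ γ fun i => R.resHom (FinGSet.proj S i) (a i)))
    rw [burnsidePi_mk', mk'_eq, Functor.map_comp_apply]
    change _ = (box fun _ : κ => R.fn).map (tr (FinGSet.piMap fun i => (U i).r))
      ((box fun _ : κ => R.fn).map (res (FinGSet.piMap fun i => (U i).l)) (R.pure _))
    rw [pure_res]
    have h := R.tr_comb_aux φ γ (fun i => (U i).r) (fun i => R.resHom (U i).l (a i)) Finset.univ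
      (FinGSet.piMap fun i => (U i).r) (FinGSet.proj _) (FinGSet.proj S') (fun _ _ => rfl)
      (fun b x hx => ⟨fun i => x i (Finset.mem_univ i), ⟨funext fun i => hx i _, fun _ _ => rfl⟩,
        fun v hv => funext fun i => hv.2 i (Finset.mem_univ i)⟩) (fun _ : κ => 1)
    simp only [map_one, mul_one] at h
    refine Eq.trans ?_ (h.symm.trans ?_)
    · refine congrArg R.pure (funext fun k => Finset.prod_congr rfl fun i _ => ?_)
      refine congrArg (fun z => R.act (γ i) _ (R.resHom (FinGSet.proj S' i) z)) ?_
      rw [mk'_eq, Functor.map_comp_apply]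
      rfl
    · refine congrArg _ (congrArg R.pure (funext fun k => ?_))
      rw [comb_res]
      refine Finset.prod_congr rfl fun i _ => congrArg _ ?_
      exact (R.res_apply_comp (h := (U i).l.comp (FinGSet.proj _ i)) (fun _ => rfl) (a i)).trans
        (R.res_apply_comp (f := FinGSet.piMap fun i => (U i).l) (g := FinGSet.proj S i)
          (fun _ => rfl) (a i)).symm

noncomputable def thetaNat [Fintype ι] [DecidableEq κ] [Finite κ] (φ : ι → κ)
    (γ : ι → G) : box (fun _ : ι => R.fn) ⟶ box (fun _ : κ => R.fn) :=
  Lan.desc (R.thetaAux φ γ)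

lemma thetaNat_pure [Fintype ι] [DecidableEq κ] [Finite κ] (φ : ι → κ) (γ : ι → G)
    {U : FinGSet.{u} G} (b : ι → R.fn.obj U) :
    (R.thetaNat φ γ).app U (R.pure b) = R.pure (R.comb φ γ b) := by
  have h : (R.thetaNat φ γ).app U (R.pure b) = (box fun _ : κ => R.fn).map (res (piDiag ι U))
      (R.pure (R.comb φ γ fun i => R.resHom (FinGSet.proj (fun _ => U) i) (b i))) :=
    Lan.desc_mk _ _ _
  rw [h, pure_res]
  refine congrArg R.pure (funext fun k => ?_)
  rw [comb_res]
  refine Finset.prod_congr rfl fun i _ => congrArg _ ?_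
  refine (R.res_apply_comp (h := .id G) (fun _ => rfl) (b i)).trans ?_
  rw [res_id]
  exact Functor.map_id_apply R.fn U (b i)

lemma box_hom_ext [Finite ι] {N : FinGSet.{u} G ⥤ Type (u + 1)}
    {f f' : box (fun _ : ι => R.fn) ⟶ N}
    (h : ∀ (U : FinGSet.{u} G) (b : ι → R.fn.obj U), f.app U (R.pure b) = f'.app U (R.pure b)) :
    f = f' := by
  ext T x
  obtain ⟨U, s, b, rfl⟩ := R.exists_pure x
  change f.app T _ = f'.app T _
  rw [NatTrans.naturality_apply, NatTrans.naturality_apply, h]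

lemma boxPow_mul [Finite ι] [Nonempty ι] {U V : FinGSet.{u} G} (b : ι → R.fn.obj U)
    (c : ι → R.fn.obj V) :
    (boxPow R ι).pairing.mul (R.pure b : (boxPow R ι).fn.obj U) (R.pure c) =
      (R.pure fun i => R.pairing.mul (b i) (c i) :
        (box fun _ : ι => R.fn).obj (U.prod V)) := by
  refine congrArg (fun s => R.bmk (S := fun _ : ι => U.prod V) s
    fun i => R.pairing.mul (b i) (c i)) ?_
  have h : ((piOplax G ι).δ (fun _ => U) (fun _ => V)) = res (⟨fun x i => (x.1 i, x.2 i),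
      fun _ _ => rfl⟩ : (FinGSet.pi fun _ : ι => U).prod (FinGSet.pi fun _ : ι => V) →[G]
        FinGSet.pi fun _ : ι => U.prod V) := tr_eq_res _ _ (fun _ => rfl) fun _ => rfl
  rw [h]
  exact (res_comp (FinGSet.prodMap (piDiag ι U) (piDiag ι V)) _).symm

lemma boxPow_mul_map [Finite ι] [Nonempty ι] {U V S T : FinGSet.{u} G} (s : U ⟶ S) (t : V ⟶ T)
    (b : ι → R.fn.obj U) (c : ι → R.fn.obj V) :
    (boxPow R ι).pairing.mul ((box fun _ : ι => R.fn).map s (R.pure b))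
      ((box fun _ : ι => R.fn).map t (R.pure c)) = (box fun _ : ι => R.fn).map
        (burnsideProd s t) (R.pure fun i => R.pairing.mul (b i) (c i)) := by
  rw [← boxPow_mul]
  exact ((boxPow R ι).pairing.mul_nat s t _ _).symm

lemma one_eq : R.pairing.one = (1 : R.fn.obj (FinGSet.pt G)) := by
  rw [one_def]
  have h : (FinGSet.toPt (FinGSet.pt.{u} G)) = .id G := rfl
  rw [h, res_id]
  exact (Functor.map_id_apply R.fn _ _).symm

lemma boxPow_one [Finite ι] [Nonempty ι] :
    (boxPow R ι).pairing.one = (R.pure fun _ => R.pairing.one :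
      (box fun _ : ι => R.fn).obj (FinGSet.pt G)) := by
  refine congrArg (fun s => R.bmk (S := fun _ : ι => FinGSet.pt G) s fun i => R.pairing.one) ?_
  exact tr_eq_res _ _ (fun _ => rfl) fun _ => rfl

/-- The map `R^{□ι} ⟶ R^{□κ}` that sends `⊗ᵢ bᵢ` to the tensor product over `k` of the products
of the `γᵢ bᵢ` with `φ i = k`. -/
noncomputable def boxMap [Fintype ι] [Nonempty ι] [DecidableEq κ] [Finite κ] [Nonempty κ]
    (φ : ι → κ) (γ : ι → G) : boxPow R ι ⟶ boxPow R κ :=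
  { nat := R.thetaNat φ γ
    map_mul := by
      intro S T X Y
      obtain ⟨U, s, b, rfl⟩ := R.exists_pure X
      obtain ⟨V, t, c, rfl⟩ := R.exists_pure Y
      have e3 : (fun i => R.pairing.mul (b i) (c i)) = fun i =>
          (R.resHom (FinGSet.fst U V) (b i) * R.resHom (FinGSet.snd U V) (c i) :
            R.fn.obj (U.prod V)) := funext fun i => R.mul_eq _ _
      refine (congrArg ((R.thetaNat φ γ).app _) (R.boxPow_mul_map s t b c)).trans ?_
      rw [NatTrans.naturality_apply]
      refine Eq.trans ?_ (congrArg₂ (boxPow R κ).pairing.mul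
        ((NatTrans.naturality_apply (R.thetaNat φ γ) s (R.pure b)).trans
          (congrArg _ (R.thetaNat_pure φ γ b))).symm
        ((NatTrans.naturality_apply (R.thetaNat φ γ) t (R.pure c)).trans
          (congrArg _ (R.thetaNat_pure φ γ c))).symm)
      refine Eq.trans ?_ (R.boxPow_mul_map s t _ _).symm
      rw [thetaNat_pure, e3]
      refine congrArg _ (congrArg R.pure (funext fun k => ?_))
      rw [comb_mul, mul_eq, comb_res, comb_res]
    map_one := by
      refine (congrArg ((R.thetaNat φ γ).app _) R.boxPow_one).trans ?_
      rw [thetaNat_pure, boxPow_one, one_eq]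
      exact congrArg R.pure (R.comb_one φ γ) }

lemma boxMap_id [Fintype ι] [Nonempty ι] [DecidableEq ι] :
    R.boxMap (id : ι → ι) (fun _ => 1) = 𝟙 _ := by
  refine hom_ext' (R.box_hom_ext fun U b => ?_)
  exact (R.thetaNat_pure _ _ b).trans (congrArg R.pure (R.comb_id b))

lemma boxMap_comp [Fintype ι] [Nonempty ι] [Fintype κ] [Nonempty κ] [DecidableEq κ] [Finite μ]
    [Nonempty μ] [DecidableEq μ] (φ : ι → κ) (γ : ι → G) (ψ : κ → μ) (ξ : κ → G) :
    R.boxMap φ γ ≫ R.boxMap ψ ξ = R.boxMap (ψ ∘ φ) fun i => ξ (φ i) * γ i := by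
  refine hom_ext' (R.box_hom_ext fun U b => ?_)
  refine (congrArg ((R.thetaNat ψ ξ).app U) (R.thetaNat_pure φ γ b)).trans ?_
  rw [thetaNat_pure, comb_comb]
  exact (R.thetaNat_pure _ _ b).symm

variable {R}

/-- The underlying natural transformation of `f^{□ι}`. -/
noncomputable def powNat (ι : Type) [Finite ι] {R' : CommGreen.{u} G} (f : R ⟶ R') :
    box (fun _ : ι => R.fn) ⟶ box (fun _ : ι => R'.fn) :=
  Lan.mapNat
    { app := fun S => ↾fun a i => (Hom.nat f).app (S i) (a i)
      naturality := fun S S' v => by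
        ext a
        exact funext fun i => NatTrans.naturality_apply (Hom.nat f) (v i) (a i) }

lemma powNat_pure [Finite ι] {R' : CommGreen.{u} G} (f : R ⟶ R') {U : FinGSet.{u} G}
    (b : ι → R.fn.obj U) :
    (powNat ι f).app U (R.pure b) = R'.pure fun i => Hom.monoidHom f U (b i) :=
  Lan.mapNat_mk _ _ _

/-- The morphism `f^{□ι}`. -/
noncomputable def powMap (ι : Type) [Finite ι] [Nonempty ι] {R' : CommGreen.{u} G} (f : R ⟶ R') :
    boxPow R ι ⟶ boxPow R' ι :=
  { nat := powNat ι f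
    map_mul := by
      intro S T X Y
      obtain ⟨U, s, b, rfl⟩ := R.exists_pure X
      obtain ⟨V, t, c, rfl⟩ := R.exists_pure Y
      refine (congrArg ((powNat ι f).app _) (R.boxPow_mul_map s t b c)).trans ?_
      rw [NatTrans.naturality_apply]
      refine Eq.trans ?_ (congrArg₂ (boxPow R' ι).pairing.mul
        ((NatTrans.naturality_apply (powNat ι f) s (R.pure b)).trans
          (congrArg _ (powNat_pure f b))).symm
        ((NatTrans.naturality_apply (powNat ι f) t (R.pure c)).trans
          (congrArg _ (powNat_pure f c))).symm)
      refine Eq.trans ?_ (R'.boxPow_mul_map s t _ _).symm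
      rw [powNat_pure]
      exact congrArg _ (congrArg R'.pure (funext fun i => Hom.map_mul f _ _))
    map_one := by
      refine (congrArg ((powNat ι f).app _) R.boxPow_one).trans ?_
      rw [powNat_pure, boxPow_one]
      exact congrArg R'.pure (funext fun i => Hom.map_one f) }

lemma powMap_id (ι : Type) [Finite ι] [Nonempty ι] : powMap ι (𝟙 R) = 𝟙 _ := by
  refine hom_ext' (R.box_hom_ext fun U b => ?_)
  exact powNat_pure _ b

lemma powMap_comp (ι : Type) [Finite ι] [Nonempty ι] {R' R'' : CommGreen.{u} G} (f : R ⟶ R')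
    (f' : R' ⟶ R'') : powMap ι (f ≫ f') = powMap ι f ≫ powMap ι f' := by
  refine hom_ext' (R.box_hom_ext fun U b => ?_)
  refine (powNat_pure _ b).trans ?_
  refine Eq.symm ((congrArg ((powNat ι f').app U) (powNat_pure f b)).trans ?_)
  exact powNat_pure f' _

lemma powMap_boxMap [Fintype ι] [Nonempty ι] [DecidableEq κ] [Finite κ] [Nonempty κ]
    {R' : CommGreen.{u} G} (f : R ⟶ R') (φ : ι → κ) (γ : ι → G) :
    R.boxMap φ γ ≫ powMap κ f = powMap ι f ≫ R'.boxMap φ γ := by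
  refine hom_ext' (R.box_hom_ext fun U b => ?_)
  refine (congrArg ((powNat κ f).app U) (R.thetaNat_pure φ γ b)).trans ?_
  refine Eq.symm ((congrArg ((R'.thetaNat φ γ).app U) (powNat_pure f b)).trans ?_)
  rw [thetaNat_pure, powNat_pure]
  refine congrArg R'.pure (funext fun k => ?_)
  rw [comb, comb, map_prod]
  exact Finset.prod_congr rfl fun i _ => (Hom.map_act f (γ i) U (b i)).symm

end CommGreen

end BoxMaps

/-! ## The twisted cyclic nerve -/

section Nerve

/-- For a monotone map `α : [m] → [n]` and `j ∈ [n]`, the least `i ∈ [m]` with `j ≤ α i`, if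
there is one, and `0` otherwise. -/
def cycIdx {m n : ℕ} (α : Fin (m + 1) →o Fin (n + 1)) (j : Fin (n + 1)) : Fin (m + 1) :=
  if h : ∃ i, j ≤ α i then
    (Finset.univ.filter fun i => j ≤ α i).min' (h.imp fun _ hi => by simpa using hi)
  else 0

/-- The element by which the factor `j` is acted on: `g` if it is moved around the end, and `1`
otherwise. -/
def cycLabel {M : Type} [One M] (g : M) {m n : ℕ} (α : Fin (m + 1) →o Fin (n + 1))
    (j : Fin (n + 1)) : M :=
  if ∃ i, j ≤ α i then 1 else g

lemma cycIdx_le {m n : ℕ} {α : Fin (m + 1) →o Fin (n + 1)} {j : Fin (n + 1)} (h : ∃ i, j ≤ α i)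
    (i : Fin (m + 1)) : cycIdx α j ≤ i ↔ j ≤ α i := by
  rw [cycIdx, dif_pos h]
  constructor
  · intro hi
    have := Finset.min'_mem (Finset.univ.filter fun i => j ≤ α i)
      (h.imp fun _ hi => by simpa using hi)
    exact (Finset.mem_filter.1 this).2.trans (α.monotone hi)
  · intro hi
    exact Finset.min'_le _ _ (by simpa using hi)

lemma cycIdx_neg {m n : ℕ} {α : Fin (m + 1) →o Fin (n + 1)} {j : Fin (n + 1)}
    (h : ¬ ∃ i, j ≤ α i) : cycIdx α j = 0 := dif_neg h

lemma cycIdx_id {n : ℕ} (j : Fin (n + 1)) : cycIdx (OrderHom.id : Fin (n + 1) →o _) j = j :=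
  eq_of_forall_ge_iff fun i => cycIdx_le ⟨j, le_rfl⟩ i

lemma cycIdx_comp {l m n : ℕ} (α : Fin (l + 1) →o Fin (m + 1)) (β : Fin (m + 1) →o Fin (n + 1))
    (j : Fin (n + 1)) : cycIdx (β.comp α) j = cycIdx α (cycIdx β j) := by
  by_cases hβ : ∃ i, j ≤ β i
  · by_cases h : ∃ i, j ≤ (β.comp α) i
    · refine eq_of_forall_ge_iff fun i => ?_
      have h' : ∃ i, cycIdx β j ≤ α i := h.imp fun i hi => (cycIdx_le hβ _).2 hi
      rw [cycIdx_le h, cycIdx_le h', cycIdx_le hβ]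
      rfl
    · rw [cycIdx_neg h, cycIdx_neg]
      exact fun ⟨i, hi⟩ => h ⟨i, (cycIdx_le hβ _).1 hi⟩
  · have h : ¬ ∃ i, j ≤ (β.comp α) i := fun ⟨i, hi⟩ => hβ ⟨α i, hi⟩
    rw [cycIdx_neg h, cycIdx_neg hβ]
    exact (le_antisymm ((cycIdx_le ⟨0, Fin.zero_le _⟩ _).2 (Fin.zero_le _)) (Fin.zero_le _)).symm

lemma cycLabel_comp {M : Type} [MulOneClass M] (g : M) {l m n : ℕ} (α : Fin (l + 1) →o Fin (m + 1))
    (β : Fin (m + 1) →o Fin (n + 1)) (j : Fin (n + 1)) :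
    cycLabel g (β.comp α) j = cycLabel g α (cycIdx β j) * cycLabel g β j := by
  by_cases hβ : ∃ i, j ≤ β i
  · have h : (∃ i, j ≤ (β.comp α) i) ↔ ∃ i, cycIdx β j ≤ α i :=
      exists_congr fun i => (cycIdx_le hβ _).symm
    rw [cycLabel, cycLabel, cycLabel, if_pos hβ, mul_one]
    simp only [h]
  · have h : ¬ ∃ i, j ≤ (β.comp α) i := fun ⟨i, hi⟩ => hβ ⟨α i, hi⟩
    rw [cycLabel, cycLabel, cycLabel, if_neg hβ, if_neg h, cycIdx_neg hβ,
      if_pos ⟨0, Fin.zero_le _⟩, one_mul]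

lemma cycLabel_id {M : Type} [One M] (g : M) {n : ℕ} (j : Fin (n + 1)) :
    cycLabel g (OrderHom.id : Fin (n + 1) →o _) j = 1 := if_pos ⟨j, le_rfl⟩

/-- The index map of the face `dᵢ` with `i < n + 1`. -/
lemma cycIdx_δ {n : ℕ} (i : Fin (n + 1)) (j : Fin (n + 2)) :
    cycIdx (SimplexCategory.δ i.castSucc).toOrderHom j = i.predAbove j ∧
      ∀ {M : Type} [One M] (g : M), cycLabel g (SimplexCategory.δ i.castSucc).toOrderHom j = 1 := by
  have h : ∀ x : Fin (n + 1), i.predAbove j ≤ x ↔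
      j ≤ (SimplexCategory.δ i.castSucc).toOrderHom x := fun x => by
    change _ ↔ j ≤ Fin.succAbove i.castSucc x
    simp only [Fin.predAbove, Fin.succAbove, Fin.lt_def, Fin.le_def, Fin.val_castSucc]
    split_ifs <;> simp <;> omega
  have hj : ∃ x, j ≤ (SimplexCategory.δ i.castSucc).toOrderHom x :=
    ⟨Fin.last n, (h _).1 (Fin.le_last _)⟩
  exact ⟨eq_of_forall_ge_iff fun x => (cycIdx_le hj x).trans (h x).symm, fun g => if_pos hj⟩

/-- The index map of the last face. -/
lemma cycIdx_δ_last {n : ℕ} {M : Type} [One M] (g : M) :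
    (∀ j : Fin (n + 1), cycIdx (SimplexCategory.δ (Fin.last (n + 1))).toOrderHom j.castSucc = j ∧
      cycLabel g (SimplexCategory.δ (Fin.last (n + 1))).toOrderHom j.castSucc = 1) ∧
    cycIdx (SimplexCategory.δ (Fin.last (n + 1))).toOrderHom (Fin.last (n + 1)) = 0 ∧
    cycLabel g (SimplexCategory.δ (Fin.last (n + 1))).toOrderHom (Fin.last (n + 1)) = g := by
  have h : ∀ x, (SimplexCategory.δ (Fin.last (n + 1))).toOrderHom x = Fin.castSucc x :=
    fun x => Fin.succAbove_last_apply x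
  have h' : ¬ ∃ x, Fin.last (n + 1) ≤ (SimplexCategory.δ (Fin.last (n + 1))).toOrderHom x := by
    rintro ⟨x, hx⟩
    rw [h] at hx
    exact absurd (Fin.castSucc_lt_last x) hx.not_gt
  refine ⟨fun j => ?_, cycIdx_neg h', if_neg h'⟩
  have hj : ∃ x, j.castSucc ≤ (SimplexCategory.δ (Fin.last (n + 1))).toOrderHom x :=
    ⟨j, (h j).ge⟩
  refine ⟨eq_of_forall_ge_iff fun x => (cycIdx_le hj x).trans ?_, if_pos hj⟩
  rw [h]
  exact Fin.castSucc_le_castSucc_iff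

/-- The index map of the degeneracy `sᵢ`. -/
lemma cycIdx_σ {n : ℕ} (i j : Fin (n + 1)) :
    cycIdx (SimplexCategory.σ i).toOrderHom j = i.succ.succAbove j ∧
      ∀ {M : Type} [One M] (g : M), cycLabel g (SimplexCategory.σ i).toOrderHom j = 1 := by
  have h : ∀ x : Fin (n + 2), i.succ.succAbove j ≤ x ↔
      j ≤ (SimplexCategory.σ i).toOrderHom x := fun x => by
    change _ ↔ j ≤ Fin.predAbove i x
    simp only [Fin.predAbove, Fin.succAbove, Fin.lt_def, Fin.le_def, Fin.val_castSucc]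
    split_ifs <;> simp at * <;> omega
  have hj : ∃ x, j ≤ (SimplexCategory.σ i).toOrderHom x :=
    ⟨Fin.last (n + 1), (h _).1 (Fin.le_last _)⟩
  exact ⟨eq_of_forall_ge_iff fun x => (cycIdx_le hj x).trans (h x).symm, fun g => if_pos hj⟩

variable {G : Type} [CommGroup G]

/-- The cyclic nerve of `R` twisted by `g`: its `n`-simplices are `ᵍR □ R^{□ n} = R^{□ (n + 1)}`,
with the factors numbered `0, …, n`. The structure map of `α : [m] → [n]` multiplies together, for
each `i ∈ [m]`, the factors `j` with `cycIdx α j = i`, after letting `g` act on the factors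
`j > α m`, which go to `i = 0`.

So the face `dᵢ` with `i < n` multiplies the factors `i` and `i + 1`, the face `dₙ` rotates the
factor `n` to the front, acts on it by `g` and multiplies it into the factor `0`, and the degeneracy
`sᵢ` inserts the unit between the factors `i` and `i + 1`. -/
noncomputable def nerve (g : G) : CommGreen.{u} G ⥤ SimplicialObject (CommGreen.{u} G) where
  obj R :=
    { obj := fun n => boxPow R (Fin (n.unop.len + 1))
      map := fun α => R.boxMap (cycIdx α.unop.toOrderHom) (cycLabel g α.unop.toOrderHom)
      map_id := fun n => by
        refine Eq.trans ?_ R.boxMap_id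
        exact congrArg₂ R.boxMap (funext cycIdx_id) (funext (cycLabel_id g))
      map_comp := fun α β => by
        refine Eq.trans ?_ (R.boxMap_comp _ _ _ _).symm
        exact congrArg₂ R.boxMap (funext (cycIdx_comp _ _)) (funext (cycLabel_comp g _ _)) }
  map f :=
    { app := fun n => CommGreen.powMap _ f
      naturality := fun _ _ α => CommGreen.powMap_boxMap f _ _ }
  map_id R := NatTrans.ext (funext fun n => CommGreen.powMap_id _)
  map_comp f f' := NatTrans.ext (funext fun n => CommGreen.powMap_comp _ f f')

end Nerve

/-! ## Edgewise subdivision -/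

lemma lt_mul_of_lt {r x m : ℕ} (hx : x < r * (m + 1) - 1 + 1) (hr : 0 < r) :
    x / (m + 1) < r := by
  have h : 0 < r * (m + 1) := Nat.mul_pos hr m.succ_pos
  exact Nat.div_lt_of_lt_mul (by rw [Nat.mul_comm]; omega)

lemma sd_lt {r a n b : ℕ} (ha : a < r) (hb : b < n + 1) :
    a * (n + 1) + b < r * (n + 1) - 1 + 1 := by
  have h := Nat.mul_le_mul_right (n + 1) (Nat.succ_le_of_lt ha)
  rw [Nat.succ_mul] at h
  omega

/-- The functor `[m] ↦ [r(m + 1) - 1]` on the simplex category, the `r`-fold concatenation, that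
sends `f : [m] → [n]` to the map `a(m + 1) + b ↦ a(n + 1) + f(b)`. -/
def sdFunctor (r : ℕ+) : SimplexCategory ⥤ SimplexCategory where
  obj m := SimplexCategory.mk (r * (m.len + 1) - 1)
  map {m n} f := SimplexCategory.Hom.mk
    { toFun := fun x => ⟨x / (m.len + 1) * (n.len + 1) +
          f.toOrderHom ⟨x % (m.len + 1), Nat.mod_lt _ m.len.succ_pos⟩,
        sd_lt (lt_mul_of_lt x.isLt r.pos) (Fin.isLt _)⟩
      monotone' := fun x y hxy => by
        have hxy' : (x : ℕ) ≤ y := hxy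
        rw [Fin.mk_le_mk]
        rcases (Nat.div_le_div_right (c := m.len + 1) hxy').lt_or_eq with h | h
        · have h2 := (f.toOrderHom ⟨x % (m.len + 1), Nat.mod_lt _ m.len.succ_pos⟩).isLt
          have h3 := Nat.mul_le_mul_right (n.len + 1) (Nat.succ_le_of_lt h)
          rw [Nat.succ_mul] at h3
          omega
        · rw [h]
          refine Nat.add_le_add_left (f.toOrderHom.monotone ?_) _
          rw [Fin.mk_le_mk]
          have e1 := Nat.div_add_mod (x : ℕ) (m.len + 1)
          have e2 := Nat.div_add_mod (y : ℕ) (m.len + 1)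
          rw [h] at e1
          omega }
  map_id m := by
    refine SimplexCategory.Hom.ext _ _ (OrderHom.ext _ _ (funext fun x => Fin.ext ?_))
    exact Nat.div_add_mod' (x : ℕ) (m.len + 1)
  map_comp {l m n} f g := by
    refine SimplexCategory.Hom.ext _ _ (OrderHom.ext _ _ (funext fun x => Fin.ext ?_))
    have h := (f.toOrderHom ⟨x % (l.len + 1), Nat.mod_lt _ l.len.succ_pos⟩).isLt
    have hb := f.toOrderHom ⟨x % (l.len + 1), Nat.mod_lt _ l.len.succ_pos⟩
    change _ / _ * _ + (g.toOrderHom (f.toOrderHom ⟨x % (l.len + 1), _⟩) : ℕ) =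
      ((x / (l.len + 1) * (m.len + 1) + (f.toOrderHom _ : ℕ)) / (m.len + 1)) * (n.len + 1) +
        (g.toOrderHom ⟨(x / (l.len + 1) * (m.len + 1) + (f.toOrderHom _ : ℕ)) % (m.len + 1), _⟩ : ℕ)
    have e1 : ((x : ℕ) / (l.len + 1) * (m.len + 1) + (f.toOrderHom ⟨x % (l.len + 1),
        Nat.mod_lt _ l.len.succ_pos⟩ : ℕ)) / (m.len + 1) = x / (l.len + 1) := by
      rw [Nat.mul_comm, Nat.mul_add_div m.len.succ_pos, Nat.div_eq_of_lt h, Nat.add_zero]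
    have e2 : ((x : ℕ) / (l.len + 1) * (m.len + 1) + (f.toOrderHom ⟨x % (l.len + 1),
        Nat.mod_lt _ l.len.succ_pos⟩ : ℕ)) % (m.len + 1) =
        f.toOrderHom ⟨x % (l.len + 1), Nat.mod_lt _ l.len.succ_pos⟩ := by
      rw [Nat.mul_comm, Nat.mul_add_mod, Nat.mod_eq_of_lt h]
    rw [e1]
    refine congrArg (fun z : Fin (m.len + 1) => _ + (g.toOrderHom z : ℕ)) (Fin.ext e2.symm)

/-- The `r`-fold edgewise subdivision of a simplicial object. -/
def sd (C : Type*) [Category C] (r : ℕ+) : SimplicialObject C ⥤ SimplicialObject C :=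
  (Functor.whiskeringLeft _ _ _).obj (sdFunctor r).op

/-! ## Finite subgroups of the circle -/

section Circle

lemma exp_mem (G : Subgroup Circle) [Finite G] : Circle.exp (2 * Real.pi / Nat.card G) ∈ G := by
  have hn : Nat.card G ≠ 0 := Nat.card_pos.ne'
  have hn' : (Nat.card G : ℝ) ≠ 0 := by exact_mod_cast hn
  have hfin := Fintype.ofFinite G
  let f : G → ℂ := fun x => ((x : Circle) : ℂ)
  have hf : Function.Injective f := fun x y h => Subtype.ext (Circle.ext h)
  have hsub : Finset.univ.image f ⊆ Polynomial.nthRootsFinset (Nat.card G) (1 : ℂ) := by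
    intro z hz
    obtain ⟨x, -, rfl⟩ := Finset.mem_image.1 hz
    rw [Polynomial.mem_nthRootsFinset (Nat.pos_of_ne_zero hn)]
    have h : x ^ Nat.card G = 1 := pow_card_eq_one'
    have h2 := congrArg (fun y : G => ((y : Circle) : ℂ)) h
    exact h2
  have hcard : (Polynomial.nthRootsFinset (Nat.card G) (1 : ℂ)).card ≤
      (Finset.univ.image f).card := by
    rw [Finset.card_image_of_injective _ hf, Finset.card_univ, ← Nat.card_eq_fintype_card,
      Polynomial.nthRootsFinset_def]
    exact (Multiset.toFinset_card_le _).trans (Polynomial.card_nthRoots _ _)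
  have hmem : ((Circle.exp (2 * Real.pi / Nat.card G) : Circle) : ℂ) ∈
      Finset.univ.image f := by
    rw [Finset.eq_of_subset_of_card_le hsub hcard,
      Polynomial.mem_nthRootsFinset (Nat.pos_of_ne_zero hn), ← Circle.coe_pow, ← Circle.exp_nsmul,
      nsmul_eq_mul, mul_div_cancel₀ _ hn', Circle.exp_two_pi, Circle.coe_one]
  obtain ⟨x, -, hx⟩ := Finset.mem_image.1 hmem
  rw [← (Circle.ext hx : (x : Circle) = _)]
  exact x.2

/-- The generator `e^{2πi/|G|}` of a finite subgroup `G` of the circle. -/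
noncomputable def gen (G : Subgroup Circle) [Finite G] : G :=
  ⟨Circle.exp (2 * Real.pi / Nat.card G), exp_mem G⟩

/-- The index `[G : J]` as a positive integer. -/
noncomputable def index (J G : Subgroup Circle) [Finite G] : ℕ+ :=
  ⟨J.relIndex G, Nat.pos_of_ne_zero (Subgroup.FiniteIndex.index_ne_zero (H := J.subgroupOf G))⟩

/-- The `G`-twisted cyclic nerve relative to `K`, `HC^G_K(R) = HC^G(N_K^G R; ᵍN_K^G R)`, where
`g = e^{2πi/|G|}`. -/
noncomputable def relNerve {K G : Subgroup Circle} [Finite G] (h : K ≤ G) :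
    CommGreen.{u} K ⥤ SimplicialObject (CommGreen.{u} G) :=
  norm (Subgroup.inclusion h) ⋙ nerve (gen G)

end Circle

/-! ## Quasi-isomorphisms -/

section QuasiIso

variable {G : Type} [Group G]

/-- The value of a Mackey functor at a finite `G`-set, as an abelian group. -/
noncomputable def evalAb (T : FinGSet.{u} G) : Mack.{u, w} G ⥤ AddCommGrpCat.{w} where
  obj M := @AddCommGrpCat.of (M.obj.obj T) (M.property.addCommGroup T)
  map {M N} f :=
    letI := M.property.addCommGroup T
    letI := N.property.addCommGroup T
    AddCommGrpCat.ofHom (AddMonoidHom.mk' (f.hom.app T)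
      (M.property.choose.app_add N.property.choose f.hom))

/-- A map of simplicial Mackey functors is a quasi-isomorphism if it induces isomorphisms on the
homology Mackey functors of the normalized chain complexes. These are computed at each finite
`G`-set. -/
def IsQuasiIso {X Y : SimplicialObject (Mack.{u, w} G)} (f : X ⟶ Y) : Prop :=
  ∀ T : FinGSet.{u} G, QuasiIso ((AlgebraicTopology.normalizedMooreComplex AddCommGrpCat.{w}).map
    (((SimplicialObject.whiskering _ _).obj (evalAb T)).map f))

end QuasiIso

end TwistedNerve

open TwistedNerve

/-! The comparison is an isomorphism in every simplicial degree, and is therefore a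
quasi-isomorphism for trivial reasons. Put `r = [G : J]`. Restricting a norm from `G` to `J` gives a
double coset formula: `i_J^* N_H^G R` is the box product of `r` copies of `N_H^J R`, one for each
coset of `J` in `G`. Hence `i_J^*` of the `(n+1)`-fold box power of `N_H^G R` is the `r(n+1)`-fold
box power of `N_H^J R`, which is the degree `n` part of the `r`-fold subdivision. What remains is to
choose coset representatives for which these isomorphisms respect the simplicial structure.

Bijectivity. Left Kan extensions compose, so a box power of norms is one left Kan extension along
`(Aᵢ) ↦ ∏ᵢ F_K(G, Aᵢ)` (`normBox_bijective`). Evaluating it at `G ×_J T` involves morphisms into an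
induced set. On Burnside categories restriction is left adjoint to induction (`indHomEquiv`), and a
restricted coinduced set splits over the cosets (`cosetMap_bijective`). So these morphisms
correspond to morphisms `∏ₖ F_K(J, A_{π k}) ⟶ T`, where `π k` is the factor from which `k` comes
(`cosetHomEquiv`). The result is a left Kan extension in which coordinates over the same `i` are
forced to agree. That constraint is harmless: disjoint unions are products in the Burnside category,
`R` preserves them, and so extension along the diagonal `(Aᵢ) ↦ (A_{π k})` turns `∏ᵢ R(Aᵢ)` into `∏ₖ
R(Aₖ)` (`Lan.comap_bijective`). The composite of these bijections is `cosetFun_bijective`.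

Simplicial structure. Write a position of the subdivision as `k = a(n+1) + b`, with `a` the block,
and give it the representative `g^(r-1-a)`. When a factor passes the end of a block `a < r-1`, the
subdivided nerve does not act on it, while its representative loses one factor `g`; this loss is the
single `g` by which the `G`-nerve acts. When a factor passes the end of the last block, it comes
back to block `0`, and `g^(r-1) · g = g^r` is the generator of `J`, by which the `J`-nerve acts
(`inclusion_gen`). This bookkeeping is `sdMod_cycIdx`.

Commuting squares. A morphism of Green functors out of `i_J^*` of a box power of norms is determined
by its values on tensors with one nontrivial factor, that factor being a restriction of a universal
element of the norm (`restrict_boxPow_norm_hom_ext`). On these the comparison has an explicit value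
(`cosetApp_mulSingle`), so compatibility with structure maps becomes a count of coset
representatives (`restrict_boxMap_cosetHom`). -/

namespace TwistedNerve

/-! ## Quotients of products -/

/-- A function on a finite product of sets that is compatible with reflexive relations on the
factors descends to the product of the quotients. -/
lemma eq_of_quot_eq {ι : Type*} [Finite ι] {α : ι → Type*} {X : Type*}
    (r : ∀ i, α i → α i → Prop) (hr : ∀ i a, r i a a) (f : (∀ i, α i) → X)
    (hf : ∀ y y', (∀ i, r i (y i) (y' i)) → f y = f y') (y y' : ∀ i, α i)
    (h : ∀ i, Quot.mk (r i) (y i) = Quot.mk (r i) (y' i)) : f y = f y' := by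
  classical
  have := Fintype.ofFinite ι
  -- One coordinate at a time, `f` is a function of a single variable that factors through the
  -- quotient; reflexivity handles the coordinates that are held fixed. This absorbs the passage
  -- from `r i` to the equivalence relation that it generates.
  have step : ∀ (z : ∀ i, α i) (i : ι) (a b : α i), Quot.mk (r i) a = Quot.mk (r i) b →
      f (Function.update z i a) = f (Function.update z i b) := by
    intro z i a b hab
    refine congrArg (Quot.lift (fun a => f (Function.update z i a)) fun a b hab => ?_) hab
    refine hf _ _ fun k => ?_
    by_cases hk : k = i
    · subst hk
      simpa using hab
    · simpa [hk] using hr k _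
  -- Finiteness enters here: the coordinates in `s` have already been replaced.
  have key : ∀ s : Finset ι, f y = f (s.piecewise y' y) := by
    intro s
    induction s using Finset.induction_on with
    | empty => rw [Finset.piecewise_empty]
    | insert i s hi ih =>
      rw [Finset.piecewise_insert, ih, ← step _ i (y i) (y' i) (h i)]
      congr 1
      refine (Function.update_eq_self_iff.2 ?_).symm
      rw [Finset.piecewise_eq_of_notMem _ _ _ hi]
  rw [key Finset.univ, Finset.piecewise_univ]

/-! ## Further properties of left Kan extensions -/

section LanMore

variable {C D D' : Type w} [Category.{w} C] [Category.{w} D] [Category.{w} D']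

/-- Natural bijections `(F c ⟶ d) ≃ (F' c ⟶ d')` induce a bijection of left Kan extensions. -/
lemma Lan.bijective_of_homEquiv {F : C ⥤ D} {F' : C ⥤ D'} {M : C ⥤ Type w} {d : D} {d' : D'}
    (e : ∀ c, (F.obj c ⟶ d) ≃ (F'.obj c ⟶ d'))
    (he : ∀ {c c' : C} (v : c ⟶ c') (s : F.obj c' ⟶ d), e c (F.map v ≫ s) = F'.map v ≫ e c' s)
    (f : (Lan F M).obj d → (Lan F' M).obj d')
    (hf : ∀ {c : C} (s : F.obj c ⟶ d) (m : M.obj c), f (Lan.mk s m) = Lan.mk (e c s) m) :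
    Function.Bijective f := by
  have he' : ∀ {c c' : C} (v : c ⟶ c') (s : F'.obj c' ⟶ d'),
      (e c).symm (F'.map v ≫ s) = F.map v ≫ (e c').symm s := fun v s => by
    rw [Equiv.symm_apply_eq, he, Equiv.apply_symm_apply]
  let g : (Lan F' M).obj d' → (Lan F M).obj d :=
    Lan.elim (fun {c} s m => Lan.mk ((e c).symm s) m) fun v s m => by
      rw [he', Lan.mk_map]
  refine Function.bijective_iff_has_inverse.2 ⟨g, fun x => ?_, fun x => ?_⟩
  · obtain ⟨c, s, m, rfl⟩ := Lan.exists_mk x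
    rw [hf]
    exact congrArg (fun s => Lan.mk s m) ((e c).symm_apply_apply s)
  · obtain ⟨c, s, m, rfl⟩ := Lan.exists_mk x
    exact (hf _ _).trans (congrArg (fun s => Lan.mk s m) ((e c).apply_symm_apply s))

/-- An inversion principle in existential form, so that connecting morphisms can be chosen for all
factors of a product at once. -/
lemma LanRel.exists_hom {F : C ⥤ D} {M : C ⥤ Type w} {d : D} {a b : LanPre F M d}
    (h : LanRel F M d a b) : ∃ v : a.c ⟶ b.c, a.s = F.map v ≫ b.s ∧ b.m = M.map v a.m := by
  cases h with
  | mk v s m => exact ⟨v, rfl, rfl⟩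

/-- The identity of the indexing object witnesses this; reflexivity is what `eq_of_quot_eq` asks of
the relations on the factors. -/
lemma LanRel.refl {F : C ⥤ D} {M : C ⥤ Type w} {d : D} (a : LanPre F M d) : LanRel F M d a a := by
  have h := LanRel.mk (F := F) (M := M) (𝟙 a.c) a.s a.m
  rwa [F.map_id, Category.id_comp, Functor.map_id_apply] at h

end LanMore

/-! ### Generators of box products of arbitrary families -/

section BurnsidePi

variable {G : Type} [Group G]

lemma burnsidePi_comp {ι : Type} [Finite ι] {S T W : ι → FinGSet.{u} G} (f : ∀ i, S i ⟶ T i)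
    (g : ∀ i, T i ⟶ W i) : burnsidePi f ≫ burnsidePi g = burnsidePi fun i => f i ≫ g i :=
  ((piFunctor G ι).map_comp f g).symm

lemma burnsidePi_id {ι : Type} [Finite ι] (S : ι → FinGSet.{u} G) :
    burnsidePi (fun i => 𝟙 (S i)) = 𝟙 (FinGSet.pi S) :=
  (piFunctor G ι).map_id S

variable {ι : Type} [Finite ι]

/-- The element of `□ᵢ Mᵢ` represented by `s : ∏ᵢ Sᵢ ⟶ T` and `(bᵢ)ᵢ ∈ ∏ᵢ Mᵢ(Sᵢ)`. -/
noncomputable def boxMk {M : ι → (FinGSet.{u} G ⥤ Type (u + 1))} {S : ι → FinGSet.{u} G}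
    {T : FinGSet.{u} G} (s : FinGSet.pi S ⟶ T) (b : ∀ i, (M i).obj (S i)) : (box M).obj T :=
  Lan.mk (F := piFunctor G ι) (M := extProd M) (c := S) s b

lemma boxMk_pi {M : ι → (FinGSet.{u} G ⥤ Type (u + 1))} {S S' : ι → FinGSet.{u} G}
    {T : FinGSet.{u} G} (v : ∀ i, S i ⟶ S' i) (s : FinGSet.pi S' ⟶ T) (b : ∀ i, (M i).obj (S i)) :
    boxMk (burnsidePi v ≫ s) b = boxMk (M := M) s fun i => (M i).map (v i) (b i) :=
  Lan.mk_map (F := piFunctor G ι) (M := extProd M) (c := S) (c' := S') v s b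

lemma exists_boxMk {M : ι → (FinGSet.{u} G ⥤ Type (u + 1))} {T : FinGSet.{u} G}
    (x : (box M).obj T) : ∃ (S : ι → FinGSet.{u} G) (s : FinGSet.pi S ⟶ T)
      (b : ∀ i, (M i).obj (S i)), x = boxMk s b :=
  Lan.exists_mk x

end BurnsidePi

/-! ### A box product of norms as a single left Kan extension -/

section Flat

variable {K G : Type} [Group K] [Group G] [Finite G]

/-- The morphism `F_K(G, A) ⟶ F_K(G, A')` induced by a morphism `A ⟶ A'` of the Burnside
category. -/
def coindHom (φ : K →* G) {A A' : FinGSet.{u} K} (v : A ⟶ A') :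
    FinGSet.coind φ A ⟶ FinGSet.coind φ A' := (coind φ).burnside.map v

/-- The functor `(Aᵢ)ᵢ ↦ ∏ᵢ F_K(G, Aᵢ)` on Burnside categories. -/
noncomputable def coindPi (φ : K →* G) (ι : Type) [Finite ι] :
    (ι → FinGSet.{u} K) ⥤ FinGSet.{u} G :=
  Functor.pi (fun _ : ι => (coind φ).burnside) ⋙ piFunctor G ι

section

variable {ι : Type} [Finite ι]

/-- The element of the norm represented by `s : F_K(G, A) ⟶ T` and `x ∈ M(A)`. -/
def normMk (φ : K →* G) {M : FinGSet.{u} K ⥤ Type (u + 1)} {A : FinGSet.{u} K}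
    {T : FinGSet.{u} G} (s : FinGSet.coind φ A ⟶ T) (x : M.obj A) : (normFn φ M).obj T :=
  Lan.mk (F := (coind φ).burnside) s x

lemma map_normMk (φ : K →* G) {M : FinGSet.{u} K ⥤ Type (u + 1)} {A : FinGSet.{u} K}
    {T T' : FinGSet.{u} G} (s : FinGSet.coind φ A ⟶ T) (t : T ⟶ T') (x : M.obj A) :
    (normFn φ M).map t (normMk φ s x) = normMk φ (s ≫ t) x := rfl

lemma normMk_map (φ : K →* G) {M : FinGSet.{u} K ⥤ Type (u + 1)} {A A' : FinGSet.{u} K}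
    {T : FinGSet.{u} G} (v : A ⟶ A') (s : FinGSet.coind φ A' ⟶ T) (x : M.obj A) :
    normMk φ ((coind φ).burnside.map v ≫ s) x = normMk φ s (M.map v x) :=
  Lan.mk_map (F := (coind φ).burnside) v s x

lemma exists_normMk (φ : K →* G) {M : FinGSet.{u} K ⥤ Type (u + 1)} {T : FinGSet.{u} G}
    (x : (normFn φ M).obj T) : ∃ (A : FinGSet.{u} K) (s : FinGSet.coind φ A ⟶ T) (a : M.obj A),
      x = normMk φ s a :=
  Lan.exists_mk x

/-- The element of the left Kan extension along `(Aᵢ)ᵢ ↦ ∏ᵢ F_K(G, Aᵢ)` represented by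
`s : ∏ᵢ F_K(G, Aᵢ) ⟶ T` and `(xᵢ)ᵢ ∈ ∏ᵢ M(Aᵢ)`. -/
noncomputable def coindPiMk (φ : K →* G) {M : FinGSet.{u} K ⥤ Type (u + 1)}
    {A : ι → FinGSet.{u} K} {T : FinGSet.{u} G} (s : FinGSet.pi (fun i => FinGSet.coind φ (A i)) ⟶ T)
    (x : ∀ i, M.obj (A i)) : (Lan (coindPi φ ι) (extProd fun _ : ι => M)).obj T :=
  Lan.mk (F := coindPi φ ι) (M := extProd fun _ : ι => M) (c := A) s x

lemma coindPiMk_map (φ : K →* G) {M : FinGSet.{u} K ⥤ Type (u + 1)} {A A' : ι → FinGSet.{u} K}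
    {T : FinGSet.{u} G} (v : ∀ i, A i ⟶ A' i)
    (s : FinGSet.pi (fun i => FinGSet.coind φ (A' i)) ⟶ T) (x : ∀ i, M.obj (A i)) :
    coindPiMk φ (burnsidePi (fun i => coindHom φ (v i)) ≫ s) x =
      coindPiMk (M := M) φ s fun i => M.map (v i) (x i) :=
  Lan.mk_map (F := coindPi φ ι) (M := extProd fun _ : ι => M) (c := A) (c' := A') v s x

/-- The box product of norms as a single left Kan extension. -/
noncomputable def normBox (φ : K →* G) (ι : Type) [Finite ι] (M : FinGSet.{u} K ⥤ Type (u + 1)) :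
    Lan (coindPi φ ι) (extProd fun _ : ι => M) ⟶ box fun _ : ι => normFn φ M :=
  Lan.desc
    { app := fun A => ↾fun x => boxMk (M := fun _ => normFn φ M)
        (𝟙 (FinGSet.pi fun i => FinGSet.coind φ (A i))) fun i => normMk φ (𝟙 _) (x i)
      naturality := fun A A' v => by
        ext x
        have h := boxMk_pi (M := fun _ => normFn φ M) (fun i => coindHom φ (v i))
          (𝟙 (FinGSet.pi fun i => FinGSet.coind φ (A' i))) fun i => normMk φ (𝟙 _) (x i)
        rw [Category.comp_id] at h
        refine Eq.trans ?_ (h.symm.trans ?_)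
        · refine congrArg (fun b => boxMk _ b) (funext fun i => ?_)
          refine (normMk_map φ (v i) (𝟙 _) (x i)).symm.trans ?_
          exact congrArg (fun s => normMk φ s (x i))
            ((Category.comp_id (coindHom φ (v i))).trans (Category.id_comp _).symm)
        · exact congrArg (fun s => boxMk s fun i => normMk φ (𝟙 _) (x i)) (Category.id_comp _).symm }

lemma normBox_mk (φ : K →* G) {M : FinGSet.{u} K ⥤ Type (u + 1)} {T : FinGSet.{u} G}
    {A : ι → FinGSet.{u} K} (s : FinGSet.pi (fun i => FinGSet.coind φ (A i)) ⟶ T)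
    (x : ∀ i, M.obj (A i)) : (normBox φ ι M).app T (coindPiMk φ s x) =
      boxMk (M := fun _ => normFn φ M) s fun i => normMk φ (𝟙 _) (x i) :=
  congrArg (fun s => boxMk (M := fun _ => normFn φ M) s fun i => normMk φ (𝟙 _) (x i))
    (Category.id_comp s)

/-- This is transitivity of left Kan extensions, proved on generators. For the inverse, represent
each factor of a generator of the box product by a generator of the norm and absorb the structure
morphisms of these representatives into the outer morphism. The work lies in showing independence of
the representatives, which change in all factors simultaneously. -/
lemma normBox_bijective (φ : K →* G) (ι : Type) [Finite ι] (M : FinGSet.{u} K ⥤ Type (u + 1))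
    (T : FinGSet.{u} G) : Function.Bijective ((normBox φ ι M).app T) := by
  -- the element with given representatives of the factors
  let f : ∀ {S : ι → FinGSet.{u} G}, (FinGSet.pi S ⟶ T) →
      (∀ i, LanPre (coind φ).burnside M (S i)) → (Lan (coindPi φ ι) (extProd fun _ : ι => M)).obj T :=
    fun {S} s y => coindPiMk φ (burnsidePi (fun i => (y i).s) ≫ s) fun i => (y i).m
  -- If each factor moves by one generating relation, the chosen morphisms `v i` form a morphism of
  -- families, and this is one relation in the target. `eq_of_quot_eq` extends this to arbitrary
  -- changes of representatives.
  have hf : ∀ {S : ι → FinGSet.{u} G} (s : FinGSet.pi S ⟶ T)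
      (y y' : ∀ i, LanPre (coind φ).burnside M (S i)),
      (∀ i, (y i).cls = (y' i).cls) → f s y = f s y' := by
    intro S s
    refine eq_of_quot_eq (fun i => LanRel (coind φ).burnside M (S i)) (fun i => LanRel.refl) _ ?_
    intro y y' h
    choose v h1 h2 using fun i => (h i).exists_hom
    have e := coindPiMk_map φ v (burnsidePi (fun i => (y' i).s) ≫ s) fun i => (y i).m
    refine Eq.trans ?_ (e.trans ?_)
    · refine congrArg (fun s => coindPiMk φ s fun i => (y i).m) ?_
      refine Eq.trans ?_ (Category.assoc _ _ _)
      refine congrArg (· ≫ s) (Eq.trans ?_ (burnsidePi_comp _ _).symm)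
      exact congrArg burnsidePi (funext h1)
    · exact congrArg (coindPiMk φ _) (funext h2).symm
  -- Representatives are chosen arbitrarily and without any naturality; `hf` makes the choice
  -- irrelevant.
  have hrep : ∀ {S : FinGSet.{u} G} (z : (normFn φ M).obj S),
      ∃ y : LanPre (coind φ).burnside M S, y.cls = z := fun z => Quot.exists_rep z
  choose rep hrep using @hrep
  let g : (box fun _ : ι => normFn φ M).obj T → (Lan (coindPi φ ι) (extProd fun _ : ι => M)).obj T :=
    Lan.elim (F := piFunctor G ι) (M := extProd fun _ => normFn φ M)
      (fun {S} s b => f s fun i => rep (b i)) fun {S S'} v s b => by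
        -- The chosen representative of the image of `b i` under `v i` may differ from the pushed
        -- forward representative of `b i`, but their classes coincide.
        refine Eq.trans ?_ (hf s (fun i => ⟨(rep (b i)).c, (rep (b i)).s ≫ v i, (rep (b i)).m⟩) _
          fun i => ?_)
        · refine congrArg (fun t => coindPiMk φ t fun i => (rep (b i)).m) ?_
          refine (Category.assoc _ _ _).symm.trans ?_
          exact congrArg (· ≫ s) (burnsidePi_comp _ _)
        · refine Eq.trans ?_ (hrep _).symm
          exact congrArg ((normFn φ M).map (v i)) (hrep (b i))
  refine Function.bijective_iff_has_inverse.2 ⟨g, fun z => ?_, fun z => ?_⟩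
  · obtain ⟨A, s, x, rfl⟩ := Lan.exists_mk z
    refine (congrArg g (normBox_mk φ s x)).trans ?_
    -- The chosen representative of a universal element is exchanged for the tautological one.
    refine (hf s _ (fun i => ⟨A i, 𝟙 _, x i⟩) fun i => hrep _).trans ?_
    refine congrArg (fun s => coindPiMk φ s x) ?_
    exact (congrArg (· ≫ s) (burnsidePi_id _)).trans (Category.id_comp s)
  · obtain ⟨S, s, b, rfl⟩ := exists_boxMk z
    refine (normBox_mk φ _ _).trans ?_
    refine (boxMk_pi (M := fun _ => normFn φ M) _ _ _).trans ?_
    refine congrArg (boxMk s) (funext fun i => ?_)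
    refine (map_normMk φ _ _ _).trans (Eq.trans ?_ (hrep (b i)))
    exact congrArg (fun s => normMk φ s (rep (b i)).m) (Category.id_comp _)

end

end Flat

/-! ## Finite products in the Burnside category -/

section Products

variable {K : Type} [Group K]

/-- The object is the disjoint union of the `A k`, built one summand at a time; restrictions to the
summands are the projections. Morphisms into it need only exist, since uniqueness can be tested
after applying `M`. -/
lemma IsSemiMackey.exists_finite_prod {M : FinGSet.{u} K ⥤ Type (u + 1)} (hM : IsSemiMackey M)
    {κ : Type} (A : κ → FinGSet.{u} K) (s : Finset κ) :
    ∃ (c : FinGSet.{u} K) (p : ∀ k ∈ s, c ⟶ A k),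
      (∀ (X : FinGSet.{u} K) (f : ∀ k ∈ s, X ⟶ A k), ∃ l : X ⟶ c, ∀ k hk, l ≫ p k hk = f k hk) ∧
      (∀ y : ∀ k ∈ s, M.obj (A k), ∃ x : M.obj c, ∀ k hk, M.map (p k hk) x = y k hk) ∧
      ∀ x x' : M.obj c, (∀ k hk, M.map (p k hk) x = M.map (p k hk) x') → x = x' := by
  classical
  induction s using Finset.induction_on with
  | empty =>
    refine ⟨FinGSet.empty K, fun k hk => absurd hk (Finset.notMem_empty k), fun X f =>
      ⟨res (FinGSet.fromEmpty X), fun k hk => absurd hk (Finset.notMem_empty k)⟩, fun y =>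
      ⟨hM.empty.choose, fun k hk => absurd hk (Finset.notMem_empty k)⟩, fun x x' _ =>
      (hM.empty.choose_spec x).trans (hM.empty.choose_spec x').symm⟩
  | insert k₀ s hk₀ ih =>
    obtain ⟨c, p, h1, h2, h3⟩ := ih
    -- The projection is specified by two equations, one for the new index and one for the old ones.
    -- The `eqToHom` only identifies `A k₀` with `A k` when `k = k₀`.
    have hex : ∀ k (hk : k ∈ insert k₀ s), ∃ q : (A k₀).sum c ⟶ A k,
        (∀ h : k = k₀, q = res (FinGSet.inl (A k₀) c) ≫ eqToHom (by rw [h])) ∧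
        ∀ h : k ∈ s, q = res (FinGSet.inr (A k₀) c) ≫ p k h := by
      intro k hk
      by_cases h : k = k₀
      · exact ⟨res (FinGSet.inl (A k₀) c) ≫ eqToHom (by rw [h]), fun _ => rfl,
          fun h' => absurd (h ▸ h') hk₀⟩
      · have hs := (Finset.mem_insert.1 hk).resolve_left h
        exact ⟨res (FinGSet.inr (A k₀) c) ≫ p k hs, fun h' => absurd h' h, fun _ => rfl⟩
    choose q hq1 hq2 using hex
    have hq1' : q k₀ (Finset.mem_insert_self k₀ s) = res (FinGSet.inl (A k₀) c) := by
      rw [hq1 k₀ _ rfl, eqToHom_refl, Category.comp_id]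
    refine ⟨(A k₀).sum c, q, fun X f => ?_, fun y => ?_, fun x x' hx => ?_⟩
    · obtain ⟨l, hl⟩ := h1 X fun k hk => f k (Finset.mem_insert_of_mem hk)
      obtain ⟨l', hl1, hl2⟩ := burnside_lift (f k₀ (Finset.mem_insert_self k₀ s)) l
      refine ⟨l', fun k hk => ?_⟩
      rcases Finset.mem_insert.1 hk with h | h
      · subst h
        rw [hq1', hl1]
      · rw [hq2 k hk h, ← Category.assoc, hl2, hl]
    · obtain ⟨x, hx⟩ := h2 fun k hk => y k (Finset.mem_insert_of_mem hk)
      refine ⟨hM.pair (y k₀ (Finset.mem_insert_self k₀ s)) x, fun k hk => ?_⟩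
      rcases Finset.mem_insert.1 hk with h | h
      · subst h
        rw [hq1', hM.inl_pair]
      · rw [hq2 k hk h, Functor.map_comp_apply, hM.inr_pair, hx]
    · refine hM.hom_ext ?_ (h3 _ _ fun k hk => ?_)
      · have := hx k₀ (Finset.mem_insert_self k₀ s)
        rwa [hq1'] at this
      · have := hx k (Finset.mem_insert_of_mem hk)
        rwa [hq2 k _ hk, Functor.map_comp_apply, Functor.map_comp_apply] at this

/-- The left Kan extension of `∏ᵢ M(Aᵢ)` along the composite of a functor `E` with the diagonal
`(Aᵢ)ᵢ ↦ (A_{π k})ₖ` is the left Kan extension of `∏ₖ M(Aₖ)` along `E`. -/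
lemma Lan.comap_bijective {M : FinGSet.{u} K ⥤ Type (u + 1)} (hM : IsSemiMackey M) {ι κ : Type}
    [Finite κ] (π : κ → ι) {D : Type (u + 1)} [Category.{u + 1} D] (E : (κ → FinGSet.{u} K) ⥤ D)
    (d : D)
    (f : (Lan (Pi.comap (fun _ : ι => FinGSet.{u} K) π ⋙ E) (extProd fun _ : ι => M)).obj d →
      (Lan E (extProd fun _ : κ => M)).obj d)
    (hf : ∀ {A : ι → FinGSet.{u} K} (s : E.obj (fun k => A (π k)) ⟶ d) (x : ∀ i, M.obj (A i)),
      f (Lan.mk (F := Pi.comap (fun _ : ι => FinGSet.{u} K) π ⋙ E) (c := A) s x) =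
        Lan.mk (F := E) (M := extProd fun _ : κ => M) (c := fun k => A (π k)) s
          fun k => x (π k)) : Function.Bijective f := by
  classical
  have := Fintype.ofFinite κ
  have hprod := fun (A : κ → FinGSet.{u} K) (i : ι) =>
    hM.exists_finite_prod A (Finset.univ.filter fun k => π k = i)
  choose c p h1 h2 h3 using hprod
  have hm : ∀ k, k ∈ Finset.univ.filter fun k' => π k' = π k := fun k => by simp
  -- `c A i` is the product of the `A k` over the fibre of `π` at `i`, so `A ↦ c A` plays the part
  -- of a right adjoint to the diagonal, with `P` as counit. Extension along a left adjoint is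
  -- precomposition with its right adjoint, and `M` turns the product over each fibre into the
  -- product of the values.
  let P : ∀ (A : κ → FinGSet.{u} K), (fun k => c A (π k)) ⟶ A := fun A k => p A (π k) k (hm k)
  choose n hn using h2
  let F := Pi.comap (fun _ : ι => FinGSet.{u} K) π ⋙ E
  let mk : ∀ (A : ι → FinGSet.{u} K) (s : E.obj (fun k => A (π k)) ⟶ d) (x : ∀ i, M.obj (A i)),
      (Lan F (extProd fun _ : ι => M)).obj d := fun A s x =>
    Lan.mk (F := F) (M := extProd fun _ : ι => M) (c := A) s x
  have hmk : ∀ {A A' : ι → FinGSet.{u} K} (v : ∀ i, A i ⟶ A' i)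
      (s : E.obj (fun k => A' (π k)) ⟶ d) (x : ∀ i, M.obj (A i)),
      mk A (E.map (X := fun k => A (π k)) (Y := fun k => A' (π k)) (fun k => v (π k)) ≫ s) x =
        mk A' s fun i => M.map (v i) (x i) := fun {A A'} v s x =>
    Lan.mk_map (F := F) (M := extProd fun _ : ι => M) (c := A) (c' := A') v s x
  let g : (Lan E (extProd fun _ : κ => M)).obj d → (Lan F (extProd fun _ : ι => M)).obj d :=
    Lan.elim (F := E) (M := extProd fun _ : κ => M)
      (fun {A} s x => mk (c A) (E.map (P A) ≫ s) fun i => n A i fun k _ => x k)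
      fun {A A'} v s x => by
        -- `w` is the action of the would-be right adjoint on `v`: in each fibre, the morphism of
        -- products with components `v k`.
        choose w hw using fun i => h1 A' i (c A i) fun k hk => p A i k hk ≫ v k
        have e1 : (fun i => n A' i fun k _ => M.map (v k) (x k)) =
            fun i => M.map (w i) (n A i fun k _ => x k) := funext fun i => by
          refine h3 A' i _ _ fun k hk => ?_
          rw [hn, ← Functor.map_comp_apply, hw, Functor.map_comp_apply, hn]
        change mk _ _ _ = mk (c A') _ (fun i => n A' i fun k _ => M.map (v k) (x k))
        rw [e1, ← hmk]
        refine congrArg (fun s => mk (c A) s _) ?_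
        rw [← Category.assoc, ← Category.assoc, ← E.map_comp, ← E.map_comp]
        exact congrArg (fun t => E.map t ≫ s) (funext fun k => (hw (π k) k (hm k)).symm)
  refine Function.bijective_iff_has_inverse.2 ⟨g, fun z => ?_, fun z => ?_⟩
  · obtain ⟨A, s, x, rfl⟩ := Lan.exists_mk z
    refine (congrArg g (hf s x)).trans ?_
    change mk _ (E.map (P fun k => A (π k)) ≫ s) (fun i => n (fun k => A (π k)) i
      fun k _ => x (π k)) = mk A s x
    have hπ : ∀ i k, k ∈ (Finset.univ.filter fun k => π k = i) → A i = A (π k) := fun i k hk => by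
      rw [(Finset.mem_filter.1 hk).2]
    -- `l` is the unit: the diagonal from `A i` to the product of copies of itself indexed by the
    -- fibre over `i`. An empty fibre causes no trouble, since the product is then terminal.
    choose l hl using fun i => h1 (fun k => A (π k)) i (A i) fun k hk => eqToHom (hπ i k hk)
    have e1 : (fun i => n (fun k => A (π k)) i fun k _ => x (π k)) =
        fun i => M.map (l i) (x i) := funext fun i => by
      refine h3 _ i _ _ fun k hk => ?_
      rw [hn, ← Functor.map_comp_apply, hl]
      obtain rfl := (Finset.mem_filter.1 hk).2
      exact (Functor.map_id_apply M _ _).symm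
    rw [e1]
    refine (hmk l _ x).symm.trans (congrArg (fun s => mk A s x) ?_)
    refine (Category.assoc _ _ _).symm.trans (Eq.trans ?_ (Category.id_comp s))
    refine congrArg (· ≫ s) ((E.map_comp _ _).symm.trans (Eq.trans ?_ (E.map_id _)))
    exact congrArg E.map (funext fun k => hl (π k) k (hm k))
  -- The other composite is pushed along the counit `P A`, which sends the tuple built from `x` back
  -- to `x`.
  · obtain ⟨A, s, x, rfl⟩ := Lan.exists_mk z
    refine (hf (A := c A) (E.map (P A) ≫ s) fun i => n A i fun k _ => x k).trans ?_
    refine (Lan.mk_map (F := E) (M := extProd fun _ : κ => M) (P A) s _).trans ?_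
    exact congrArg (fun x => Lan.mk (F := E) (M := extProd fun _ : κ => M) (c := A) s x)
      (funext fun k => hn A (π k) _ k (hm k))

end Products

/-! ## Restriction of the group on Burnside categories -/

lemma isPB_of_bijective {W U V T : Type u} {p : W → U} {q : W → V} {f : U → T} {g : V → T}
    (h : ∀ x, f (p x) = g (q x)) (hp : Function.Bijective p) (hg : Function.Bijective g) :
    IsPB p q f g := by
  refine ⟨h, fun a b hab => ?_⟩
  obtain ⟨x, rfl⟩ := hp.2 a
  exact ⟨x, ⟨rfl, hg.1 ((h x).symm.trans hab)⟩, fun y hy => hp.1 hy.1⟩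

section Restriction

variable {J G : Type} [Group J] [Group G]

/-- The restriction of a finite `G`-set along a homomorphism `J → G`. -/
def FinGSet.restr (ψ : J →* G) (X : FinGSet.{u} G) : FinGSet.{u} J :=
  letI : MulAction J X := MulAction.compHom X ψ
  ⟨X⟩

/-- A map of `G`-sets as a map of `J`-sets. -/
def restrMap (ψ : J →* G) {X Y : FinGSet.{u} G} (f : X →[G] Y) :
    FinGSet.restr ψ X →[J] FinGSet.restr ψ Y :=
  ⟨fun x => f x, fun j (x : X) => map_smul f (ψ j) x⟩

/-- Restriction from `G`-sets to `J`-sets. -/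
def restr (ψ : J →* G) : PBFunctor.{u} G J where
  obj := FinGSet.restr ψ
  map := restrMap ψ
  map_id _ := rfl
  map_comp _ _ := rfl
  map_pb _ _ _ _ h := h

/-- The restriction of a morphism of the Burnside category. -/
def restrHom (ψ : J →* G) {X Y : FinGSet.{u} G} (s : X ⟶ Y) :
    FinGSet.restr ψ X ⟶ FinGSet.restr ψ Y := (restr ψ).burnside.map s

lemma restrHom_tr (ψ : J →* G) {X Y : FinGSet.{u} G} (f : X →[G] Y) :
    restrHom ψ (tr f) = tr (restrMap ψ f) := (restr ψ).burnside_tr f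

lemma restrHom_res (ψ : J →* G) {X Y : FinGSet.{u} G} (f : X →[G] Y) :
    restrHom ψ (res f) = res (restrMap ψ f) := (restr ψ).burnside_res f

lemma restrHom_comp (ψ : J →* G) {X Y Z : FinGSet.{u} G} (s : X ⟶ Y) (t : Y ⟶ Z) :
    restrHom ψ (s ≫ t) = restrHom ψ s ≫ restrHom ψ t := (restr ψ).burnside.map_comp s t

lemma restrHom_prod (ψ : J →* G) {X X' Y Y' : FinGSet.{u} G} (s : X ⟶ X') (t : Y ⟶ Y') :
    restrHom ψ (burnsideProd s t) = burnsideProd (S := FinGSet.restr ψ X)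
      (S' := FinGSet.restr ψ X') (T := FinGSet.restr ψ Y) (T' := FinGSet.restr ψ Y')
      (restrHom ψ s) (restrHom ψ t) := by
  obtain ⟨U, rfl⟩ := exists_span s
  obtain ⟨V, rfl⟩ := exists_span t
  rfl

variable [Finite G]

/-- The map of `G`-sets induced by a map of `J`-sets. -/
def indMap (ψ : J →* G) (hψ : Function.Injective ψ) {S T : FinGSet.{u} J} (f : S →[J] T) :
    FinGSet.ind ψ S →[G] FinGSet.ind ψ T := (ind ψ hψ).map f

/-- Induction on morphisms of the Burnside category. -/
def indHom (ψ : J →* G) (hψ : Function.Injective ψ) {S T : FinGSet.{u} J} (s : S ⟶ T) :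
    FinGSet.ind ψ S ⟶ FinGSet.ind ψ T := (ind ψ hψ).burnside.map s

lemma indHom_tr (ψ : J →* G) (hψ : Function.Injective ψ) {S T : FinGSet.{u} J} (f : S →[J] T) :
    indHom ψ hψ (tr f) = tr (indMap ψ hψ f) := (ind ψ hψ).burnside_tr f

lemma indHom_res (ψ : J →* G) (hψ : Function.Injective ψ) {S T : FinGSet.{u} J} (f : S →[J] T) :
    indHom ψ hψ (res f) = res (indMap ψ hψ f) := (ind ψ hψ).burnside_res f

lemma indHom_comp (ψ : J →* G) (hψ : Function.Injective ψ) {S T W : FinGSet.{u} J} (s : S ⟶ T)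
    (t : T ⟶ W) : indHom ψ hψ (s ≫ t) = indHom ψ hψ s ≫ indHom ψ hψ t :=
  (ind ψ hψ).burnside.map_comp s t

/-- The map `T → G ×_J T` that sends `t` to `[1, t]`. -/
def indUnit (ψ : J →* G) (T : FinGSet.{u} J) : T →[J] FinGSet.restr ψ (FinGSet.ind ψ T) :=
  ⟨fun t => indMk ψ 1 t, fun j t => by
    refine Eq.symm ((indMk_eq ψ).2 ⟨j, ?_, rfl⟩)
    exact (mul_one _).trans (one_mul _).symm⟩

/-- The map `G ×_J X → X` that sends `[g, x]` to `g x`. -/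
def indCounit (ψ : J →* G) (X : FinGSet.{u} G) : FinGSet.ind ψ (FinGSet.restr ψ X) →[G] X :=
  ⟨Quotient.lift (fun p => p.1 • (show X from p.2)) (by
    rintro ⟨a, x⟩ ⟨b, y⟩ ⟨j, h1, h2⟩
    dsimp only at h1 h2
    subst h1 h2
    exact mul_smul b (ψ j) (show X from x)), by
    rintro g ⟨x⟩
    exact mul_smul g x.1 (show X from x.2)⟩

/-- `T` sits in `G ×_J T` as the part over the trivial coset, and a point `[g, s]` lies there
exactly when `g ∈ ψ(J)`. The square being cartesian, and not merely commutative, is what makes the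
unit natural for transfers. -/
lemma isPB_indUnit (ψ : J →* G) (hψ : Function.Injective ψ) {S T : FinGSet.{u} J} (f : S →[J] T) :
    IsPB (indUnit ψ S) f (restrMap ψ (indMap ψ hψ f)) (indUnit ψ T) := by
  refine ⟨fun _ => rfl, fun a b hab => ?_⟩
  obtain ⟨g, s, rfl⟩ := exists_indMk ψ a
  obtain ⟨j, h1, h2⟩ := (indMk_eq ψ).1 (show indMk ψ g (f s) = indMk ψ 1 b from hab)
  refine ⟨j • s, ⟨(indMk_eq ψ).2 ⟨j⁻¹, ?_, (inv_smul_smul j s).symm⟩, ?_⟩, ?_⟩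
  · rw [h1, map_inv]
    simp
  · rw [map_smul]
    exact h2.symm
  · rintro y ⟨hy1, -⟩
    obtain ⟨j', h3, h4⟩ := (indMk_eq ψ).1 (show indMk ψ 1 y = indMk ψ g s from hy1)
    -- Injectivity of `ψ` excludes a nontrivial stabilizer, so the point is unique.
    have : j * j' = 1 := hψ (by rw [map_mul, map_one, h3, h1, one_mul])
    rw [h4, smul_smul, this, one_smul]

/-- Given `[g, y]` and a point `a` over `g y`, the only candidate is `[g, g⁻¹ a]`. As for the unit,
cartesianness is needed for transfers. -/
lemma isPB_indCounit (ψ : J →* G) (hψ : Function.Injective ψ) {X Y : FinGSet.{u} G} (f : X →[G] Y) :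
    IsPB (indCounit ψ X) (indMap ψ hψ (restrMap ψ f)) f (indCounit ψ Y) := by
  refine ⟨?_, fun a b hab => ?_⟩
  · rintro ⟨g, x⟩
    exact map_smul f g (show X from x)
  · obtain ⟨g, y, rfl⟩ := exists_indMk ψ b
    have hab' : f a = g • (show Y from y) := hab
    obtain ⟨x, rfl⟩ : ∃ x : X, g • x = a := ⟨g⁻¹ • a, smul_inv_smul g a⟩
    have hy : f x = y := by
      rw [map_smul] at hab'
      exact MulAction.injective g hab'
    subst hy
    refine ⟨indMk ψ g (T := FinGSet.restr ψ X) x, ⟨rfl, rfl⟩, ?_⟩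
    rintro z ⟨hz1, hz2⟩
    obtain ⟨g', x', rfl⟩ := exists_indMk ψ z
    obtain ⟨j, h1, h2⟩ := (indMk_eq ψ).1 (show indMk ψ g' (T := FinGSet.restr ψ Y)
      (restrMap ψ f x') = indMk ψ g (T := FinGSet.restr ψ Y) (f x) from hz2)
    subst h1
    refine (indMk_eq ψ).2 ⟨j, rfl, ?_⟩
    have hz1' : (g * ψ j) • (show X from x') = g • x := hz1
    rw [mul_smul] at hz1'
    exact (MulAction.injective g hz1').symm

/-- A span is a restriction followed by a transfer. Restrictions commute with the unit by
functoriality, transfers by base change along its cartesian square. Since restricting along the unit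
reverses its direction, it becomes the counit of an adjunction in which restriction is the left
adjoint. -/
lemma restr_ind_naturality (ψ : J →* G) (hψ : Function.Injective ψ) {S T : FinGSet.{u} J}
    (s : S ⟶ T) : restrHom ψ (indHom ψ hψ s) ≫ res (indUnit ψ T) = res (indUnit ψ S) ≫ s := by
  obtain ⟨U, rfl⟩ := exists_span s
  rw [mk'_eq, indHom_comp, indHom_res, indHom_tr, restrHom_comp, restrHom_res, restrHom_tr,
    Category.assoc, base_change _ _ _ _ (isPB_indUnit ψ hψ U.r), ← Category.assoc,
    ← Category.assoc]
  exact congrArg (· ≫ tr U.r) (res2 fun _ => rfl)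

/-- The dual statement, again by base change for the transfer part; restriction along `indCounit`
serves as the unit of the adjunction on Burnside categories. -/
lemma ind_restr_naturality (ψ : J →* G) (hψ : Function.Injective ψ) {X Y : FinGSet.{u} G}
    (s : X ⟶ Y) :
    s ≫ res (indCounit ψ Y) = res (indCounit ψ X) ≫ indHom ψ hψ (restrHom ψ s) := by
  obtain ⟨U, rfl⟩ := exists_span s
  rw [mk'_eq, restrHom_comp, restrHom_res, restrHom_tr, indHom_comp, indHom_res, indHom_tr,
    Category.assoc, base_change _ _ _ _ (isPB_indCounit ψ hψ U.r), ← Category.assoc,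
    ← Category.assoc]
  refine congrArg (· ≫ tr _) (res2 ?_)
  rintro ⟨g, (x : U.apex)⟩
  exact map_smul U.l g x

/-- The bijection `Hom(X, G ×_J T) ≃ Hom(X, T)`. -/
def indHomEquiv (ψ : J →* G) (hψ : Function.Injective ψ) (X : FinGSet.{u} G) (T : FinGSet.{u} J) :
    (X ⟶ FinGSet.ind ψ T) ≃ (FinGSet.restr ψ X ⟶ T) where
  toFun s := restrHom ψ s ≫ res (indUnit ψ T)
  invFun s := res (indCounit ψ X) ≫ indHom ψ hψ s
  left_inv s := by
    change res (indCounit ψ X) ≫ indHom ψ hψ (restrHom ψ s ≫ res (indUnit ψ T)) = s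
    rw [indHom_comp, ← Category.assoc, ← ind_restr_naturality, indHom_res, Category.assoc,
      ← res_comp]
    -- A triangle identity, already true on finite sets: `[g, t] ↦ [g, [1, t]] ↦ [g · 1, t]`.
    refine Eq.trans (congrArg (s ≫ ·) ?_) (Category.comp_id s)
    refine (congrArg res (MulActionHom.ext ?_)).trans (res_id _)
    rintro ⟨g, t⟩
    exact congrArg (indMk ψ · t) (mul_one g)
  right_inv s := by
    change restrHom ψ (res (indCounit ψ X) ≫ indHom ψ hψ s) ≫ res (indUnit ψ T) = s
    rw [restrHom_comp, Category.assoc, restr_ind_naturality, restrHom_res, ← Category.assoc,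
      ← res_comp]
    -- The other triangle identity: `x ↦ [1, x] ↦ 1 · x`.
    refine Eq.trans (congrArg (· ≫ s) ?_) (Category.id_comp s)
    refine (congrArg res (MulActionHom.ext fun x => ?_)).trans (res_id _)
    exact one_smul G (show X from x)

end Restriction

/-! ## The double coset formula -/

section DoubleCoset

variable {K J G : Type} [Group K] [Group J] [CommGroup G] [Finite J] [Finite G]

/-- The map `F_K(G, A) → F_K(J, A)` that sends `f` to `j ↦ f (j c)`. -/
def cosetProj {φ : K →* J} {ψ : J →* G} {χ : K →* G} (hχ : ∀ k, χ k = ψ (φ k)) (c : G)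
    (A : FinGSet.{u} K) : FinGSet.restr ψ (FinGSet.coind χ A) →[J] FinGSet.coind φ A where
  toFun (f : FinGSet.coind χ A) := ⟨fun j => f.1 (ψ j * c), fun k j => by
    refine Eq.trans (congrArg f.1 ?_) (f.2 k _)
    rw [map_mul, hχ, mul_assoc]⟩
  -- Commutativity of `G` is used here: `J` acts by right translation, which has to be moved past
  -- the representative `c`.
  map_smul' j (f : FinGSet.coind χ A) := Subtype.ext (funext fun j' => by
    refine congrArg f.1 (a₁ := ψ j' * c * ψ j) (a₂ := ψ (j' * j) * c) ?_
    rw [map_mul, mul_right_comm])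

variable {ι κ : Type} [Finite ι] [Finite κ]

/-- For each `i`, the `c k` with `π k = i` are representatives of the cosets of the image
of `ψ`. -/
def IsCosetFamily (ψ : J →* G) (π : κ → ι) (c : κ → G) : Prop :=
  ∀ (i : ι) (x : G), ∃! p : J × κ, π p.2 = i ∧ ψ p.1 * c p.2 = x

/-- The map `∏ᵢ F_K(G, Aᵢ) → ∏ₖ F_K(J, A_{π k})`, whose components are given by `cosetProj`. -/
def cosetMap {φ : K →* J} {ψ : J →* G} {χ : K →* G} (hχ : ∀ k, χ k = ψ (φ k)) (π : κ → ι)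
    (c : κ → G) (A : ι → FinGSet.{u} K) :
    FinGSet.restr ψ (FinGSet.pi fun i => FinGSet.coind χ (A i)) →[J]
      FinGSet.pi fun k => FinGSet.coind φ (A (π k)) :=
  FinGSet.piLift fun k => (cosetProj hχ (c k) (A (π k))).comp
    (restrMap ψ (FinGSet.proj (fun i => FinGSet.coind χ (A i)) (π k)))

/-- Each copy of `G` is the disjoint union of the cosets `ψ(J) c k` with `π k = i`, and left
multiplication by `K` preserves each of them. A `K`-equivariant function on `G` therefore amounts to
an independent family of `K`-equivariant functions on `J`. -/
lemma cosetMap_bijective {φ : K →* J} {ψ : J →* G} {χ : K →* G} (hχ : ∀ k, χ k = ψ (φ k))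
    {π : κ → ι} {c : κ → G} (hc : IsCosetFamily ψ π c) (A : ι → FinGSet.{u} K) :
    Function.Bijective (cosetMap hχ π c A) := by
  refine ⟨fun (f f' : FinGSet.pi fun i => FinGSet.coind χ (A i)) h =>
    funext fun i => Subtype.ext (funext fun x => ?_), fun y => ?_⟩
  · obtain ⟨⟨j, k⟩, ⟨rfl, rfl⟩, -⟩ := hc i x
    exact congrFun (congrArg Subtype.val (congrFun h k)) j
  -- The value at `x` is read off from the unique decomposition `x = ψ j * c k`. It lives in `A (π
  -- k)` and is transported to `A i`; requiring agreement for every decomposition avoids carrying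
  -- the chosen one along.
  · have hex : ∀ i x, ∃ a : A i, ∀ j k (h : π k = i), ψ j * c k = x → h ▸ (y k).1 j = a := by
      intro i x
      obtain ⟨⟨j, k⟩, ⟨rfl, rfl⟩, hu⟩ := hc i x
      refine ⟨(y k).1 j, fun j' k' h h' => ?_⟩
      cases hu (j', k') ⟨h, h'⟩
      rfl
    choose a ha using hex
    refine ⟨(show FinGSet.pi fun i => FinGSet.coind χ (A i) from
      fun i => ⟨a i, fun k₀ x => ?_⟩), funext fun k => Subtype.ext (funext fun j => ?_)⟩
    -- Multiplying by `χ k₀` on the left keeps the coset and replaces `j` by `φ k₀ * j`, so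
    -- equivariance reduces to that of `y k`.
    · obtain ⟨⟨j, k⟩, ⟨rfl, rfl⟩, -⟩ := hc i x
      refine (ha _ _ (φ k₀ * j) k rfl ?_).symm.trans (((y k).2 k₀ j).trans
        (congrArg (k₀ • ·) (ha _ _ j k rfl rfl)))
      rw [map_mul, hχ, mul_assoc]
    · exact (ha _ _ j k rfl rfl).symm

/-- The splitting is natural for maps of finite sets and bijective on sources, targets and apices of
spans, hence natural for spans. -/
lemma cosetMap_naturality {φ : K →* J} {ψ : J →* G} {χ : K →* G} (hχ : ∀ k, χ k = ψ (φ k))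
    {π : κ → ι} {c : κ → G} (hc : IsCosetFamily ψ π c) {A A' : ι → FinGSet.{u} K}
    (v : ∀ i, A i ⟶ A' i) :
    restrHom ψ (burnsidePi fun i => coindHom χ (v i)) ≫ tr (cosetMap hχ π c A') =
      tr (cosetMap hχ π c A) ≫ burnsidePi fun k => coindHom φ (v (π k)) := by
  obtain ⟨U, hU⟩ : ∃ U : ∀ i, GSpan (A i) (A' i), v = fun i => (U i).mk' :=
    ⟨fun i => (exists_span (v i)).choose, funext fun i => (exists_span (v i)).choose_spec⟩
  subst hU
  rw [show (burnsidePi fun i => coindHom χ (U i).mk') = _ from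
    burnsidePi_mk' fun i => (coind χ).span (U i),
    show (burnsidePi fun k => coindHom φ (U (π k)).mk') = _ from
    burnsidePi_mk' fun k => (coind φ).span (U (π k))]
  exact tr_square ((restr ψ).span (GSpan.pi fun i => (coind χ).span (U i)))
    (GSpan.pi fun k => (coind φ).span (U (π k))) _ _ (cosetMap hχ π c fun i => (U i).apex)
    (cosetMap_bijective hχ hc A) (cosetMap_bijective hχ hc _) (fun _ => rfl) (fun _ => rfl)

/-- The transfer and the restriction along a bijection are mutually inverse, so the naturality
square may be turned around. -/
lemma cosetMap_naturality_res {φ : K →* J} {ψ : J →* G} {χ : K →* G} (hχ : ∀ k, χ k = ψ (φ k))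
    {π : κ → ι} {c : κ → G} (hc : IsCosetFamily ψ π c) {A A' : ι → FinGSet.{u} K}
    (v : ∀ i, A i ⟶ A' i) :
    res (cosetMap hχ π c A) ≫ restrHom ψ (burnsidePi fun i => coindHom χ (v i)) =
      (burnsidePi fun k => coindHom φ (v (π k))) ≫ res (cosetMap hχ π c A') := by
  have h := congrArg (fun t => res (cosetMap hχ π c A) ≫ t ≫ res (cosetMap hχ π c A'))
    (cosetMap_naturality hχ hc v)
  simp only [Category.assoc, (tr_res_of_bij _ (cosetMap_bijective hχ hc A')).1,
    Category.comp_id] at h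
  rw [h, ← Category.assoc, (tr_res_of_bij _ (cosetMap_bijective hχ hc A)).2, Category.id_comp]

/-- The bijection `Hom(∏ᵢ F_K(G, Aᵢ), G ×_J T) ≃ Hom(∏ₖ F_K(J, A_{π k}), T)`. -/
noncomputable def cosetHomEquiv {φ : K →* J} {ψ : J →* G} {χ : K →* G} (hχ : ∀ k, χ k = ψ (φ k))
    (hψ : Function.Injective ψ) {π : κ → ι} {c : κ → G} (hc : IsCosetFamily ψ π c)
    (A : ι → FinGSet.{u} K) (T : FinGSet.{u} J) :
    ((FinGSet.pi fun i => FinGSet.coind χ (A i)) ⟶ FinGSet.ind ψ T) ≃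
      ((FinGSet.pi fun k => FinGSet.coind φ (A (π k))) ⟶ T) :=
  (indHomEquiv ψ hψ _ T).trans
    { toFun := fun s => res (cosetMap hχ π c A) ≫ s
      invFun := fun s => tr (cosetMap hχ π c A) ≫ s
      left_inv := fun s => by
        change tr _ ≫ res _ ≫ s = s
        rw [← Category.assoc, (tr_res_of_bij _ (cosetMap_bijective hχ hc A)).1, Category.id_comp]
      right_inv := fun s => by
        change res _ ≫ tr _ ≫ s = s
        rw [← Category.assoc, (tr_res_of_bij _ (cosetMap_bijective hχ hc A)).2,
          Category.id_comp] }

lemma cosetHomEquiv_apply {φ : K →* J} {ψ : J →* G} {χ : K →* G} (hχ : ∀ k, χ k = ψ (φ k))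
    (hψ : Function.Injective ψ) {π : κ → ι} {c : κ → G} (hc : IsCosetFamily ψ π c)
    (A : ι → FinGSet.{u} K) (T : FinGSet.{u} J)
    (s : (FinGSet.pi fun i => FinGSet.coind χ (A i)) ⟶ FinGSet.ind ψ T) :
    cosetHomEquiv hχ hψ hc A T s =
      res (cosetMap hχ π c A) ≫ restrHom ψ s ≫ res (indUnit ψ T) := rfl

lemma cosetHomEquiv_naturality {φ : K →* J} {ψ : J →* G} {χ : K →* G} (hχ : ∀ k, χ k = ψ (φ k))
    (hψ : Function.Injective ψ) {π : κ → ι} {c : κ → G} (hc : IsCosetFamily ψ π c)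
    {A A' : ι → FinGSet.{u} K} (T : FinGSet.{u} J) (v : ∀ i, A i ⟶ A' i)
    (s : (FinGSet.pi fun i => FinGSet.coind χ (A' i)) ⟶ FinGSet.ind ψ T) :
    cosetHomEquiv hχ hψ hc A T (burnsidePi (fun i => coindHom χ (v i)) ≫ s) =
      burnsidePi (fun k => coindHom φ (v (π k))) ≫ cosetHomEquiv hχ hψ hc A' T s := by
  rw [cosetHomEquiv_apply, cosetHomEquiv_apply, restrHom_comp, Category.assoc, ← Category.assoc,
    cosetMap_naturality_res hχ hc, Category.assoc]

end DoubleCoset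

/-! ## Generators of box powers of norms -/

section NormElt

variable {K G : Type} [Group K] [CommGroup G] [Finite G] (χ : K →* G) (R : CommGreen.{u} K)

/-- The image of `x ∈ R(A)` under the universal map `R(A) → (N_K^G R)(F_K(G, A))`. -/
def normElt {A : FinGSet.{u} K} (x : R.fn.obj A) :
    ((norm χ).obj R).fn.obj (FinGSet.coind χ A) := normMk χ (M := R.fn) (𝟙 _) x

lemma exists_normElt {T : FinGSet.{u} G} (m : ((norm χ).obj R).fn.obj T) :
    ∃ (A : FinGSet.{u} K) (s : FinGSet.coind χ A ⟶ T) (x : R.fn.obj A),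
      m = ((norm χ).obj R).fn.map s (normElt χ R x) := by
  obtain ⟨A, s, x, rfl⟩ := exists_normMk χ (M := R.fn) m
  exact ⟨A, s, x, congrArg (fun s => normMk χ (M := R.fn) s x) (Category.id_comp s).symm⟩

lemma normElt_map {A A' : FinGSet.{u} K} (v : A ⟶ A') (x : R.fn.obj A) :
    ((norm χ).obj R).fn.map (coindHom χ v) (normElt χ R x) = normElt χ R (R.fn.map v x) := by
  refine Eq.trans ?_ (normMk_map χ (M := R.fn) v (𝟙 _) x)
  exact congrArg (fun s => normMk χ (M := R.fn) s x)
    ((Category.id_comp (coindHom χ v)).trans (Category.comp_id _).symm)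

/-- The map `F_K(G, A × B) → F_K(G, A) × F_K(G, B)`. -/
def coindProd (A B : FinGSet.{u} K) :
    FinGSet.coind χ (A.prod B) →[G] (FinGSet.coind χ A).prod (FinGSet.coind χ B) :=
  FinGSet.prodLift ((coind χ).map (FinGSet.fst A B)) ((coind χ).map (FinGSet.snd A B))

lemma normElt_mul {A B : FinGSet.{u} K} (x : R.fn.obj A) (y : R.fn.obj B) :
    ((norm χ).obj R).pairing.mul (normElt χ R x) (normElt χ R y) =
      ((norm χ).obj R).fn.map (tr (coindProd χ A B)) (normElt χ R (R.pairing.mul x y)) := by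
  refine congrArg (fun s => normMk χ (M := R.fn) s (R.pairing.mul x y)) (Eq.trans ?_
    (Category.id_comp _).symm)
  exact Category.comp_id (tr (coindProd χ A B))

lemma normElt_one : ((norm χ).obj R).pairing.one =
    ((norm χ).obj R).fn.map (tr (FinGSet.toPt _)) (normElt χ R R.pairing.one) :=
  congrArg (fun s => normMk χ (M := R.fn) s R.pairing.one) (Category.id_comp _).symm

/-- Coinduction of a point is a point, so the universal element on `1` is the unit. This lets
trivial tensor factors be presented as universal elements too. -/
lemma res_normElt_one {U : FinGSet.{u} G} (f : U →[G] FinGSet.coind χ (FinGSet.pt K)) :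
    ((norm χ).obj R).fn.map (res f) (normElt χ R R.pairing.one) = 1 := by
  have hb : Function.Bijective (FinGSet.toPt (FinGSet.coind χ (FinGSet.pt.{u} K))) :=
    ⟨fun _ _ _ => Subtype.ext (funext fun _ => rfl), fun x => ⟨⟨fun _ => x, fun _ _ => rfl⟩, rfl⟩⟩
  have h : ((norm χ).obj R).fn.map (res (FinGSet.toPt _)) ((norm χ).obj R).pairing.one =
      normElt χ R R.pairing.one := by
    rw [normElt_one]
    refine (Functor.map_comp_apply _ _ _ _).symm.trans ?_
    refine (congrArg (fun t => ((norm χ).obj R).fn.map t (normElt χ R R.pairing.one))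
      (tr_res_of_bij _ hb).1).trans ?_
    exact Functor.map_id_apply ((norm χ).obj R).fn _ _
  rw [← h]
  exact ((norm χ).obj R).res_apply_comp (fun _ => rfl) _

variable {ι : Type} [Finite ι]

/-- The element of `(N_K^G R)^{□ι}(T)` represented by `s : ∏ᵢ F_K(G, Aᵢ) ⟶ T` and
`(xᵢ)ᵢ ∈ ∏ᵢ R(Aᵢ)`. -/
noncomputable def normBoxElt {A : ι → FinGSet.{u} K} {T : FinGSet.{u} G}
    (s : FinGSet.pi (fun i => FinGSet.coind χ (A i)) ⟶ T) (x : ∀ i, R.fn.obj (A i)) :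
    (box fun _ : ι => ((norm χ).obj R).fn).obj T :=
  ((norm χ).obj R).bmk s fun i => normElt χ R (x i)

lemma map_normBoxElt {A : ι → FinGSet.{u} K} {T T' : FinGSet.{u} G}
    (s : FinGSet.pi (fun i => FinGSet.coind χ (A i)) ⟶ T) (t : T ⟶ T') (x : ∀ i, R.fn.obj (A i)) :
    (box fun _ : ι => ((norm χ).obj R).fn).map t (normBoxElt χ R s x) =
      normBoxElt χ R (s ≫ t) x := rfl

lemma normBoxElt_eq {A : ι → FinGSet.{u} K} {T : FinGSet.{u} G}
    (s : FinGSet.pi (fun i => FinGSet.coind χ (A i)) ⟶ T) (x : ∀ i, R.fn.obj (A i)) :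
    (normBox χ ι R.fn).app T (coindPiMk χ s x) = normBoxElt χ R s x :=
  normBox_mk χ s x

/-- The surjective half of `normBox_bijective`: elements of a box power of norms have presentations
by universal elements alone, on which all later formulas are checked. -/
lemma exists_normBoxElt {T : FinGSet.{u} G} (y : (box fun _ : ι => ((norm χ).obj R).fn).obj T) :
    ∃ (A : ι → FinGSet.{u} K) (s : FinGSet.pi (fun i => FinGSet.coind χ (A i)) ⟶ T)
      (x : ∀ i, R.fn.obj (A i)), y = normBoxElt χ R s x := by
  obtain ⟨z, rfl⟩ := (normBox_bijective χ ι R.fn T).2 y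
  obtain ⟨A, s, x, rfl⟩ := Lan.exists_mk z
  exact ⟨A, s, x, normBoxElt_eq χ R s x⟩

/-- The map `∏ᵢ F_K(G, Aᵢ × Bᵢ) → ∏ᵢ F_K(G, Aᵢ) × ∏ᵢ F_K(G, Bᵢ)`. -/
def coindPiProd (A B : ι → FinGSet.{u} K) :
    (FinGSet.pi fun i => FinGSet.coind χ ((A i).prod (B i))) →[G]
      (FinGSet.pi fun i => FinGSet.coind χ (A i)).prod
        (FinGSet.pi fun i => FinGSet.coind χ (B i)) :=
  FinGSet.prodLift
    (FinGSet.piMap fun i => (coind χ).map (FinGSet.fst (A i) (B i)))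
    (FinGSet.piMap fun i => (coind χ).map (FinGSet.snd (A i) (B i)))

variable [Nonempty ι]

/-- Both the product over `ι` and coinduction are monoidal; the two comparison maps compose to
`coindPiProd` once the transfers in the single factors are moved into the outer morphism. -/
lemma normBoxElt_mul {A B : ι → FinGSet.{u} K} {T T' : FinGSet.{u} G}
    (s : FinGSet.pi (fun i => FinGSet.coind χ (A i)) ⟶ T)
    (t : FinGSet.pi (fun i => FinGSet.coind χ (B i)) ⟶ T') (x : ∀ i, R.fn.obj (A i))
    (y : ∀ i, R.fn.obj (B i)) :
    (boxPow ((norm χ).obj R) ι).pairing.mul (normBoxElt χ R s x) (normBoxElt χ R t y) =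
      normBoxElt χ R (tr (coindPiProd χ A B) ≫ burnsideProd s t)
        fun i => R.pairing.mul (x i) (y i) := by
  let P := (norm χ).obj R
  let d := FinGSet.prodLift
    (FinGSet.piMap fun i => FinGSet.fst (FinGSet.coind χ (A i)) (FinGSet.coind χ (B i)))
    (FinGSet.piMap fun i => FinGSet.snd (FinGSet.coind χ (A i)) (FinGSet.coind χ (B i)))
  have h : P.bmk (tr d ≫ burnsideProd s t)
      (fun i => P.fn.map (tr (coindProd χ (A i) (B i))) (normElt χ R (R.pairing.mul (x i) (y i)))) =
      normBoxElt χ R (tr (coindPiProd χ A B) ≫ burnsideProd s t)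
        fun i => R.pairing.mul (x i) (y i) := by
    rw [← P.bmk_pi, burnsidePi_tr, ← Category.assoc, ← tr_comp]
    rfl
  refine Eq.trans ?_ h
  exact congrArg (P.bmk (tr d ≫ burnsideProd s t)) (funext fun i => normElt_mul χ R (x i) (y i))

lemma normBoxElt_one : (boxPow ((norm χ).obj R) ι).pairing.one =
    normBoxElt χ R (tr (FinGSet.toPt _)) fun _ : ι => R.pairing.one := by
  let P := (norm χ).obj R
  have h : P.bmk (tr (FinGSet.toPt (FinGSet.pi fun _ : ι => FinGSet.pt.{u} G)))
      (fun i => P.fn.map (tr (FinGSet.toPt _)) (normElt χ R R.pairing.one)) =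
      normBoxElt χ R (tr (FinGSet.toPt _)) fun _ : ι => R.pairing.one := by
    rw [← P.bmk_pi, burnsidePi_tr, ← tr_comp]
    rfl
  refine Eq.trans ?_ h
  exact congrArg (P.bmk (tr (FinGSet.toPt (FinGSet.pi fun _ : ι => FinGSet.pt.{u} G))))
    (funext fun i => normElt_one χ R)

end NormElt

/-! ## The comparison map -/

section Comparison

variable {K J G : Type} [Group K] [CommGroup J] [CommGroup G] [Finite J] [Finite G]
  {ι κ : Type} [Finite ι] [Finite κ] {φ : K →* J} {ψ : J →* G} {χ : K →* G}
  (hχ : ∀ k, χ k = ψ (φ k)) (hψ : Function.Injective ψ) {π : κ → ι} {c : κ → G}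
  (hc : IsCosetFamily ψ π c) (R : CommGreen.{u} K)

/-- The comparison map on representatives. -/
noncomputable def cosetFun (T : FinGSet.{u} J)
    (y : (Lan (coindPi χ ι) (extProd fun _ : ι => R.fn)).obj (FinGSet.ind ψ T)) :
    (box fun _ : κ => ((norm φ).obj R).fn).obj T :=
  Lan.elim (F := coindPi χ ι) (M := extProd fun _ : ι => R.fn)
    (fun {A} s x => normBoxElt φ R (A := fun k => A (π k)) (cosetHomEquiv hχ hψ hc A T s)
      fun k => x (π k)) (by
    intro A A' v s x
    refine (congrArg (fun s => normBoxElt φ R s fun k => x (π k))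
      (cosetHomEquiv_naturality hχ hψ hc T v s)).trans ?_
    refine (((norm φ).obj R).bmk_pi (fun k => coindHom φ (v (π k))) _ _).trans ?_
    exact congrArg (((norm φ).obj R).bmk _) (funext fun k => normElt_map φ R _ _)) y

/-- Three bijections are composed: the adjunction with the coset splitting, extension along the
diagonal given by `π`, and the recombination into a box power of norms. -/
lemma cosetFun_bijective (T : FinGSet.{u} J) : Function.Bijective (cosetFun hχ hψ hc R T) := by
  let F := Pi.comap (fun _ : ι => FinGSet.{u} K) π ⋙ coindPi φ κ
  let f1 : (Lan (coindPi χ ι) (extProd fun _ : ι => R.fn)).obj (FinGSet.ind ψ T) →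
      (Lan F (extProd fun _ : ι => R.fn)).obj T :=
    Lan.elim (F := coindPi χ ι) (M := extProd fun _ : ι => R.fn)
      (fun {A} s x => Lan.mk (F := F) (M := extProd fun _ : ι => R.fn) (c := A)
        (cosetHomEquiv hχ hψ hc A T s) x) (by
      intro A A' v s x
      refine (congrArg (fun s => Lan.mk (F := F) (M := extProd fun _ : ι => R.fn) (c := A) s x)
        (cosetHomEquiv_naturality hχ hψ hc T v s)).trans ?_
      exact Lan.mk_map (F := F) (M := extProd fun _ : ι => R.fn) v _ x)
  -- Only the outer morphism changes here; the coefficients in `∏ᵢ R(Aᵢ)` stay as they are.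
  have h1 : Function.Bijective f1 := Lan.bijective_of_homEquiv (F := coindPi χ ι) (F' := F)
    (M := extProd fun _ : ι => R.fn)
    (fun A => cosetHomEquiv hχ hψ hc A T) (fun v s => cosetHomEquiv_naturality hχ hψ hc T v s) f1
    (fun s m => rfl)
  let f2 : (Lan F (extProd fun _ : ι => R.fn)).obj T →
      (Lan (coindPi φ κ) (extProd fun _ : κ => R.fn)).obj T :=
    Lan.elim (F := F) (M := extProd fun _ : ι => R.fn)
      (fun {A} s x => coindPiMk φ (A := fun k => A (π k)) s fun k => x (π k)) (by
      intro A A' v s x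
      exact coindPiMk_map φ (A := fun k => A (π k)) (A' := fun k => A' (π k))
        (fun k => v (π k)) s fun k => x (π k))
  -- Here the coefficients are repeated along `π`, which is where `R` being product-preserving
  -- enters.
  have h2 : Function.Bijective f2 := Lan.comap_bijective R.mack.property.choose π (coindPi φ κ) T f2
    (fun s x => rfl)
  refine (congrArg Function.Bijective (funext fun y => ?_)).mp
    ((normBox_bijective φ κ R.fn T).comp (h2.comp h1))
  obtain ⟨A, s, x, rfl⟩ := Lan.exists_mk y
  exact normBoxElt_eq φ R _ _

/-- The comparison map `i_J^* (N_K^G R)^{□ι} → (N_K^J R)^{□κ}`. -/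
noncomputable def cosetApp (T : FinGSet.{u} J)
    (y : (box fun _ : ι => ((norm χ).obj R).fn).obj (FinGSet.ind ψ T)) :
    (box fun _ : κ => ((norm φ).obj R).fn).obj T :=
  cosetFun hχ hψ hc R T ((Equiv.ofBijective _ (normBox_bijective χ ι R.fn _)).symm y)

lemma cosetApp_bijective (T : FinGSet.{u} J) : Function.Bijective (cosetApp hχ hψ hc R T) :=
  (cosetFun_bijective hχ hψ hc R T).comp (Equiv.bijective _)

lemma cosetApp_normBoxElt {A : ι → FinGSet.{u} K} {T : FinGSet.{u} J}
    (s : FinGSet.pi (fun i => FinGSet.coind χ (A i)) ⟶ FinGSet.ind ψ T)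
    (x : ∀ i, R.fn.obj (A i)) : cosetApp hχ hψ hc R T (normBoxElt χ R s x) =
      normBoxElt φ R (res (cosetMap hχ π c A) ≫ restrHom ψ s ≫ res (indUnit ψ T))
        fun k => x (π k) := by
  have h : (Equiv.ofBijective _ (normBox_bijective χ ι R.fn _)).symm (normBoxElt χ R s x) =
      coindPiMk χ s x := by
    exact (Equiv.symm_apply_eq _).2 (normBoxElt_eq χ R s x).symm
  exact congrArg (cosetFun hχ hψ hc R T) h

/-- The comparison map as a natural transformation. -/
noncomputable def cosetNat : resFn ψ hψ (box fun _ : ι => ((norm χ).obj R).fn) ⟶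
    box fun _ : κ => ((norm φ).obj R).fn where
  app T := ↾cosetApp hχ hψ hc R T
  naturality T T' t := by
    ext y
    obtain ⟨A, s, x, rfl⟩ := exists_normBoxElt χ R (T := FinGSet.ind ψ T) y
    change cosetApp hχ hψ hc R T' ((box fun _ : ι => ((norm χ).obj R).fn).map (indHom ψ hψ t)
      (normBoxElt χ R s x)) = (box fun _ : κ => ((norm φ).obj R).fn).map t
        (cosetApp hχ hψ hc R T (normBoxElt χ R s x))
    -- On presentations by universal elements, naturality in `T` is that of the unit `T → G ×_J T`.
    rw [map_normBoxElt, cosetApp_normBoxElt, cosetApp_normBoxElt, map_normBoxElt, restrHom_comp,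
      Category.assoc, Category.assoc, Category.assoc, restr_ind_naturality]

/-- Pure pasting of diagrams, isolated to keep the multiplicativity argument readable. -/
lemma comp_eq_of_squares {C : Type*} [Category C] {X Y Y' Z W V T : C} {a : X ⟶ Y} {b : Y ⟶ Z}
    {m m' : Z ⟶ W} {r : W ⟶ V} {v : V ⟶ T} {w : W ⟶ T} {a' : X ⟶ Y'} {b' : Y' ⟶ Z}
    (h1 : a ≫ b = a' ≫ b') (hm : m = m') (h2 : r ≫ v = w) :
    a ≫ ((b ≫ m) ≫ r) ≫ v = a' ≫ b' ≫ m' ≫ w := by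
  subst hm h2
  simp only [Category.assoc]
  rw [← Category.assoc, h1, Category.assoc]

/-- The comparison map as a morphism of Green functors. -/
noncomputable def cosetHom [Nonempty ι] [Nonempty κ] :
    (restrict ψ hψ).obj (boxPow ((norm χ).obj R) ι) ⟶ boxPow ((norm φ).obj R) κ :=
  { nat := cosetNat hχ hψ hc R
    map_mul := by
      intro S T X Y
      obtain ⟨A, s, x, rfl⟩ := exists_normBoxElt χ R (T := FinGSet.ind ψ S) X
      obtain ⟨B, t, y, rfl⟩ := exists_normBoxElt χ R (T := FinGSet.ind ψ T) Y
      -- The product of `i_J^*` restricts an external product along this map, by the lax structure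
      -- of induction.
      let γ := FinGSet.prodLift (indMap ψ hψ (FinGSet.fst S T)) (indMap ψ hψ (FinGSet.snd S T))
      change cosetApp hχ hψ hc R _ ((box fun _ : ι => ((norm χ).obj R).fn).map (res γ)
        ((boxPow ((norm χ).obj R) ι).pairing.mul (normBoxElt χ R s x) (normBoxElt χ R t y))) =
        (boxPow ((norm φ).obj R) κ).pairing.mul (cosetApp hχ hψ hc R _ (normBoxElt χ R s x))
          (cosetApp hχ hψ hc R _ (normBoxElt χ R t y))
      rw [normBoxElt_mul, map_normBoxElt, cosetApp_normBoxElt, cosetApp_normBoxElt,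
        cosetApp_normBoxElt, normBoxElt_mul]
      refine congrArg (fun s => normBoxElt φ R s fun k => R.pairing.mul (x (π k)) (y (π k))) ?_
      -- The coset splitting is compatible with products of `K`-sets. Both coset maps in this square
      -- are bijective, so it is a pullback and base change applies.
      have h1 : res (cosetMap hχ π c fun i => (A i).prod (B i)) ≫
          tr (restrMap ψ (coindPiProd χ A B)) =
          tr (coindPiProd φ (fun k => A (π k)) fun k => B (π k)) ≫
            res (FinGSet.prodMap (cosetMap hχ π c A) (cosetMap hχ π c B)) :=
        (base_change (cosetMap hχ π c fun i => (A i).prod (B i)) (restrMap ψ (coindPiProd χ A B))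
          (coindPiProd φ (fun k => A (π k)) fun k => B (π k))
          (FinGSet.prodMap (cosetMap hχ π c A) (cosetMap hχ π c B))
          (isPB_of_bijective (fun _ => rfl) (cosetMap_bijective hχ hc _)
          (prodMap_bij (cosetMap_bijective hχ hc A) (cosetMap_bijective hχ hc B)))).symm
      have h2 : res (restrMap ψ γ) ≫ res (indUnit ψ (S.prod T)) =
          res (FinGSet.prodMap (indUnit ψ S) (indUnit ψ T)) := by
        rw [← res_comp]
        rfl
      have h3 : restrHom ψ ((tr (coindPiProd χ A B) ≫ burnsideProd s t) ≫ res γ) =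
          (tr (restrMap ψ (coindPiProd χ A B)) ≫ restrHom ψ (burnsideProd s t)) ≫
            res (restrMap ψ γ) := by
        rw [restrHom_comp, restrHom_comp, restrHom_tr, restrHom_res]
      rw [burnsideProd_comp, burnsideProd_comp, burnsideProd_res, burnsideProd_res]
      refine (congrArg (fun t => res _ ≫ t ≫ res _) h3).trans ?_
      exact comp_eq_of_squares h1 (restrHom_prod ψ s t) h2
    map_one := by
      let γ := FinGSet.toPt (FinGSet.ind ψ (FinGSet.pt.{u} J))
      change cosetApp hχ hψ hc R _ ((box fun _ : ι => ((norm χ).obj R).fn).map (res γ)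
        (boxPow ((norm χ).obj R) ι).pairing.one) = (boxPow ((norm φ).obj R) κ).pairing.one
      rw [normBoxElt_one, map_normBoxElt, cosetApp_normBoxElt, normBoxElt_one]
      refine congrArg (fun s => normBoxElt φ R s fun k => R.pairing.one) ?_
      -- For the unit all coinduced sets are points, and the corresponding square is again a
      -- pullback of bijections.
      have h1 : res (cosetMap hχ π c fun _ => FinGSet.pt.{u} K) ≫
          tr (restrMap ψ (FinGSet.toPt (FinGSet.pi fun _ : ι => FinGSet.coind χ (FinGSet.pt K)))) =
          tr (FinGSet.toPt _) :=
        (base_change (cosetMap hχ π c fun _ => FinGSet.pt.{u} K)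
          (restrMap ψ (FinGSet.toPt (FinGSet.pi fun _ : ι => FinGSet.coind χ (FinGSet.pt K))))
          (FinGSet.toPt _) (.id J) (isPB_of_bijective (fun _ => rfl)
          (cosetMap_bijective hχ hc _) Function.bijective_id)).symm.trans (Category.comp_id _)
      have h2 : res (restrMap ψ γ) ≫ res (indUnit ψ (FinGSet.pt J)) = 𝟙 (FinGSet.pt J) := by
        rw [← res_comp]
        rfl
      rw [restrHom_comp, restrHom_tr, restrHom_res, Category.assoc]
      refine (congrArg (fun t => res _ ≫ tr _ ≫ t) h2).trans ?_
      exact (congrArg (_ ≫ ·) (Category.comp_id _)).trans h1 }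

end Comparison

/-! ## Products of pure tensors -/

namespace CommGreen

section

variable {G : Type} [CommGroup G] (R : CommGreen.{u} G) {ι κ : Type}

/-- The pure tensors `⊗ᵢ bᵢ` depend multiplicatively on `b`. -/
noncomputable def pureHom (ι : Type) [Finite ι] [Nonempty ι] (U : FinGSet.{u} G) :
    (ι → R.fn.obj U) →* (boxPow R ι).fn.obj U where
  toFun b := R.pure b
  map_one' := by
    refine Eq.symm ((congrArg ((box fun _ : ι => R.fn).map (res (FinGSet.toPt U)))
      R.boxPow_one).trans ?_)
    exact R.pure_res _ _
  map_mul' b c := by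
    refine Eq.symm ((congrArg ((box fun _ : ι => R.fn).map (res (diag U)))
      (R.boxPow_mul b c)).trans ?_)
    exact R.pure_res _ _

/-- Restriction preserves the unit factors. For the transfer, these factors are restrictions of
units, so Frobenius reciprocity puts the whole transfer on the remaining factor. -/
lemma map_pure_mulSingle [Finite ι] [DecidableEq ι] {U V : FinGSet.{u} G} (s : U ⟶ V) (i : ι)
    (b : R.fn.obj U) : (box fun _ : ι => R.fn).map s (R.pure (Pi.mulSingle i b)) =
      R.pure (Pi.mulSingle i (R.fn.map s b)) := by
  obtain ⟨W, rfl⟩ := exists_span s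
  rw [mk'_eq, Functor.map_comp_apply, Functor.map_comp_apply, pure_res]
  have h : (fun k => R.resHom W.l ((Pi.mulSingle i b : ι → R.fn.obj U) k)) =
      Pi.mulSingle i (R.resHom W.l b) :=
    funext fun k => Pi.apply_mulSingle (fun _ => R.resHom W.l) (fun _ => map_one _) i b k
  rw [h]
  refine R.pure_tr W.r _ _ i ?_ fun k hk => ?_
  · rw [Pi.mulSingle_eq_same, Pi.mulSingle_eq_same]
    rfl
  · rw [Pi.mulSingle_eq_of_ne hk, Pi.mulSingle_eq_of_ne hk, map_one]

/-- The group acts by multiplicative maps, so all unit factors drop out of the fibrewise products.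
-/
lemma comb_mulSingle [Fintype ι] [DecidableEq ι] [DecidableEq κ] (φ : ι → κ) (γ : ι → G)
    {U : FinGSet.{u} G} (i : ι) (b : R.fn.obj U) :
    R.comb φ γ (Pi.mulSingle i b) = Pi.mulSingle (φ i) (R.act (γ i) U b) := by
  funext k
  have h : ∀ i', i' ≠ i → R.act (γ i') U ((Pi.mulSingle i b : ι → R.fn.obj U) i') = 1 :=
    fun i' hi' => by rw [Pi.mulSingle_eq_of_ne hi', map_one]
  rw [comb]
  by_cases hk : φ i = k
  · subst hk
    rw [Finset.prod_eq_single i (fun i' _ => h i') (by simp), Pi.mulSingle_eq_same,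
      Pi.mulSingle_eq_same]
  · rw [Pi.mulSingle_eq_of_ne (Ne.symm hk)]
    refine Finset.prod_eq_one fun i' hi' => h i' ?_
    rintro rfl
    exact hk (Finset.mem_filter.1 hi').2

end

section

variable {J G : Type} [CommGroup J] [CommGroup G] [Finite G] (ψ : J →* G)
  (hψ : Function.Injective ψ) (B : CommGreen.{u} G)

/-- The multiplication of `(i_J^* B)(U)` is that of `B(G ×_J U)`. -/
def restrictMonoidHom (U : FinGSet.{u} J) :
    B.fn.obj (FinGSet.ind ψ U) →* ((restrict ψ hψ).obj B).fn.obj U where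
  toFun x := x
  map_one' := by
    have h : ∀ y, B.fn.map (indHom ψ hψ (res (FinGSet.toPt U)))
        (B.fn.map (res (FinGSet.toPt (FinGSet.ind ψ (FinGSet.pt.{u} J)))) y) =
        B.fn.map (res (FinGSet.toPt _)) y := fun y => by
      rw [indHom_res]
      exact B.res_apply_comp (fun _ => rfl) y
    exact (h _).symm
  map_mul' x y := by
    have h : ∀ z, B.fn.map (indHom ψ hψ (res (diag U))) (B.fn.map (res (FinGSet.prodLift
        (indMap ψ hψ (FinGSet.fst U U)) (indMap ψ hψ (FinGSet.snd U U)))) z) =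
        B.fn.map (res (diag (FinGSet.ind ψ U))) z := fun z => by
      rw [indHom_res]
      refine B.res_apply_comp (fun x => ?_) z
      obtain ⟨g, t, rfl⟩ := exists_indMk ψ x
      rfl
    exact (h _).symm

end

end CommGreen

/-! ### The comparison map on pure tensors -/

section Comparison

variable {K J G : Type} [Group K] [CommGroup J] [CommGroup G] [Finite J] [Finite G]
  {ι κ : Type} [Finite ι] [Finite κ] {φ : K →* J} {ψ : J →* G} {χ : K →* G}
  (hχ : ∀ k, χ k = ψ (φ k)) (hψ : Function.Injective ψ) {π : κ → ι} {c : κ → G}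
  (hc : IsCosetFamily ψ π c) (R : CommGreen.{u} K)

/-- The map `U → F_K(J, A)` that sends `u` to `j ↦ h [1, u] (j c)`. -/
def cosetAdj (c : G) {U : FinGSet.{u} J} {A : FinGSet.{u} K}
    (h : FinGSet.ind ψ U →[G] FinGSet.coind χ A) : U →[J] FinGSet.coind φ A :=
  (cosetProj hχ c A).comp ((restrMap ψ h).comp (indUnit ψ U))

/-- A pure tensor of restricted universal elements is presented by a single restriction, so the
adjunction and the coset splitting become composition of maps of finite sets. -/
lemma cosetApp_pure {U : FinGSet.{u} J} {A : ι → FinGSet.{u} K}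
    (h : ∀ i, FinGSet.ind ψ U →[G] FinGSet.coind χ (A i)) (x : ∀ i, R.fn.obj (A i)) :
    cosetApp hχ hψ hc R U (((norm χ).obj R).pure fun i =>
        ((norm χ).obj R).resHom (h i) (normElt χ R (x i))) =
      ((norm φ).obj R).pure fun k =>
        ((norm φ).obj R).resHom (cosetAdj hχ (c k) (h (π k))) (normElt φ R (x (π k))) := by
  have h1 : (((norm χ).obj R).pure fun i =>
      ((norm χ).obj R).resHom (h i) (normElt χ R (x i))) =
      normBoxElt χ R (res (FinGSet.piLift h)) x := by
    have e := ((norm χ).obj R).bmk_res h (𝟙 _) fun i => normElt χ R (x i)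
    rw [Functor.map_id_apply, Category.comp_id] at e
    exact e.symm
  have h2 : (((norm φ).obj R).pure fun k =>
      ((norm φ).obj R).resHom (cosetAdj hχ (c k) (h (π k))) (normElt φ R (x (π k)))) =
      normBoxElt φ R (res (FinGSet.piLift fun k => cosetAdj hχ (c k) (h (π k))))
        fun k => x (π k) := by
    have e := ((norm φ).obj R).bmk_res (fun k => cosetAdj hχ (c k) (h (π k))) (𝟙 _)
      fun k => normElt φ R (x (π k))
    rw [Functor.map_id_apply, Category.comp_id] at e
    exact e.symm
  rw [h1, h2, cosetApp_normBoxElt, restrHom_res, ← res_comp, ← res_comp]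
  rfl

/-- One factor over `G` spreads out to all positions `k` above it, evaluated at the respective coset
representatives. This explicit value serves in all commuting squares. -/
lemma cosetApp_mulSingle [DecidableEq ι] {U : FinGSet.{u} J} {A : FinGSet.{u} K} (i : ι)
    (h : FinGSet.ind ψ U →[G] FinGSet.coind χ A) (x : R.fn.obj A) :
    cosetApp hχ hψ hc R U (((norm χ).obj R).pure
        (Pi.mulSingle i (((norm χ).obj R).resHom h (normElt χ R x)))) =
      ((norm φ).obj R).pure fun k => if π k = i then
        ((norm φ).obj R).resHom (cosetAdj hχ (c k) h) (normElt φ R x) else 1 := by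
  have key : ∀ i', ∃ (A' : FinGSet.{u} K) (h' : FinGSet.ind ψ U →[G] FinGSet.coind χ A')
      (x' : R.fn.obj A'), ((norm χ).obj R).resHom h' (normElt χ R x') =
        (Pi.mulSingle i (((norm χ).obj R).resHom h (normElt χ R x)) :
          ι → ((norm χ).obj R).fn.obj _) i' ∧ ∀ c : G,
        ((norm φ).obj R).resHom (cosetAdj hχ c h') (normElt φ R x') = if i' = i then
        ((norm φ).obj R).resHom (cosetAdj hχ c h) (normElt φ R x) else 1 := by
    intro i'
    by_cases hi : i' = i
    · subst hi
      exact ⟨A, h, x, by rw [Pi.mulSingle_eq_same], fun c => by rw [if_pos rfl]⟩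
    -- A unit factor is written as a restriction of the universal element on a point, so that
    -- `cosetApp_pure` covers all factors uniformly.
    · refine ⟨FinGSet.pt K, ⟨fun _ => ⟨fun _ => PUnit.unit, fun _ _ => rfl⟩, fun _ _ => rfl⟩,
        R.pairing.one, ?_, fun c => ?_⟩
      · rw [Pi.mulSingle_eq_of_ne hi]
        exact res_normElt_one χ R _
      · rw [if_neg hi]
        exact res_normElt_one φ R _
  choose A' h' x' h1 h2 using key
  have h3 := cosetApp_pure hχ hψ hc R h' x'
  simp only [h1, h2] at h3
  exact h3

end Comparison

/-! ### Multiplicative generators of a restricted box power of norms -/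

section Ext

variable {K J G : Type} [Group K] [CommGroup J] [CommGroup G] [Finite G] {ι : Type} [Finite ι]
  [Nonempty ι] {ψ : J →* G} {χ : K →* G} (hψ : Function.Injective ψ) (R : CommGreen.{u} K)

/-- Morphisms out of `i_J^* (N_K^G R)^{□ι}` are determined by their values on the generators. -/
lemma restrict_boxPow_norm_hom_ext [DecidableEq ι] {Q : CommGreen.{u} J}
    {f f' : (restrict ψ hψ).obj (boxPow ((norm χ).obj R) ι) ⟶ Q}
    (hf : ∀ (i : ι) (U : FinGSet.{u} J) (A : FinGSet.{u} K)
      (h : FinGSet.ind ψ U →[G] FinGSet.coind χ A) (x : R.fn.obj A),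
      (CommGreen.Hom.nat f).app U (((norm χ).obj R).pure
        (Pi.mulSingle i (((norm χ).obj R).resHom h (normElt χ R x)))) =
      (CommGreen.Hom.nat f').app U (((norm χ).obj R).pure
        (Pi.mulSingle i (((norm χ).obj R).resHom h (normElt χ R x))))) : f = f' := by
  let M := (norm χ).obj R
  let B := boxPow M ι
  -- Morphisms agree on an element if they agree on its restriction along the counit.
  have hnat : ∀ (g : (restrict ψ hψ).obj B ⟶ Q) {U : FinGSet.{u} G} {T : FinGSet.{u} J}
      (s : U ⟶ FinGSet.ind ψ T) (y : B.fn.obj U), (CommGreen.Hom.nat g).app T (B.fn.map s y) =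
      Q.fn.map (restrHom ψ s ≫ res (indUnit ψ T)) ((CommGreen.Hom.nat g).app _
        (B.fn.map (res (indCounit ψ U)) y)) := by
    intro g U T s y
    -- Any morphism into `G ×_J T` factors through its adjoint. This is needed because `g` is
    -- natural only for induced morphisms.
    have e : s = res (indCounit ψ U) ≫ indHom ψ hψ (restrHom ψ s ≫ res (indUnit ψ T)) :=
      ((indHomEquiv ψ hψ U T).symm_apply_apply s).symm
    have e2 := NatTrans.naturality_apply (CommGreen.Hom.nat g)
      (restrHom ψ s ≫ res (indUnit ψ T)) (B.fn.map (res (indCounit ψ U)) y)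
    refine Eq.trans ?_ e2
    refine congrArg ((CommGreen.Hom.nat g).app T) ?_
    refine (congrArg (fun s => B.fn.map s y) e).trans ?_
    exact Functor.map_comp_apply B.fn _ _ y
  -- An arbitrary single factor is a morphism applied to a universal element. That morphism acts on
  -- the whole tensor by `map_pure_mulSingle`, and `hnat` removes it at the cost of a restriction
  -- along the counit.
  have h1 : ∀ (i : ι) (U : FinGSet.{u} J) (m : M.fn.obj (FinGSet.ind ψ U)),
      (CommGreen.Hom.nat f).app U (M.pure (Pi.mulSingle i m)) =
        (CommGreen.Hom.nat f').app U (M.pure (Pi.mulSingle i m)) := by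
    intro i U m
    obtain ⟨A, s, x, rfl⟩ := exists_normElt χ R m
    have e := M.map_pure_mulSingle s i (normElt χ R x)
    have e2 := M.map_pure_mulSingle (res (indCounit ψ (FinGSet.coind χ A))) i (normElt χ R x)
    refine (congrArg ((CommGreen.Hom.nat f).app U) e.symm).trans
      (Eq.trans ?_ (congrArg ((CommGreen.Hom.nat f').app U) e))
    refine (hnat f s _).trans (Eq.trans ?_ (hnat f' s _).symm)
    refine congrArg (Q.fn.map _) ?_
    refine (congrArg ((CommGreen.Hom.nat f).app _) e2).trans
      (Eq.trans ?_ (congrArg ((CommGreen.Hom.nat f').app _) e2).symm)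
    exact hf i _ A (indCounit ψ _) x
  -- A pure tensor is the product of its single factors, and both morphisms are multiplicative.
  have h2 : ∀ (U : FinGSet.{u} J) (b : ι → M.fn.obj (FinGSet.ind ψ U)),
      (CommGreen.Hom.nat f).app U (M.pure b) = (CommGreen.Hom.nat f').app U (M.pure b) := by
    intro U b
    have := Fintype.ofFinite ι
    let F := ((CommGreen.Hom.monoidHom f U).comp
      (CommGreen.restrictMonoidHom ψ hψ B U)).comp (M.pureHom ι (FinGSet.ind ψ U))
    let F' := ((CommGreen.Hom.monoidHom f' U).comp
      (CommGreen.restrictMonoidHom ψ hψ B U)).comp (M.pureHom ι (FinGSet.ind ψ U))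
    have h3 : F = F' := MonoidHom.functions_ext _ _ _ fun i m => h1 i U m
    exact DFunLike.congr_fun h3 b
  refine CommGreen.hom_ext' (NatTrans.ext (funext fun T => ?_))
  ext y
  -- Every element is the image of a pure tensor; `hnat` reduces to its restriction along the
  -- counit, which is again pure.
  obtain ⟨U, s, b, rfl⟩ := M.exists_pure (T := FinGSet.ind ψ T) y
  refine (hnat f s _).trans (Eq.trans ?_ (hnat f' s _).symm)
  refine congrArg (Q.fn.map _) ?_
  have e := M.pure_res (indCounit ψ U) b
  refine (congrArg ((CommGreen.Hom.nat f).app _) e).trans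
    (Eq.trans ?_ (congrArg ((CommGreen.Hom.nat f').app _) e).symm)
  exact h2 _ _

end Ext

/-! ### Compatibility with structure maps and with maps of coefficients -/

section Compatibility

variable {K J G : Type} [Group K] [CommGroup J] [CommGroup G] [Finite J] [Finite G]
  {φ : K →* J} {ψ : J →* G} {χ : K →* G}

/-- Group elements act on coinduced sets by right translation, so both sides evaluate `h [1, u]` at
a point of `G`: one at `ψ j * c' * γ`, the other at `ψ j * c * ψ γ'`. These agree by `hc` and
commutativity. -/
lemma resHom_cosetAdj_act (hχ : ∀ k, χ k = ψ (φ k)) {c c' γ : G} {γ' : J}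
    (hc : c' * γ = ψ γ' * c) (R : CommGreen.{u} K) {U : FinGSet.{u} J} {A : FinGSet.{u} K}
    (h : FinGSet.ind ψ U →[G] FinGSet.coind χ A) (y : ((norm φ).obj R).fn.obj (FinGSet.coind φ A)) :
    ((norm φ).obj R).resHom (cosetAdj hχ c' (h.comp (FinGSet.lmul γ _))) y =
      ((norm φ).obj R).act γ' U (((norm φ).obj R).resHom (cosetAdj hχ c h) y) := by
  refine (((norm φ).obj R).res_apply_comp (f := FinGSet.lmul γ' U) (g := cosetAdj hχ c h)
    (h := cosetAdj hχ c' (h.comp (FinGSet.lmul γ _))) (fun u => ?_) y).symm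
  refine Subtype.ext (funext fun j => ?_)
  have h1 : indMk ψ 1 (γ' • u) = ψ γ' • indMk ψ 1 u := map_smul (indUnit ψ U) γ' u
  change (h (indMk ψ 1 (γ' • u))).1 (ψ j * c) = (h (γ • indMk ψ 1 u)).1 (ψ j * c')
  rw [h1, map_smul, map_smul]
  refine congrArg (h (indMk ψ 1 u)).1 (a₁ := ψ j * c * ψ γ') (a₂ := ψ j * c' * γ) ?_
  rw [mul_assoc, mul_assoc, hc, mul_comm c]

/-- The comparison maps are compatible with the maps between box powers. -/
lemma restrict_boxMap_cosetHom (hχ : ∀ k, χ k = ψ (φ k)) (hψ : Function.Injective ψ)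
    {ι ι' κ κ' : Type} [Fintype ι] [Fintype κ] [Finite ι'] [Finite κ'] [Nonempty ι] [Nonempty ι']
    [Nonempty κ] [Nonempty κ'] [DecidableEq ι'] [DecidableEq κ'] {π : κ → ι} {π' : κ' → ι'}
    {c : κ → G} {c' : κ' → G} (hc : IsCosetFamily ψ π c) (hc' : IsCosetFamily ψ π' c')
    (R : CommGreen.{u} K) {α : ι → ι'} {γ : ι → G} {α' : κ → κ'} {γ' : κ → J}
    (hα : ∀ k, π' (α' k) = α (π k)) (hγ : ∀ k, c' (α' k) * γ (π k) = ψ (γ' k) * c k) :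
    (restrict ψ hψ).map (((norm χ).obj R).boxMap α γ) ≫ cosetHom hχ hψ hc' R =
      cosetHom hχ hψ hc R ≫ ((norm φ).obj R).boxMap α' γ' := by
  classical
  refine restrict_boxPow_norm_hom_ext hψ R fun i U A h x => ?_
  let M := (norm χ).obj R
  let P := (norm φ).obj R
  let y := normElt φ R x
  have e1 : (M.thetaNat α γ).app (FinGSet.ind ψ U) (M.pure
      (Pi.mulSingle i (M.resHom h (normElt χ R x)))) = M.pure (Pi.mulSingle (α i)
        (M.resHom (h.comp (FinGSet.lmul (γ i) _)) (normElt χ R x))) := by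
    refine (M.thetaNat_pure α γ _).trans (congrArg M.pure ?_)
    refine (M.comb_mulSingle α γ i _).trans (congrArg (Pi.mulSingle (α i)) ?_)
    exact M.res_apply_comp (f := FinGSet.lmul (γ i) _) (g := h)
      (h := h.comp (FinGSet.lmul (γ i) _)) (fun _ => rfl) (normElt χ R x)
  have e2 : (P.thetaNat α' γ').app U (P.pure fun k => if π k = i then
        P.resHom (cosetAdj hχ (c k) h) y else 1) = P.pure fun k' => if π' k' = α i then
        P.resHom (cosetAdj hχ (c' k') (h.comp (FinGSet.lmul (γ i) _))) y else 1 := by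
    refine (P.thetaNat_pure α' γ' _).trans (congrArg P.pure (funext fun k' => ?_))
    rw [CommGreen.comb]
    by_cases hk' : π' k' = α i
    · rw [if_pos hk']
      -- Only one `k` over `i` can contribute to position `k'`: the one whose coset contains `c' k'
      -- * γ i`. The product over the fibre of `α'` then has a single nontrivial factor.
      obtain ⟨⟨j, k⟩, ⟨hk1, hk2⟩, hu⟩ := hc i (c' k' * γ i)
      dsimp only at hk1 hk2
      -- By `hγ`, the representatives of `α' k` and `k'` lie in the same coset, so uniqueness in
      -- `hc'` identifies the two positions.
      have hk3 : α' k = k' := by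
        have h1 : ψ (j * (γ' k)⁻¹) * c' (α' k) = c' k' := by
          have := hγ k
          rw [hk1] at this
          rw [← mul_left_inj (γ i), ← hk2, mul_assoc, this, map_mul, map_inv]
          group
        have h2 := (hc' (π' k') (c' k')).unique (y₁ := (j * (γ' k)⁻¹, α' k)) (y₂ := (1, k'))
          ⟨by rw [hα, hk1, hk'], h1⟩ ⟨rfl, by rw [map_one, one_mul]⟩
        exact congrArg Prod.snd h2
      rw [Finset.prod_eq_single k]
      · rw [if_pos hk1, ← hk3]
        exact (resHom_cosetAdj_act hχ (by rw [← hγ, hk1]) R h y).symm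
      -- Another position over `i` landing at `k'` would give a second coset decomposition of the
      -- same element, by `hγ`.
      · intro k₁ hk₁ hne
        by_cases hi : π k₁ = i
        · refine absurd ?_ hne
          have h1 := hu (γ' k₁, k₁) ⟨hi, by rw [← hγ, hi, (Finset.mem_filter.1 hk₁).2]⟩
          exact congrArg Prod.snd h1
        · rw [if_neg hi, map_one]
      · intro h
        exact absurd (Finset.mem_filter (p := fun k => α' k = k').2 ⟨Finset.mem_univ k, hk3⟩) h
    -- By `hα`, no position over `i` lands at such a `k'`, so only units are multiplied.
    · rw [if_neg hk']
      refine Finset.prod_eq_one fun k hk => ?_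
      rw [if_neg, map_one]
      rintro rfl
      exact hk' ((congrArg π' (Finset.mem_filter.1 hk).2).symm.trans (hα k))
  refine (congrArg (cosetApp hχ hψ hc' R U) e1).trans ?_
  refine (cosetApp_mulSingle hχ hψ hc' R (α i) _ x).trans (e2.symm.trans ?_)
  exact congrArg ((P.thetaNat α' γ').app U) (cosetApp_mulSingle hχ hψ hc R i h x).symm

lemma norm_map_normElt {L : Type} [CommGroup L] [Finite L] (θ : K →* L) {R R' : CommGreen.{u} K}
    (f : R ⟶ R') {A : FinGSet.{u} K} (x : R.fn.obj A) {U : FinGSet.{u} L}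
    (h : U →[L] FinGSet.coind θ A) :
    CommGreen.Hom.monoidHom ((norm θ).map f) U (((norm θ).obj R).resHom h (normElt θ R x)) =
      ((norm θ).obj R').resHom h (normElt θ R' ((CommGreen.Hom.nat f).app A x)) := by
  refine (NatTrans.naturality_apply (CommGreen.Hom.nat ((norm θ).map f)) (res h)
    (normElt θ R x)).trans ?_
  have e : (CommGreen.Hom.nat ((norm θ).map f)).app (FinGSet.coind θ A) (normElt θ R x) =
      normElt θ R' ((CommGreen.Hom.nat f).app A x) :=
    Lan.mapNat_mk (F := (coind θ).burnside) (CommGreen.Hom.nat f) (𝟙 _) x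
  exact congrArg (fun z => ((norm θ).obj R').fn.map (res h) z) e

/-- The comparison maps are natural. -/
lemma restrict_powMap_cosetHom (hχ : ∀ k, χ k = ψ (φ k)) (hψ : Function.Injective ψ)
    {ι κ : Type} [Finite ι] [Finite κ] [Nonempty ι] [Nonempty κ] {π : κ → ι}
    {c : κ → G} (hc : IsCosetFamily ψ π c) {R R' : CommGreen.{u} K} (f : R ⟶ R') :
    (restrict ψ hψ).map (CommGreen.powMap ι ((norm χ).map f)) ≫ cosetHom hχ hψ hc R' =
      cosetHom hχ hψ hc R ≫ CommGreen.powMap κ ((norm φ).map f) := by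
  classical
  refine restrict_boxPow_norm_hom_ext hψ R fun i U A h x => ?_
  let M := (norm χ).obj R
  let M' := (norm χ).obj R'
  let P := (norm φ).obj R
  let P' := (norm φ).obj R'
  let x' := (CommGreen.Hom.nat f).app A x
  have e1 : (CommGreen.powNat ι ((norm χ).map f)).app (FinGSet.ind ψ U) (M.pure
      (Pi.mulSingle i (M.resHom h (normElt χ R x)))) = M'.pure (Pi.mulSingle i
        (M'.resHom h (normElt χ R' x'))) := by
    refine (CommGreen.powNat_pure ((norm χ).map f) _).trans (congrArg M'.pure (funext fun k => ?_))
    refine (Pi.apply_mulSingle (fun _ => CommGreen.Hom.monoidHom ((norm χ).map f) _)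
      (fun _ => map_one _) i _ k).trans ?_
    exact congrArg (fun z => (Pi.mulSingle i z : ι → M'.fn.obj _) k) (norm_map_normElt χ f x h)
  have e2 : (CommGreen.powNat κ ((norm φ).map f)).app U (P.pure fun k => if π k = i then
        P.resHom (cosetAdj hχ (c k) h) (normElt φ R x) else 1) = P'.pure fun k => if π k = i then
        P'.resHom (cosetAdj hχ (c k) h) (normElt φ R' x') else 1 := by
    refine (CommGreen.powNat_pure ((norm φ).map f) _).trans (congrArg P'.pure (funext fun k => ?_))
    split_ifs
    · exact norm_map_normElt φ f x _
    · exact map_one _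
  refine (congrArg (cosetApp hχ hψ hc R' U) e1).trans ?_
  refine (cosetApp_mulSingle hχ hψ hc R' i h x').trans (e2.symm.trans ?_)
  exact congrArg ((CommGreen.powNat κ ((norm φ).map f)).app U)
    (cosetApp_mulSingle hχ hψ hc R i h x).symm

end Compatibility

/-! ## The comparison of the nerves -/

section Subdivision

lemma sd_div {n a b : ℕ} (hb : b < n + 1) : (a * (n + 1) + b) / (n + 1) = a := by
  rw [Nat.mul_comm, Nat.mul_add_div n.succ_pos, Nat.div_eq_of_lt hb, Nat.add_zero]

lemma sd_mod {n a b : ℕ} (hb : b < n + 1) : (a * (n + 1) + b) % (n + 1) = b := by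
  rw [Nat.mul_comm, Nat.mul_add_mod, Nat.mod_eq_of_lt hb]

/-- The index `a(n + 1) + b` of a simplex of the subdivision. -/
def sdIdx (r : ℕ+) {n : ℕ} (a : Fin r) (b : Fin (n + 1)) : Fin (r * (n + 1) - 1 + 1) :=
  ⟨a * (n + 1) + b, sd_lt a.isLt b.isLt⟩

/-- The projection `a(n + 1) + b ↦ b`. -/
def sdMod (r : ℕ+) {n : ℕ} (k : Fin (r * (n + 1) - 1 + 1)) : Fin (n + 1) :=
  ⟨k % (n + 1), Nat.mod_lt _ n.succ_pos⟩

/-- The projection `a(n + 1) + b ↦ a`. -/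
def sdDiv (r : ℕ+) {n : ℕ} (k : Fin (r * (n + 1) - 1 + 1)) : Fin r :=
  ⟨k / (n + 1), lt_mul_of_lt k.isLt r.pos⟩

lemma sdMod_sdIdx (r : ℕ+) {n : ℕ} (a : Fin r) (b : Fin (n + 1)) : sdMod r (sdIdx r a b) = b :=
  Fin.ext (sd_mod b.isLt)

lemma sdDiv_sdIdx (r : ℕ+) {n : ℕ} (a : Fin r) (b : Fin (n + 1)) : sdDiv r (sdIdx r a b) = a :=
  Fin.ext (sd_div b.isLt)

lemma sdIdx_sdDiv_sdMod (r : ℕ+) {n : ℕ} (k : Fin (r * (n + 1) - 1 + 1)) :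
    sdIdx r (sdDiv r k) (sdMod r k) = k :=
  Fin.ext (Nat.div_add_mod' (k : ℕ) (n + 1))

/-- The order on positions is lexicographic, block first, because the offset in a block is less than
`n + 1`. -/
lemma sdIdx_le (r : ℕ+) {n : ℕ} {a a' : Fin r} {b b' : Fin (n + 1)} :
    sdIdx r a b ≤ sdIdx r a' b' ↔ a < a' ∨ a = a' ∧ b ≤ b' := by
  rw [sdIdx, sdIdx, Fin.mk_le_mk, Fin.lt_def, Fin.ext_iff, Fin.le_def]
  rcases lt_trichotomy (a : ℕ) a' with h | h | h
  · have h3 := Nat.mul_le_mul_right (n + 1) (Nat.succ_le_of_lt h)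
    rw [Nat.succ_mul] at h3
    omega
  · rw [h]
    omega
  · have h3 := Nat.mul_le_mul_right (n + 1) (Nat.succ_le_of_lt h)
    rw [Nat.succ_mul] at h3
    omega

/-- The `r`-fold concatenation of a monotone map with itself. -/
abbrev sdMap (r : ℕ+) {m n : ℕ} (α : Fin (m + 1) →o Fin (n + 1)) :
    Fin (r * (m + 1) - 1 + 1) →o Fin (r * (n + 1) - 1 + 1) :=
  ((sdFunctor r).map (SimplexCategory.Hom.mk (a := .mk m) (b := .mk n) α)).toOrderHom

lemma sdMap_sdIdx (r : ℕ+) {m n : ℕ} (α : Fin (m + 1) →o Fin (n + 1)) (a : Fin r)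
    (b : Fin (m + 1)) : sdMap r α (sdIdx r a b) = sdIdx r a (α b) := by
  have h : sdMap r α (sdIdx r a b) =
    sdIdx r (sdDiv r (sdIdx r a b)) (α (sdMod r (sdIdx r a b))) := rfl
  rw [h, sdDiv_sdIdx, sdMod_sdIdx]

lemma sdIdx_le_sdMap (r : ℕ+) {m n : ℕ} (α : Fin (m + 1) →o Fin (n + 1)) {a a' : Fin r}
    {b : Fin (n + 1)} {b' : Fin (m + 1)} :
    sdIdx r a b ≤ sdMap r α (sdIdx r a' b') ↔ a < a' ∨ a = a' ∧ b ≤ α b' := by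
  rw [sdMap_sdIdx, sdIdx_le]

lemma exists_sdIdx (r : ℕ+) {n : ℕ} {p : Fin (r * (n + 1) - 1 + 1) → Prop} :
    (∃ k, p k) ↔ ∃ a b, p (sdIdx r a b) :=
  ⟨fun ⟨k, hk⟩ => ⟨sdDiv r k, sdMod r k, (sdIdx_sdDiv_sdMod r k).symm ▸ hk⟩,
    fun ⟨_, _, h⟩ => ⟨_, h⟩⟩

/-- A factor that does not pass the end in the original nerve stays in its own block. -/
lemma cycIdx_sdMap_of_exists (r : ℕ+) {m n : ℕ} {α : Fin (m + 1) →o Fin (n + 1)} (a : Fin r)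
    {b : Fin (n + 1)} (h : ∃ i, b ≤ α i) :
    (∃ k, sdIdx r a b ≤ sdMap r α k) ∧
      cycIdx (sdMap r α) (sdIdx r a b) = sdIdx r a (cycIdx α b) := by
  have h' : ∃ k, sdIdx r a b ≤ sdMap r α k :=
    h.elim fun i hi => ⟨sdIdx r a i, (sdIdx_le_sdMap r α).2 (.inr ⟨rfl, hi⟩)⟩
  refine ⟨h', eq_of_forall_ge_iff fun k => ?_⟩
  rw [cycIdx_le h', ← sdIdx_sdDiv_sdMod r k, sdIdx_le_sdMap, sdIdx_le, cycIdx_le h]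

/-- A factor that passes the end of a block other than the last one goes to the start of the next
block. In the subdivision this is an interior move, so no group element acts. -/
lemma cycIdx_sdMap_of_lt (r : ℕ+) {m n : ℕ} {α : Fin (m + 1) →o Fin (n + 1)} {a a' : Fin r}
    (ha : (a : ℕ) + 1 = a') {b : Fin (n + 1)} (h : ¬ ∃ i, b ≤ α i) :
    (∃ k, sdIdx r a b ≤ sdMap r α k) ∧
      cycIdx (sdMap r α) (sdIdx r a b) = sdIdx r a' 0 := by
  have h' : ∃ k, sdIdx r a b ≤ sdMap r α k :=
    ⟨sdIdx r a' 0, (sdIdx_le_sdMap r α).2 (.inl (Fin.lt_def.2 (by omega)))⟩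
  refine ⟨h', eq_of_forall_ge_iff fun k => ?_⟩
  rw [cycIdx_le h', ← sdIdx_sdDiv_sdMod r k, sdIdx_le_sdMap, sdIdx_le]
  have h1 : ¬ b ≤ α (sdMod r k) := fun hk => h ⟨_, hk⟩
  simp only [h1, and_false, or_false, Fin.zero_le, and_true, Fin.lt_def, Fin.ext_iff]
  omega

/-- After the last block there is no next one, so passing its end means going around the end of the
subdivided simplex. -/
lemma not_exists_le_sdMap (r : ℕ+) {m n : ℕ} {α : Fin (m + 1) →o Fin (n + 1)} {a : Fin r}
    (ha : (a : ℕ) + 1 = r) {b : Fin (n + 1)} (h : ¬ ∃ i, b ≤ α i) :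
    ¬ ∃ k, sdIdx r a b ≤ sdMap r α k := by
  rw [exists_sdIdx r]
  rintro ⟨a', b', h'⟩
  rcases (sdIdx_le_sdMap r α).1 h' with h1 | ⟨-, h1⟩
  · have := Fin.lt_def.1 h1
    have := a'.isLt
    omega
  · exact h ⟨_, h1⟩

/-- The twist by `j₀` of the subdivision refines the twist by `g`, if `j₀` maps to `gʳ`. -/
lemma sdMod_cycIdx {J G : Type} [CommGroup J] [CommGroup G] {ψ : J →* G} {g : G} {j₀ : J} {r : ℕ+}
    (hg : ψ j₀ = g ^ (r : ℕ)) {m n : ℕ} (α : Fin (m + 1) →o Fin (n + 1))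
    (k : Fin (r * (n + 1) - 1 + 1)) :
    sdMod r (cycIdx (sdMap r α) k) = cycIdx α (sdMod r k) ∧
      g ^ (r - 1 - sdDiv r (cycIdx (sdMap r α) k) : ℕ) * cycLabel g α (sdMod r k) =
        ψ (cycLabel j₀ (sdMap r α) k) * g ^ (r - 1 - sdDiv r k : ℕ) := by
  obtain ⟨a, b, rfl⟩ : ∃ a b, sdIdx r a b = k := ⟨_, _, sdIdx_sdDiv_sdMod r k⟩
  rw [sdMod_sdIdx, sdDiv_sdIdx]
  by_cases h : ∃ i, b ≤ α i
  -- Within a block, neither the representative nor a label changes.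
  · obtain ⟨h1, h2⟩ := cycIdx_sdMap_of_exists r a h
    rw [h2, sdMod_sdIdx, sdDiv_sdIdx, cycLabel, cycLabel, if_pos h, if_pos h1, map_one, one_mul,
      mul_one]
    exact ⟨rfl, rfl⟩
  · have ha := a.isLt
    rcases (Nat.succ_le_of_lt ha).lt_or_eq with h' | h'
    -- Moving to the next block: `g^(r-1-(a+1)) * g = g^(r-1-a)`, which cancels the label `g` of the
    -- original nerve. This is the reason for the decreasing exponents.
    · obtain ⟨h1, h2⟩ := cycIdx_sdMap_of_lt (a' := ⟨a + 1, h'⟩) r rfl h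
      rw [h2, sdMod_sdIdx, sdDiv_sdIdx, cycLabel, cycLabel, if_neg h, if_pos h1, map_one, one_mul,
        cycIdx_neg h, ← pow_succ]
      exact ⟨rfl, congrArg (g ^ ·) (by dsimp only; omega)⟩
    -- Going around from block `r-1`, with representative `1`, to position `0` in block `0`, with
    -- representative `g^(r-1)`: here `g^(r-1) * g = g^r` is the image of the label `j₀`.
    · have h1 := not_exists_le_sdMap r h' h
      have h2 : sdDiv r (0 : Fin (r * (m + 1) - 1 + 1)) = ⟨0, r.pos⟩ := Fin.ext (Nat.zero_div _)
      rw [cycLabel, cycLabel, cycIdx_neg h, cycIdx_neg h1, if_neg h, if_neg h1, hg, h2, ← pow_succ,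
        ← pow_add]
      exact ⟨Fin.ext (Nat.zero_mod _), congrArg (g ^ ·) (by dsimp only; omega)⟩

/-- As the block `a` runs through `0, …, r-1`, so does the exponent `r-1-a`; hence for each offset
the representatives are `1, g, …, g^(r-1)` in reverse order. The reversal of `Fin r` carries this
over from `hb`. -/
lemma isCosetFamily_sd {J G : Type} [CommGroup J] [CommGroup G] [Finite J] [Finite G] {ψ : J →* G}
    {g : G} {r : ℕ+}
    (hb : Function.Bijective fun p : J × Fin r => ψ p.1 * g ^ (p.2 : ℕ)) (n : ℕ) :
    IsCosetFamily ψ (sdMod r (n := n)) fun k => g ^ (r - 1 - sdDiv r k : ℕ) := by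
  intro i x
  obtain ⟨⟨j, a⟩, hx⟩ := hb.2 x
  have e : ∀ b : Fin r, r - 1 - (b.rev : ℕ) = b := fun b => by
    rw [Fin.val_rev]
    omega
  refine ⟨(j, sdIdx r a.rev i), ⟨sdMod_sdIdx _ _ _, ?_⟩, ?_⟩
  · dsimp only
    rw [sdDiv_sdIdx, e]
    exact hx
  · rintro ⟨j', k⟩ ⟨rfl, h⟩
    have h1 := @hb.1 (j', (sdDiv r k).rev) (j, a) (by
      refine Eq.trans ?_ (h.trans hx.symm)
      refine congrArg (fun z => ψ j' * g ^ z) ?_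
      have h2 := (sdDiv r k).isLt
      dsimp only
      rw [Fin.val_rev]
      omega)
    obtain ⟨rfl, rfl⟩ := Prod.mk.inj h1
    rw [Fin.rev_rev, sdIdx_sdDiv_sdMod]

end Subdivision

/-! ### Assembly of the natural simplicial comparison map -/

section Comparison

variable {K J G : Type} [Group K] [CommGroup J] [CommGroup G] [Finite J] [Finite G]
  {φ : K →* J} {ψ : J →* G} {χ : K →* G}

/-- The comparison of the restricted nerve with the subdivided nerve. -/
noncomputable def nerveComparison (hχ : ∀ k, χ k = ψ (φ k)) (hψ : Function.Injective ψ) {g : G}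
    {j₀ : J} {r : ℕ+} (hg : ψ j₀ = g ^ (r : ℕ))
    (hb : Function.Bijective fun p : J × Fin r => ψ p.1 * g ^ (p.2 : ℕ)) :
    (norm.{u} χ ⋙ nerve g) ⋙ (SimplicialObject.whiskering _ _).obj (restrict ψ hψ) ⟶
      (norm.{u} φ ⋙ nerve j₀) ⋙ sd _ r where
  app R :=
    { app := fun n => cosetHom hχ hψ (isCosetFamily_sd hb n.unop.len) R
      naturality := fun n m α =>
        restrict_boxMap_cosetHom hχ hψ (isCosetFamily_sd hb n.unop.len)
          (isCosetFamily_sd hb m.unop.len) R (fun k => (sdMod_cycIdx hg α.unop.toOrderHom k).1)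
          fun k => (sdMod_cycIdx hg α.unop.toOrderHom k).2 }
  naturality _ _ f := NatTrans.ext (funext fun n =>
    restrict_powMap_cosetHom hχ hψ (isCosetFamily_sd hb n.unop.len) f)

end Comparison

/-- A map of simplicial Mackey functors that is bijective on all values is a quasi-isomorphism. -/
lemma isQuasiIso_of_bijective {G : Type} [Group G] {X Y : SimplicialObject (Mack.{u, w} G)}
    (f : X ⟶ Y) (hf : ∀ n T, Function.Bijective ((f.app n).hom.app T)) : IsQuasiIso f := by
  intro T
  have h : ∀ n, IsIso ((((SimplicialObject.whiskering _ _).obj (evalAb T)).map f).app n) :=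
    fun n => (ConcreteCategory.isIso_iff_bijective _).2 (hf n T)
  have h' : IsIso (((SimplicialObject.whiskering _ _).obj (evalAb T)).map f) :=
    NatIso.isIso_of_isIso_app _
  infer_instance

/-! ### Standard generators of finite subgroups of the circle -/

section Circle

/-- In `ℂ` the generator is the standard primitive root of unity, and the embedding of `G` into `ℂ`
preserves orders. -/
lemma orderOf_gen (G : Subgroup Circle) [Finite G] : orderOf (gen G) = Nat.card G := by
  have h := (Complex.isPrimitiveRoot_exp (Nat.card G) Nat.card_pos.ne').eq_orderOf
  rw [h]
  have h2 := orderOf_injective (Circle.coeHom.comp G.subtype)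
    (Circle.coe_injective.comp Subtype.coe_injective) (gen G)
  rw [← h2]
  refine congrArg orderOf ?_
  change ((Circle.exp (2 * Real.pi / Nat.card G) : Circle) : ℂ) = _
  rw [Circle.coe_exp]
  push_cast
  congr 1
  ring

lemma card_mul_index {J G : Subgroup Circle} [Finite G] (h : J ≤ G) :
    Nat.card J * (index J G : ℕ) = Nat.card G := by
  rw [← Subgroup.relIndex_bot_left, ← Subgroup.relIndex_bot_left]
  exact Subgroup.relIndex_mul_relIndex _ _ _ bot_le h

/-- `|G| = |J| · [G : J]`, so the power multiplies the angle `2π/|G|` to `2π/|J|`. This relation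
between the standard generators makes the label of the `J`-nerve fit the subdivision. -/
lemma inclusion_gen {J G : Subgroup Circle} [Finite J] [Finite G] (h : J ≤ G) :
    Subgroup.inclusion h (gen J) = gen G ^ (index J G : ℕ) := by
  refine Subtype.ext ?_
  change Circle.exp (2 * Real.pi / Nat.card J) = Circle.exp (2 * Real.pi / Nat.card G) ^ _
  have h1 : (Nat.card J : ℝ) ≠ 0 := by exact_mod_cast Nat.card_pos.ne'
  have h2 : ((index J G : ℕ) : ℝ) ≠ 0 := by exact_mod_cast (index J G).pos.ne'
  rw [← Circle.exp_nsmul, nsmul_eq_mul, ← card_mul_index h]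
  push_cast
  congr 1
  field_simp

/-- Division with remainder of the exponent by `[G : J]` writes each power of the generator as an
element of `J` times a small power. Injectivity then follows by counting. -/
lemma bijective_inclusion_mul_gen_pow {J G : Subgroup Circle} [Finite J] [Finite G] (h : J ≤ G) :
    Function.Bijective fun p : J × Fin (index J G) =>
      Subgroup.inclusion h p.1 * gen G ^ (p.2 : ℕ) := by
  refine Function.Surjective.bijective_of_nat_card_le (fun x => ?_) ?_
  -- The powers of `gen G` fill all of `G`, and in a finite group natural exponents suffice.
  · have htop := Subgroup.eq_top_of_card_eq _ ((Nat.card_zpowers _).trans (orderOf_gen G))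
    obtain ⟨k, rfl⟩ : x ∈ Submonoid.powers (gen G) :=
      mem_powers_iff_mem_zpowers.2 (htop ▸ Subgroup.mem_top x)
    refine ⟨(gen J ^ (k / index J G), ⟨k % index J G, Nat.mod_lt _ (index J G).pos⟩), ?_⟩
    dsimp only
    rw [map_pow, inclusion_gen, ← pow_mul, ← pow_add, Nat.div_add_mod]
  · rw [Nat.card_prod, Nat.card_fin, card_mul_index h]

end Circle

end TwistedNerve

theorem mainTheorem11 (H J G : Subgroup Circle) [Finite J] [Finite G]
    (hHJ : H ≤ J) (hJG : J ≤ G) :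
    ∃ η : relNerve.{u} (hHJ.trans hJG) ⋙ (SimplicialObject.whiskering _ _).obj
          (restrict (Subgroup.inclusion hJG) (Subgroup.inclusion_injective hJG)) ⟶
        relNerve.{u} hHJ ⋙ sd _ (index J G),
      ∀ R : CommGreen.{u} H,
        IsQuasiIso (((SimplicialObject.whiskering _ _).obj (greenToMack J)).map (η.app R)) :=
  ⟨nerveComparison (fun _ => rfl) (Subgroup.inclusion_injective hJG) (inclusion_gen hJG)
      (bijective_inclusion_mul_gen_pow hJG),
    -- The comparison is bijective on every value in every degree, so already the map of simplicial
    -- Mackey functors is invertible.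
    fun R => isQuasiIso_of_bijective _ fun n T =>
      cosetApp_bijective (φ := Subgroup.inclusion hHJ) (χ := Subgroup.inclusion (hHJ.trans hJG))
        (fun _ => rfl) (Subgroup.inclusion_injective hJG)
        (isCosetFamily_sd (bijective_inclusion_mul_gen_pow hJG) n.unop.len) R T⟩
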